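/- Let $n\ge 1$, let $M$ be a closed smooth manifold of dimension $2n-1$, and let $\xi$ be a co-oriented contact structure on $M$. A defining contact form for $\xi$ is a smooth 1-form $\alpha$ such that $\alpha\wedge(d\alpha)^{n-1}$ is a volume form, $\xi=\ker\alpha$, and $\alpha$ is positive on the vectors that are positively transverse to $\xi$; its Reeb vector field $R_\alpha$ is given by $d\alpha(R_\alpha,\cdot)=0$, $\alpha(R_\alpha)=1$, and $\phi^t_\alpha$ denotes the flow of $R_\alpha$. Let $\mathrm{Cont}(M,\xi)$ be the group of smooth diffeomorphisms of $M$ that preserve the co-oriented contact structure $\xi$, and let $\mathrm{cont}^+(M,\xi)$ be the set of smooth vector fields on $M$ whose flow preserves $\xi$ and which are positively transverse to $\xi$. Each $X\in\mathrm{cont}^+(M,\xi)$ is the Reeb vector field of a unique defining contact form $\alpha$ for $\xi$, and we set $$V(X):=\Big(\int_M\alpha\wedge(d\alpha)^{n-1}\Big)^{-1/n},$$ where $M$ is oriented by $\alpha\wedge(d\alpha)^{n-1}$. A smooth path $\{\phi^t\}_{t\in[0,T]}$ in $\mathrm{Cont}(M,\xi)$ is generated by the vector fields $X_t$ with $\frac{d}{dt}\phi^t=X_t\circ\phi^t$;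 it is positive if $X_t\in\mathrm{cont}^+(M,\xi)$ for every $t\in[0,T]$, and then $\mathrm{length}_V(\{\phi^t\}_{t\in[0,T]}):=\int_0^T V(X_t)\,dt$. **Theorem.** Let $\alpha_0$ be a Zoll contact form defining $\xi$, that is, there is $T_0>0$ such that all the orbits of the Reeb flow $\phi^t_{\alpha_0}$ are periodic with minimal period $T_0$. Then there exist $\epsilon>0$ and a smooth one-parameter family $\{\phi_s\}_{s\in(-\epsilon,\epsilon)}$ of positive paths $\phi_s:[0,T_0]\to\mathrm{Cont}(M,\xi)$ (smooth meaning that the map $(s,t,x)\mapsto\phi_s(t)(x)$ is smooth on $(-\epsilon,\epsilon)\times[0,T_0]\times M$) such that $\phi_0(t)=\phi^t_{\alpha_0}$ for every $t\in[0,T_0]$, such that $$\phi_s(0)=\mathrm{id}\quad\text{and}\quad \mathrm{length}_V(\phi_s)=\mathrm{length}_V\big(\{\phi^t_{\alpha_0}\}_{t\in[0,T_0]}\big)\qquad\text{for every } s\in(-\epsilon,\epsilon),$$ and such that $\phi_s(t)$ has no fixed points for every $s\in(-\epsilon,\epsilon)\setminus\{0\}$ and every $t\in(0,T_0]$. -/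

import Mathlib

open scoped Manifold ContDiff Bundle
open Set MeasureTheory

namespace ContactLF

/-- The model space `ℝ^{2m+1}` of contact manifolds of dimension `2m+1 = 2n-1`, where `n = m+1`. -/
abbrev Model (m : ℕ) : Type := EuclideanSpace ℝ (Fin (2 * m + 1))

section Forms

variable (m : ℕ) (M : Type*) [TopologicalSpace M] [ChartedSpace (Model m) M]

/-- (Not necessarily smooth) vector fields on `M`. -/
abbrev VField : Type _ := (x : M) → TangentSpace (𝓡 (2 * m + 1)) x

/-- (Not necessarily smooth) differential 1-forms on `M`. -/
abbrev OneForm : Type _ := (x : M) → TangentSpace (𝓡 (2 * m + 1)) x →L[ℝ] ℝ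

end Forms

section Basic

variable {m : ℕ} {M : Type*} [TopologicalSpace M] [ChartedSpace (Model m) M]

/-- Smoothness of a vector field, as a section of the tangent bundle. -/
def SmoothVField [IsManifold (𝓡 (2 * m + 1)) ∞ M] (X : VField m M) : Prop :=
  ContMDiff (𝓡 (2 * m + 1)) ((𝓡 (2 * m + 1)).prod 𝓘(ℝ, Model m)) ∞
    (fun x => (Bundle.TotalSpace.mk' (Model m) x (X x) : TangentBundle (𝓡 (2 * m + 1)) M))

/-- Smoothness of a 1-form, as a section of the cotangent bundle. -/
def SmoothOneForm [IsManifold (𝓡 (2 * m + 1)) ∞ M] (α : OneForm m M) : Prop :=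
  ContMDiff (𝓡 (2 * m + 1)) ((𝓡 (2 * m + 1)).prod 𝓘(ℝ, Model m →L[ℝ] ℝ)) ∞
    (fun x => Bundle.TotalSpace.mk' (Model m →L[ℝ] ℝ)
      (E := fun y : M => TangentSpace (𝓡 (2 * m + 1)) y →L[ℝ] Bundle.Trivial M ℝ y) x (α x))

/-- The expression of the 1-form `α` in the chart at `c`, i.e. its pull-back by the inverse of that
chart. -/
noncomputable def localForm (α : OneForm m M) (c : M) (y : Model m) : Model m [⋀^Fin 1]→L[ℝ] ℝ :=
  ContinuousAlternatingMap.ofSubsingleton ℝ (Model m) ℝ (0 : Fin 1)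
    ((α ((extChartAt (𝓡 (2 * m + 1)) c).symm y)).comp
      (mfderiv 𝓘(ℝ, Model m) (𝓡 (2 * m + 1)) (extChartAt (𝓡 (2 * m + 1)) c).symm y))

/-- The exterior derivative `dα` at `x`, evaluated on two tangent vectors; computed in the chart
at `x`, with the convention `dα(X,Y) = X(α(Y)) - Y(α(X)) - α([X,Y])` (standard bracket). -/
noncomputable def dForm (α : OneForm m M) (x : M) (u v : TangentSpace (𝓡 (2 * m + 1)) x) : ℝ :=
  extDeriv (localForm α x) (extChartAt (𝓡 (2 * m + 1)) x x)
    ![mfderiv (𝓡 (2 * m + 1)) 𝓘(ℝ, Model m) (extChartAt (𝓡 (2 * m + 1)) x) x u,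
      mfderiv (𝓡 (2 * m + 1)) 𝓘(ℝ, Model m) (extChartAt (𝓡 (2 * m + 1)) x) x v]

/-- The value of the wedge product `a ∧ b ∧ ⋯ ∧ b` (`m` factors `b`), where `a` is a linear form and
`b` an alternating bilinear form, on a family of `2m+1` vectors (normalization of the wedge product:
`(dx ∧ dy)(∂_x, ∂_y) = 1`). -/
noncomputable def wedgeTop {V : Type*} (m : ℕ) (a : V → ℝ) (b : V → V → ℝ)
    (v : Fin (2 * m + 1) → V) : ℝ :=
  (2 ^ m : ℝ)⁻¹ * ∑ σ : Equiv.Perm (Fin (2 * m + 1)), ((Equiv.Perm.sign σ : ℤ) : ℝ) *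
    (a (v (σ 0)) * ∏ j : Fin m,
      b (v (σ ⟨2 * (j : ℕ) + 1, by omega⟩)) (v (σ ⟨2 * (j : ℕ) + 2, by omega⟩)))

/-- The top-degree form `α ∧ (dα)^{n-1}`, `n - 1 = m`, at `x`. -/
noncomputable def topForm (α : OneForm m M) (x : M)
    (v : Fin (2 * m + 1) → TangentSpace (𝓡 (2 * m + 1)) x) : ℝ :=
  wedgeTop m (α x) (dForm α x) v

/-- Contact forms: smooth 1-forms `α` such that `α ∧ (dα)^{n-1}` is a volume form. -/
def IsContactForm [IsManifold (𝓡 (2 * m + 1)) ∞ M] (α : OneForm m M) : Prop :=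
  SmoothOneForm α ∧ ∀ x, ∃ v, topForm α x v ≠ 0

/-- The Reeb vector field `R_α`: `α(R_α) = 1` and `dα(R_α, ·) = 0`. -/
noncomputable def reebField (α : OneForm m M) : VField m M := fun x =>
  Classical.epsilon (fun v : TangentSpace (𝓡 (2 * m + 1)) x => α x v = 1 ∧ ∀ w, dForm α x v w = 0)

/-- The flow of a (complete) vector field: `t ↦ flow X t x` is the integral curve of `X` with value
`x` at time `0`. -/
noncomputable def flow (X : VField m M) (t : ℝ) (x : M) : M :=
  (@Classical.epsilon (ℝ → M) ⟨fun _ => x⟩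
    (fun γ => γ 0 = x ∧ IsMIntegralCurve (I := 𝓡 (2 * m + 1)) γ X)) t

/-- The Reeb flow `φ_α^t`. -/
noncomputable def reebFlow (α : OneForm m M) : ℝ → M → M := flow (reebField α)

/-- All the orbits of the Reeb flow of `α` are periodic, with the same minimal period `T₀`. -/
def IsZoll (α : OneForm m M) (T₀ : ℝ) : Prop :=
  0 < T₀ ∧ ∀ x, IsLeast {T : ℝ | 0 < T ∧ Function.Periodic (fun t => reebFlow α t x) T} T₀

end Basic

section Volume

variable {m : ℕ} (M : Type*) [TopologicalSpace M] [ChartedSpace (Model m) M]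
  [IsManifold (𝓡 (2 * m + 1)) ∞ M] [CompactSpace M] [T2Space M]

/-- A smooth partition of unity subordinate to the charts of `M`. -/
noncomputable def chartPartition :
    SmoothPartitionOfUnity M (𝓡 (2 * m + 1)) M univ :=
  Classical.choose (SmoothPartitionOfUnity.exists_isSubordinate_chartAt_source
    (I := 𝓡 (2 * m + 1)) (M := M))

theorem chartPartition_isSubordinate :
    (chartPartition (m := m) M).IsSubordinate (fun x => (chartAt (Model m) x).source) :=
  Classical.choose_spec (SmoothPartitionOfUnity.exists_isSubordinate_chartAt_source
    (I := 𝓡 (2 * m + 1)) (M := M))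

variable {M}

/-- The density of `α ∧ (dα)^{n-1}` with respect to Lebesgue measure in the chart at `c`. -/
noncomputable def chartDensity (α : OneForm m M) (c : M) (y : Model m) : ℝ :=
  |topForm α ((extChartAt (𝓡 (2 * m + 1)) c).symm y) (fun j =>
    mfderiv 𝓘(ℝ, Model m) (𝓡 (2 * m + 1)) (extChartAt (𝓡 (2 * m + 1)) c).symm y
      (EuclideanSpace.basisFun (Fin (2 * m + 1)) ℝ j))|

/-- The volume `vol(M, α) = ∫_M α ∧ (dα)^{n-1}`, where `M` has the orientation for which
`α ∧ (dα)^{n-1}` is positive. -/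
noncomputable def contactVolume (α : OneForm m M) : ℝ :=
  ∑ᶠ c : M, ∫ y in (extChartAt (𝓡 (2 * m + 1)) c).target,
    chartPartition (m := m) M c ((extChartAt (𝓡 (2 * m + 1)) c).symm y) * chartDensity α c y

end Volume

/-- A co-oriented contact structure `ξ` on `M`: a field of hyperplanes `ξ.ker x` in the tangent
spaces, together with the sets `ξ.pos x` of the vectors that are positively transverse to it, which
is given by some contact form. -/
structure ContactStructure (m : ℕ) (M : Type*) [TopologicalSpace M] [ChartedSpace (Model m) M]
    [IsManifold (𝓡 (2 * m + 1)) ∞ M] where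
  ker : (x : M) → Submodule ℝ (TangentSpace (𝓡 (2 * m + 1)) x)
  pos : (x : M) → Set (TangentSpace (𝓡 (2 * m + 1)) x)
  exists_form : ∃ α : OneForm m M, IsContactForm α ∧
    ∀ x, ker x = (α x).ker ∧ pos x = {v | 0 < α x v}

namespace ContactStructure

variable {m : ℕ} {M : Type*} [TopologicalSpace M] [ChartedSpace (Model m) M]
  [IsManifold (𝓡 (2 * m + 1)) ∞ M] (ξ : ContactStructure m M)

/-- `α` is a contact form defining the co-oriented contact structure `ξ`. -/
def IsDefiningForm (α : OneForm m M) : Prop :=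
  IsContactForm α ∧ ∀ x, ξ.ker x = (α x).ker ∧ ξ.pos x = {v | 0 < α x v}

/-- The map `f` preserves the co-oriented contact structure `ξ`. -/
def Preserves (f : M → M) : Prop :=
  ∀ (x : M) (v : TangentSpace (𝓡 (2 * m + 1)) x),
    (mfderiv (𝓡 (2 * m + 1)) (𝓡 (2 * m + 1)) f x v ∈ ξ.ker (f x) ↔ v ∈ ξ.ker x) ∧
    (mfderiv (𝓡 (2 * m + 1)) (𝓡 (2 * m + 1)) f x v ∈ ξ.pos (f x) ↔ v ∈ ξ.pos x)

/-- The contactomorphism group `Cont(M, ξ)`. -/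
def Cont : Type _ :=
  {φ : Diffeomorph (𝓡 (2 * m + 1)) (𝓡 (2 * m + 1)) M M ∞ // ξ.Preserves φ}

noncomputable instance : CoeFun ξ.Cont (fun _ => M → M) := ⟨fun φ => φ.1⟩

/-- Contact vector fields, the elements of `cont(M, ξ)`: smooth vector fields on the closed manifold
`M` whose flow preserves `ξ`. -/
def IsContactVField (X : VField m M) : Prop :=
  SmoothVField X ∧ ∀ t, ξ.Preserves (flow X t)

/-- The cone `cont⁺(M, ξ)` of the contact vector fields that are positively transverse to `ξ`. -/
def IsPositiveContactVField (X : VField m M) : Prop :=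
  ξ.IsContactVField X ∧ ∀ x, X x ∈ ξ.pos x

/-- The function `V(X) = vol(M, α)^{-1/n}` for `X ∈ cont⁺(M, ξ)`, where `α` is the unique
contact form defining `ξ` such that `X = R_α`. -/
noncomputable def V [CompactSpace M] [T2Space M] (X : VField m M) : ℝ :=
  contactVolume (Classical.epsilon (fun α : OneForm m M => ξ.IsDefiningForm α ∧ X = reebField α))
    ^ (-(1 / ((m : ℝ) + 1)))

end ContactStructure

section Paths

variable {m : ℕ} {M : Type*} [TopologicalSpace M] [ChartedSpace (Model m) M]

/-- The time-dependent vector field `X_t`, `t ∈ [0, T]`, generating a smooth path of diffeomorphisms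
`ψ t`, `t ∈ [0, T]`, i.e. uniquely defined by `(d/dt) ψ t = X_t ∘ ψ t` (with one-sided derivatives
at the end-points of `[0, T]`). -/
noncomputable def generator (T : ℝ) (ψ : ℝ → M → M) (t : ℝ) : VField m M :=
  Classical.epsilon (fun X : VField m M => ∀ x,
    HasMFDerivWithinAt 𝓘(ℝ, ℝ) (𝓡 (2 * m + 1)) (fun τ => ψ τ x) (Icc 0 T) t
      ((1 : ℝ →L[ℝ] ℝ).smulRight (X (ψ t x))))

variable [IsManifold (𝓡 (2 * m + 1)) ∞ M]

/-- The smooth path `ψ t`, `t ∈ [0, T]`, in `Cont(M, ξ)` is positive: `X_t ∈ cont⁺(M, ξ)` for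
every `t`. -/
def ContactStructure.IsPositivePath (ξ : ContactStructure m M) (T : ℝ) (ψ : ℝ → ξ.Cont) : Prop :=
  ∀ t ∈ Icc 0 T, ξ.IsPositiveContactVField (generator T (fun τ => ψ τ) t)

/-- The Lorentz--Finsler length of the positive path `ψ t`, `t ∈ [0, T]`:
the integral of `V(X_t)` over `[0, T]`. -/
noncomputable def ContactStructure.lengthV [CompactSpace M] [T2Space M]
    (ξ : ContactStructure m M) (T : ℝ) (ψ : ℝ → M → M) : ℝ :=
  ∫ t in (0 : ℝ)..T, ξ.V (generator T ψ t)

end Paths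

end ContactLF

/-! Write `X` for the Reeb field of the Zoll form `α`, `φ^t` for its flow, `T` for its minimal
period and `n = m + 1`. Choose a positive function `h` that is invariant under the half-period map
`φ^{T/2}` but not constant along some Reeb orbit, and let `ζ^s` be the Reeb flow of `α / h`. The
deformation is a reparametrization `p = b t` of the path `p ↦ φ^p ∘ ζ^s ∘ φ^p ∘ ζ^{-s}` (`twist`),
which for `s = 0` is `φ^{2p}`.

Length. The conjugated flow `ζ^s φ^p ζ^{-s}` is the Reeb flow of `(ζ^{-s})^* α = α / F`, with `F = h
/ (h ∘ ζ^{-s})`. Contact Hamiltonians add, so the path is generated at time `t` by the push-forward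
under `φ^{bt}` of the Reeb field of `α / (b (1 + F))`. The path is therefore positive, and the
relevant volume does not depend on `t`: it is `b^{-n} ∫ (1 + F)^{-n}` (integrals are taken against
the density of `α`). The constant `b = speed α h s` is chosen so that this equals `vol(α)`; the
length is then preserved because the integrands agree at each time.

Speed. The AM-HM inequality and convexity of the `n`-th power give `(2 / (1 + F))^n ≤ (1 + F^{-n}) /
2`, strictly where `F ≠ 1`. Since `∫ F^{-n} = vol((ζ^{-s})^* α) = vol(α)`, integration yields `b <
1/2` as soon as `F` is not identically `1`. This holds for small `s ≠ 0` because `h` has nonzero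
derivative along `ζ` at some point. Hence `t ∈ (0, T]` gives `p = b t ∈ (0, T/2)`.

Fixed points. For small `s` and `p ∈ (0, T/2)` the twisted map has none. Away from the endpoints
this is a perturbation of `φ^{2p}` with `0 < 2p < T`. Near `p = 0` the displacement in the direction
`X` is about `2p`. Near `p = T/2` the situation reduces to `p = 0`, because `ζ^s` commutes with
`φ^{T/2}` and `φ^T = id`.

The carrying lemmas are `IsContactForm.reebField_smulForm_add`, `hasVelocity_twist`,
`volInt_conformalFactor_lt` and `eventually_forall_twist_ne`. They rest on smooth dependence of
flows on initial values, naturality of the exterior derivative, invariance of the Reeb flow, and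
smoothness and change of variables for the volume integrals. -/

namespace ContactLF

/-! ### Calculus on spaces of continuous curves -/

section SmoothODE

open scoped Topology

universe u

variable {K : Type*} [TopologicalSpace K] [CompactSpace K]

section PointwiseApply

variable {E F : Type*} [NormedAddCommGroup E] [NormedSpace ℝ E]
    [NormedAddCommGroup F] [NormedSpace ℝ F]

noncomputable instance normedAddCommGroupContinuousMapCLM : NormedAddCommGroup C(K, E →L[ℝ] F) :=
  ContinuousMap.instNormedAddCommGroup

noncomputable instance normedSpaceContinuousMapCLM : NormedSpace ℝ C(K, E →L[ℝ] F) :=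
  ContinuousMap.normedSpace

/-- The operator `v ↦ (t ↦ A t (v t))` on curves. -/
noncomputable def pointwiseApplyAt (A : C(K, E →L[ℝ] F)) : C(K, E) →L[ℝ] C(K, F) :=
  LinearMap.mkContinuous
    { toFun := fun v => (⟨fun t => A t (v t), by fun_prop⟩ : C(K, F))
      map_add' := fun v w => by ext t; simp
      map_smul' := fun c v => by ext t; simp } ‖A‖
    (fun v => by
      rw [ContinuousMap.norm_le _ (by positivity)]
      intro t
      exact ((A t).le_opNorm _).trans (mul_le_mul (A.norm_coe_le_norm t) (v.norm_coe_le_norm t)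
        (norm_nonneg _) (norm_nonneg _)))

lemma pointwiseApplyAt_apply (A : C(K, E →L[ℝ] F)) (v : C(K, E)) (t : K) :
    pointwiseApplyAt A v t = A t (v t) := rfl

lemma norm_pointwiseApplyAt_le (A : C(K, E →L[ℝ] F)) : ‖pointwiseApplyAt A‖ ≤ ‖A‖ :=
  LinearMap.mkContinuous_norm_le _ (norm_nonneg _) _

variable (K E F) in
/-- Pointwise application of a continuous family of continuous linear maps. -/
noncomputable def pointwiseApply : C(K, E →L[ℝ] F) →L[ℝ] C(K, E) →L[ℝ] C(K, F) :=
  LinearMap.mkContinuous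
    { toFun := fun A => pointwiseApplyAt A
      map_add' := fun A B => by ext v t; simp [pointwiseApplyAt_apply]
      map_smul' := fun c A => by ext v t; simp [pointwiseApplyAt_apply] } 1
    (fun A => by rw [one_mul]; exact norm_pointwiseApplyAt_le A)

end PointwiseApply

@[simp] lemma pointwiseApply_apply {E F : Type*} [NormedAddCommGroup E] [NormedSpace ℝ E]
    [NormedAddCommGroup F] [NormedSpace ℝ F] (A : C(K, E →L[ℝ] F)) (v : C(K, E)) (t : K) :
    pointwiseApply K E F A v t = A t (v t) := rfl

/-- Uniform continuity of `f'` gives one radius `δ` that serves all parameters `t`; the mean value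
inequality on each ball of radius `δ` then bounds the remainder in the sup norm. -/
lemma hasFDerivAt_postcomp {E F : Type*} [NormedAddCommGroup E] [NormedSpace ℝ E]
    [NormedAddCommGroup F] [NormedSpace ℝ F] (f : C(E, F)) (f' : C(E, E →L[ℝ] F))
    (hf : ∀ x, HasFDerivAt f (f' x) x) (hf' : UniformContinuous f') (γ : C(K, E)) :
    HasFDerivAt (fun γ : C(K, E) => f.comp γ) (pointwiseApply K E F (f'.comp γ)) γ := by
  rw [hasFDerivAt_iff_isLittleO, Asymptotics.isLittleO_iff]
  intro c hc
  obtain ⟨δ, hδ, h⟩ := Metric.uniformContinuous_iff.1 hf' c hc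
  filter_upwards [Metric.ball_mem_nhds γ hδ] with η hη
  rw [ContinuousMap.norm_le _ (by positivity)]
  intro t
  have key := (convex_ball (γ t) δ).norm_image_sub_le_of_norm_hasFDerivWithin_le'
    (f := f) (f' := f') (φ := f' (γ t)) (C := c) (x := γ t) (y := η t)
    (fun x _ => (hf x).hasFDerivWithinAt)
    (fun x hx => by rw [← dist_eq_norm]; exact (h hx).le) (Metric.mem_ball_self hδ)
    ((ContinuousMap.dist_apply_le_dist t).trans_lt hη)
  refine key.trans (mul_le_mul_of_nonneg_left ?_ hc.le)
  exact (η - γ).norm_coe_le_norm t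

/-- The derivative of postcomposition with `f` is postcomposition with `f'` followed by a bounded
bilinear pairing, so one more derivative costs one use of the induction hypothesis for `f'`. The
target changes to `E →L[ℝ] F`, which is why `F` is quantified inside the induction and lies in the
universe of `E`. -/
lemma contDiff_postcomp_nat {E : Type u} [NormedAddCommGroup E] [NormedSpace ℝ E] (n : ℕ) :
    ∀ {F : Type u} [NormedAddCommGroup F] [NormedSpace ℝ F] (f : C(E, F)),
      ContDiff ℝ ∞ f → HasCompactSupport f →
      ContDiff ℝ n (fun γ : C(K, E) => f.comp γ) := by
  induction n with
  | zero =>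
    intro F _ _ f _ _
    exact contDiff_zero.2 (ContinuousMap.continuous_postcomp f)
  | succ n ih =>
    intro F _ _ f hf hc
    have hf1 : ContDiff ℝ ∞ (fderiv ℝ f) := hf.fderiv_right (by simp)
    have hc1 : HasCompactSupport (fderiv ℝ f) := hc.fderiv ℝ
    let f' : C(E, E →L[ℝ] F) := ⟨fderiv ℝ f, hf1.continuous⟩
    rw [Nat.cast_succ, contDiff_succ_iff_hasFDerivAt ]
    refine ⟨fun γ => pointwiseApply K E F (f'.comp γ),
      (pointwiseApply K E F).contDiff.comp (ih f' hf1 hc1), fun γ => ?_⟩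
    exact hasFDerivAt_postcomp f f'
      (fun x => (hf.differentiable (by simp) x).hasFDerivAt)
      (hc1.uniformContinuous_of_continuous hf1.continuous) γ

lemma contDiff_postcomp {E F : Type u} [NormedAddCommGroup E] [NormedSpace ℝ E]
    [NormedAddCommGroup F] [NormedSpace ℝ F] (f : C(E, F))
    (hf : ContDiff ℝ ∞ f) (hc : HasCompactSupport f) :
    ContDiff ℝ ∞ (fun γ : C(K, E) => f.comp γ) :=
  contDiff_infty.2 fun n => contDiff_postcomp_nat n f hf hc

/-- The primitive vanishing at `0` of a continuous curve on `[0, 1]`. -/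
noncomputable def primitive (E : Type*) [NormedAddCommGroup E] [NormedSpace ℝ E] [CompleteSpace E] :
    C(Icc (0 : ℝ) 1, E) →L[ℝ] C(Icc (0 : ℝ) 1, E) :=
  LinearMap.mkContinuous
    { toFun := fun γ => ⟨fun t => ∫ r in (0 : ℝ)..t, IccExtend zero_le_one γ r, by
        have h : Continuous (IccExtend (zero_le_one' ℝ) γ) := γ.continuous.Icc_extend'
        exact (intervalIntegral.continuous_primitive (fun a b => h.intervalIntegrable a b) 0).comp
          continuous_subtype_val⟩
      map_add' := fun γ η => by
        ext t
        have h (γ : C(Icc (0 : ℝ) 1, E)) : Continuous (IccExtend (zero_le_one' ℝ) γ) :=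
          γ.continuous.Icc_extend'
        exact intervalIntegral.integral_add ((h γ).intervalIntegrable _ _)
          ((h η).intervalIntegrable _ _)
      map_smul' := fun c γ => by
        ext t
        exact intervalIntegral.integral_smul c _ } 1
    (fun γ => by
      rw [one_mul, ContinuousMap.norm_le _ (norm_nonneg _)]
      intro t
      refine (intervalIntegral.norm_integral_le_of_norm_le_const (C := ‖γ‖) fun r _ =>
        γ.norm_coe_le_norm _).trans ?_
      have := t.2.1
      have := t.2.2
      rw [sub_zero, abs_of_nonneg t.2.1]
      exact mul_le_of_le_one_right (norm_nonneg _) t.2.2)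

lemma hasDerivWithinAt_primitive {E : Type*} [NormedAddCommGroup E] [NormedSpace ℝ E]
    [CompleteSpace E] (γ : C(Icc (0 : ℝ) 1, E)) (t : Icc (0 : ℝ) 1) :
    HasDerivWithinAt (IccExtend zero_le_one (primitive E γ)) (γ t) (Icc 0 1) t := by
  have h : Continuous (IccExtend (zero_le_one' ℝ) γ) := γ.continuous.Icc_extend'
  have h1 : HasDerivAt (fun s : ℝ => ∫ r in (0 : ℝ)..s, IccExtend zero_le_one γ r)
      (IccExtend zero_le_one γ (t : ℝ)) t :=
    intervalIntegral.integral_hasDerivAt_right (h.intervalIntegrable _ _)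
      h.stronglyMeasurable.stronglyMeasurableAtFilter h.continuousAt
  rw [IccExtend_val] at h1
  refine h1.hasDerivWithinAt.congr (fun s hs => ?_) ?_
  · rw [IccExtend_of_mem _ _ hs]; rfl
  · rw [IccExtend_val]; rfl

end SmoothODE

end ContactLF

namespace ContactLF

/-! ### Smooth dependence of local flows on time and initial value -/

section SmoothFlow

open scoped Topology

variable {E : Type*} [NormedAddCommGroup E] [NormedSpace ℝ E] [CompleteSpace E]

/-- For a smooth compactly supported vector field `f`, the time-one values of the solutions of
`γ' = τ f(γ)` depend smoothly on `τ` and the initial value. -/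
lemma exists_contDiffAt_timeOne {f : E → E} (hf : ContDiff ℝ ∞ f) (hc : HasCompactSupport f)
    (x₀ : E) :
    ∃ Φ : ℝ × E → E, ∀ᶠ p in 𝓝 ((0 : ℝ), x₀), ContDiffAt ℝ ∞ Φ p ∧ ∃ γ : ℝ → E,
      γ 0 = p.2 ∧ γ 1 = Φ p ∧
      ∀ t ∈ Icc (0 : ℝ) 1, HasDerivWithinAt γ (p.1 • f (γ t)) (Icc 0 1) t := by
  let K := Icc (0 : ℝ) 1
  let fc : C(E, E) := ⟨f, hf.continuous⟩
  let N : C(K, E) → C(K, E) := fun γ => primitive E (fc.comp γ)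
  have hN : ContDiff ℝ ∞ N := (primitive E).contDiff.comp (contDiff_postcomp fc hf hc)
  let cst : E →L[ℝ] C(K, E) := ContinuousLinearMap.const ℝ K
  -- A curve `γ` solves `γ' = τ f(γ)`, `γ(0) = x` exactly when the last component of `H (τ, x, γ)`
  -- vanishes. Keeping `(τ, x)` as a component turns the implicit function problem into an inverse
  -- function problem.
  let H : (ℝ × E) × C(K, E) → (ℝ × E) × C(K, E) :=
    fun q => (q.1, q.2 - cst q.1.2 - q.1.1 • N q.2)
  have hH : ContDiff ℝ ∞ H := by
    refine contDiff_fst.prodMk ((contDiff_snd.sub (cst.contDiff.comp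
      (contDiff_snd.comp contDiff_fst))).sub ?_)
    exact (contDiff_fst.comp contDiff_fst).smul (hN.comp contDiff_snd)
  let γ₀ := cst x₀
  let w := N γ₀
  let L : (ℝ × E) →L[ℝ] C(K, E) := cst.comp (ContinuousLinearMap.snd ℝ ℝ E) +
    (ContinuousLinearMap.fst ℝ ℝ E).smulRight w
  -- At `τ = 0` the nonlinear term contributes only through its factor `τ`, so the derivative of `H`
  -- is unipotent and its inverse is explicit.
  let A : ((ℝ × E) × C(K, E)) ≃L[ℝ] ((ℝ × E) × C(K, E)) :=
    ContinuousLinearEquiv.equivOfInverse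
      ((ContinuousLinearMap.fst ℝ (ℝ × E) C(K, E)).prod
        (ContinuousLinearMap.snd ℝ (ℝ × E) C(K, E) -
          L.comp (ContinuousLinearMap.fst ℝ (ℝ × E) C(K, E))))
      ((ContinuousLinearMap.fst ℝ (ℝ × E) C(K, E)).prod
        (ContinuousLinearMap.snd ℝ (ℝ × E) C(K, E) +
          L.comp (ContinuousLinearMap.fst ℝ (ℝ × E) C(K, E))))
      (fun q => by simp) (fun q => by simp)
  let q₀ : (ℝ × E) × C(K, E) := ((0, x₀), γ₀)
  have hA : HasFDerivAt H (A : ((ℝ × E) × C(K, E)) →L[ℝ] ((ℝ × E) × C(K, E))) q₀ := by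
    have h1 : HasFDerivAt (fun q : (ℝ × E) × C(K, E) => q.1)
      (ContinuousLinearMap.fst ℝ (ℝ × E) C(K, E)) q₀ := hasFDerivAt_fst
    have h2 : HasFDerivAt (fun q : (ℝ × E) × C(K, E) => q.2)
      (ContinuousLinearMap.snd ℝ (ℝ × E) C(K, E)) q₀ := hasFDerivAt_snd
    have h3 : HasFDerivAt (fun q : (ℝ × E) × C(K, E) => cst q.1.2)
      (cst.comp ((ContinuousLinearMap.snd ℝ ℝ E).comp
        (ContinuousLinearMap.fst ℝ (ℝ × E) C(K, E)))) q₀ := by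
      exact cst.hasFDerivAt.comp q₀ (hasFDerivAt_snd.comp q₀ hasFDerivAt_fst)
    have h4 : HasFDerivAt (fun q : (ℝ × E) × C(K, E) => q.1.1)
      ((ContinuousLinearMap.fst ℝ ℝ E).comp (ContinuousLinearMap.fst ℝ (ℝ × E) C(K, E))) q₀ := by
      exact hasFDerivAt_fst.comp q₀ hasFDerivAt_fst
    have h5 : HasFDerivAt (fun q : (ℝ × E) × C(K, E) => N q.2)
      ((fderiv ℝ N γ₀).comp (ContinuousLinearMap.snd ℝ (ℝ × E) C(K, E))) q₀ := by
      have hNγ : HasFDerivAt N (fderiv ℝ N γ₀) q₀.2 :=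
        ((hN.differentiable (by simp)) γ₀).hasFDerivAt
      exact hNγ.comp (g := N) q₀ hasFDerivAt_snd
    convert! h1.prodMk ((h2.sub h3).sub (h4.smul h5)) using 1
    ext q <;> simp [A, L, q₀, w, sub_sub, γ₀]
  let Ψ := (hH.contDiffAt (x := q₀)).localInverse hA (by simp)
  have hHq : H q₀ = ((0, x₀), 0) := by simp [H, q₀, γ₀]
  have hst := (hH.contDiffAt (x := q₀)).hasStrictFDerivAt' hA (by simp)
  have hΨ₀ : Filter.Tendsto Ψ (𝓝 (H q₀)) (𝓝 q₀) := hst.localInverse_tendsto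
  have hright : ∀ᶠ q in 𝓝 (H q₀), H (Ψ q) = q := hst.eventually_right_inverse
  -- Invertibility of the derivative is open. It is needed at all nearby points in order to obtain
  -- smoothness of the local inverse on a neighbourhood and not only at the base point.
  have hinv : ∀ᶠ q in 𝓝 q₀, ∃ B : ((ℝ × E) × C(K, E)) ≃L[ℝ] ((ℝ × E) × C(K, E)),
      HasFDerivAt H (B : ((ℝ × E) × C(K, E)) →L[ℝ] ((ℝ × E) × C(K, E))) q := by
    have h1 : ContinuousAt (fderiv ℝ H) q₀ := (hH.continuous_fderiv (by simp)).continuousAt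
    have h2 := h1.eventually (by rw [hA.fderiv]; exact ContinuousLinearEquiv.nhds A)
    filter_upwards [h2] with q hq
    obtain ⟨B, hB⟩ := hq
    exact ⟨B, hB ▸ ((hH.differentiable (by simp)) q).hasFDerivAt⟩
  have hΨ : ∀ᶠ q in 𝓝 (H q₀), ContDiffAt ℝ ∞ Ψ q := by
    let PH := (hH.contDiffAt (x := q₀)).toOpenPartialHomeomorph H hA (by simp)
    have hmem : H q₀ ∈ PH.target := (hH.contDiffAt (x := q₀)).image_mem_toOpenPartialHomeomorph_target hA (by simp)
    filter_upwards [PH.open_target.mem_nhds hmem, hΨ₀.eventually hinv] with q hq hB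
    obtain ⟨B, hB⟩ := hB
    exact PH.contDiffAt_symm hq hB hH.contDiffAt
  rw [hHq] at hΨ hright
  let ι : ℝ × E → (ℝ × E) × C(K, E) := fun p => (p, 0)
  have hι : ContDiff ℝ ∞ ι := contDiff_id.prodMk contDiff_const
  have hΨι : ∀ᶠ p in 𝓝 ((0 : ℝ), x₀), ContDiffAt ℝ ∞ (fun p => Ψ (ι p)) p := by
    filter_upwards [(hι.continuous.continuousAt (x := ((0 : ℝ), x₀))).eventually hΨ] with p hp
    exact hp.comp p hι.contDiffAt
  let ev : C(K, E) →L[ℝ] E := ContinuousMap.evalCLM ℝ (⟨1, right_mem_Icc.2 zero_le_one⟩ : K)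
  refine ⟨fun p => ev (Ψ (ι p)).2, ?_⟩
  have hright' : ∀ᶠ p in 𝓝 ((0 : ℝ), x₀), H (Ψ (ι p)) = ι p :=
    (hι.continuous.continuousAt (x := ((0 : ℝ), x₀))).eventually hright
  filter_upwards [hright', hΨι] with p hp hsm
  refine ⟨ev.contDiff.contDiffAt.comp _ hsm.snd, ?_⟩
  obtain ⟨hp1, hp2⟩ := Prod.ext_iff.1 hp
  simp only [H, ι] at hp1 hp2
  rw [hp1] at hp2
  set γ := (Ψ (ι p)).2 with hγ
  have hγ' : γ = cst p.2 + p.1 • N γ := by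
    rw [sub_sub] at hp2
    exact sub_eq_zero.1 hp2
  have hext : IccExtend zero_le_one γ =
      fun t => p.2 + p.1 • IccExtend zero_le_one (primitive E (fc.comp γ)) t := by
    funext t
    conv_lhs => rw [hγ']
    rfl
  refine ⟨IccExtend zero_le_one γ, ?_, ?_, ?_⟩
  · rw [hext]
    have : IccExtend (zero_le_one' ℝ) (primitive E (fc.comp γ)) 0 = 0 := by
      rw [IccExtend_of_mem _ _ (by simp : (0 : ℝ) ∈ Icc (0 : ℝ) 1)]
      exact intervalIntegral.integral_same
    simp only [this, smul_zero, add_zero]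
  · rw [IccExtend_of_mem _ _ (by simp : (1 : ℝ) ∈ Icc (0 : ℝ) 1)]
    rfl
  · intro t ht
    have h := hasDerivWithinAt_primitive (fc.comp γ) ⟨t, ht⟩
    have h2 := (h.const_smul p.1).const_add p.2
    rw [IccExtend_of_mem _ _ ht]
    rw [hext]
    exact h2

omit [CompleteSpace E] in
lemma eqOn_Icc_of_hasDerivWithinAt {f : E → E} {K : NNReal} (hf : LipschitzWith K f) {τ : ℝ}
    {γ η : ℝ → E}
    (hγ : ∀ t ∈ Icc (0 : ℝ) 1, HasDerivWithinAt γ (τ • f (γ t)) (Icc 0 1) t)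
    (hη : ∀ t ∈ Icc (0 : ℝ) 1, HasDerivWithinAt η (τ • f (η t)) (Icc 0 1) t)
    (h0 : γ 0 = η 0) : EqOn γ η (Icc 0 1) := by
  have hright {γ : ℝ → E}
      (hγ : ∀ t ∈ Icc (0 : ℝ) 1, HasDerivWithinAt γ (τ • f (γ t)) (Icc 0 1) t) :
      ∀ t ∈ Ico (0 : ℝ) 1, HasDerivWithinAt γ (τ • f (γ t)) (Ici t) t := fun t ht =>
    (hγ t (Ico_subset_Icc_self ht)).mono_of_mem_nhdsWithin (Icc_mem_nhdsGE_of_mem ht)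
  exact ODE_solution_unique (v := fun _ x => τ • f x) (K := ‖τ‖₊ * K)
    (fun t => ((lipschitzWith_smul τ).comp hf))
    (fun t ht => (hγ t ht).continuousWithinAt) (hright hγ)
    (fun t ht => (hη t ht).continuousWithinAt) (hright hη) h0

/-- Smooth local flow of a smooth compactly supported vector field. -/
lemma exists_contDiffOn_flow_of_hasCompactSupport {f : E → E} (hf : ContDiff ℝ ∞ f)
    (hc : HasCompactSupport f) (x₀ : E) :
    ∃ δ > 0, ∃ Φ : ℝ × E → E, ContDiffOn ℝ ∞ Φ (Ioo (-δ) δ ×ˢ Metric.ball x₀ δ) ∧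
      ∀ x ∈ Metric.ball x₀ δ, Φ (0, x) = x ∧
        ∀ t ∈ Ioo (-δ) δ, HasDerivAt (fun t => Φ (t, x)) (f (Φ (t, x))) t := by
  obtain ⟨Φ, hev⟩ := exists_contDiffAt_timeOne hf hc x₀
  obtain ⟨K, hK⟩ := (hf.of_le (m := 1) (by simp)).lipschitzWith_of_hasCompactSupport hc (by simp)
  obtain ⟨δ, hδ, hball⟩ := Metric.eventually_nhds_iff_ball.1 hev
  have hmem {τ : ℝ} {x : E} (hτ : |τ| < δ) (hx : x ∈ Metric.ball x₀ δ) :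
      (τ, x) ∈ Metric.ball ((0 : ℝ), x₀) δ := by
    rw [← ball_prod_same]
    exact ⟨by simpa using hτ, hx⟩
  have hflow {τ : ℝ} {x : E} (hτ : |τ| < δ) (hx : x ∈ Metric.ball x₀ δ) {r : ℝ}
      (hr : r ∈ Icc (0 : ℝ) 1) :
      HasDerivWithinAt (fun r => Φ (r * τ, x)) (τ • f (Φ (r * τ, x))) (Icc 0 1) r := by
    obtain ⟨γ, hγ0, hγ1, hγ⟩ := (hball _ (hmem hτ hx)).2
    -- By definition `Φ (rτ, x)` is the time-one value for the speed `rτ`. The rescaled curve `q ↦ γ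
    -- (q r)` solves the same problem, so uniqueness identifies this value with `γ r`.
    have key : EqOn (fun r => Φ (r * τ, x)) γ (Icc 0 1) := by
      intro r hr
      have hrτ : |r * τ| < δ := by
        rw [abs_mul, abs_of_nonneg hr.1]
        exact (mul_le_of_le_one_left (abs_nonneg _) hr.2).trans_lt hτ
      obtain ⟨η, hη0, hη1, hη⟩ := (hball _ (hmem hrτ hx)).2
      have hmaps : MapsTo (fun q : ℝ => q * r) (Icc 0 1) (Icc 0 1) := fun q hq =>
        ⟨mul_nonneg hq.1 hr.1, mul_le_one₀ hq.2 hr.1 hr.2⟩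
      have h := eqOn_Icc_of_hasDerivWithinAt hK (τ := r * τ) (γ := fun q => γ (q * r)) (η := η)
        (fun q hq => by
          have := (hγ (q * r) (hmaps hq)).scomp q
            ((hasDerivAt_mul_const (x := q) r).hasDerivWithinAt) hmaps
          simpa only [smul_smul] using! this) hη (by simp [hγ0, hη0])
      have h1 := h (by simp : (1 : ℝ) ∈ Icc (0 : ℝ) 1)
      simp only [one_mul] at h1
      simp only [h1, hη1]
    have := (hγ r hr).congr key (key hr)
    rwa [← key hr] at this
  refine ⟨δ, hδ, Φ, fun p hp => ?_, fun x hx => ⟨?_, fun t ht => ?_⟩⟩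
  · exact (hball p (hmem (abs_lt.2 hp.1) hp.2)).1.contDiffWithinAt
  · obtain ⟨γ, hγ0, hγ1, hγ⟩ := (hball _ (hmem (τ := 0) (by simpa using hδ) hx)).2
    rw [← hγ1, ← show γ 0 = x from hγ0]
    exact constant_of_has_deriv_right_zero (a := 0) (b := 1)
      (fun t ht => (hγ t ht).continuousWithinAt) (fun t ht => by
        simpa using (hγ t (Ico_subset_Icc_self ht)).mono_of_mem_nhdsWithin
          (Icc_mem_nhdsGE_of_mem ht)) 1 (by simp)
  · have hdiff : DifferentiableAt ℝ (fun t => Φ (t, x)) t := by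
      have h1 : DifferentiableAt ℝ Φ (t, x) :=
        (hball _ (hmem (abs_lt.2 ht) hx)).1.differentiableAt (by simp)
      exact h1.comp t (by fun_prop)
    obtain ⟨d, hd⟩ : ∃ d, HasDerivAt (fun t => Φ (t, x)) d t := ⟨_, hdiff.hasDerivAt⟩
    -- The time `t` is written as `r τ` with `τ ≠ 0`, also when `t = 0`, so that the factor `τ` can
    -- be cancelled from the derivative in `r`.
    obtain ⟨τ, hτ, hτ0, r, hr, hrt⟩ : ∃ τ : ℝ, |τ| < δ ∧ τ ≠ 0 ∧ ∃ r ∈ Icc (0 : ℝ) 1, r * τ = t := by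
      obtain ⟨τ, h1, h2⟩ := exists_between (max_lt (abs_lt.2 ht) hδ)
      have h3 := (max_lt_iff.1 h1)
      rcases le_total 0 t with h | h
      · refine ⟨τ, by rwa [abs_of_pos h3.2], h3.2.ne', t / τ, ⟨div_nonneg h h3.2.le, ?_⟩,
          div_mul_cancel₀ _ h3.2.ne'⟩
        rw [div_le_one h3.2]
        exact (le_abs_self t).trans h3.1.le
      · refine ⟨-τ, by rwa [abs_neg, abs_of_pos h3.2], (neg_ne_zero.2 h3.2.ne'), -t / τ,
          ⟨div_nonneg (by linarith) h3.2.le, ?_⟩, by have := h3.2.ne'; field_simp⟩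
        rw [div_le_one h3.2]
        exact (neg_le_abs t).trans h3.1.le
    have h1 := hflow hτ hx hr
    subst hrt
    have h2 : HasDerivWithinAt (fun r => Φ (r * τ, x)) (τ • d) (Icc 0 1) r := by
      exact (hd.scomp r (hasDerivAt_mul_const (x := r) τ)).hasDerivWithinAt
    have h3 := (uniqueDiffOn_Icc (zero_lt_one' ℝ) r hr).eq_deriv _ h1 h2
    have h4 : f (Φ (r * τ, x)) = d := smul_right_injective E hτ0 h3
    rw [h4]
    exact hd

/-- Smooth local flow of a vector field which is smooth on an open set. -/
theorem exists_contDiffOn_flow [FiniteDimensional ℝ E] {f : E → E} {U : Set E} (hU : IsOpen U)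
    (hf : ContDiffOn ℝ ∞ f U) {x₀ : E} (hx₀ : x₀ ∈ U) :
    ∃ δ > 0, ∃ Φ : ℝ × E → E, ContDiffOn ℝ ∞ Φ (Ioo (-δ) δ ×ˢ Metric.ball x₀ δ) ∧
      ∀ x ∈ Metric.ball x₀ δ, Φ (0, x) = x ∧
        ∀ t ∈ Ioo (-δ) δ, Φ (t, x) ∈ U ∧ HasDerivAt (fun t => Φ (t, x)) (f (Φ (t, x))) t := by
  obtain ⟨r, hr, hrU⟩ := Metric.isOpen_iff.1 hU x₀ hx₀
  -- Multiplying by a bump function makes the field globally smooth with compact support; near `x₀`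
  -- the bump is `1`, and for short times the flow stays there.
  let χ : ContDiffBump x₀ := ⟨r / 4, r / 2, by positivity, by linarith⟩
  have hsupp : tsupport χ ⊆ U := by
    rw [χ.tsupport_eq]
    exact (Metric.closedBall_subset_ball (by simp [χ]; linarith)).trans hrU
  have hg : ContDiff ℝ ∞ (fun x => χ x • f x) := by
    rw [contDiff_iff_contDiffAt]
    intro x
    by_cases hx : x ∈ U
    · exact χ.contDiffAt.smul (hf.contDiffAt (hU.mem_nhds hx))
    · have h0 : (fun x => χ x • f x) =ᶠ[𝓝 x] fun _ => 0 := by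
        filter_upwards [(isClosed_tsupport χ).isOpen_compl.mem_nhds (fun h => hx (hsupp h))]
          with y hy
        rw [image_eq_zero_of_notMem_tsupport hy, zero_smul]
      exact contDiffAt_const.congr_of_eventuallyEq h0
  obtain ⟨δ, hδ, Φ, hΦ, h⟩ := exists_contDiffOn_flow_of_hasCompactSupport hg
    (χ.hasCompactSupport.smul_right) x₀
  have hcont : ContinuousAt Φ (0, x₀) := (hΦ.continuousOn).continuousAt
    ((isOpen_Ioo.prod Metric.isOpen_ball).mem_nhds ⟨by simpa using hδ, Metric.mem_ball_self hδ⟩)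
  have h0 : Φ (0, x₀) = x₀ := (h x₀ (Metric.mem_ball_self hδ)).1
  have hev : ∀ᶠ p in 𝓝 ((0 : ℝ), x₀), Φ p ∈ Metric.ball x₀ (r / 4) :=
    hcont.eventually (by rw [h0]; exact Metric.ball_mem_nhds _ (by positivity))
  obtain ⟨ε, hε, hball⟩ := Metric.eventually_nhds_iff_ball.1 hev
  refine ⟨min δ ε, lt_min hδ hε, Φ, hΦ.mono (prod_mono (Ioo_subset_Ioo
    (neg_le_neg (min_le_left _ _)) (min_le_left _ _)) (Metric.ball_subset_ball (min_le_left _ _))),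
    fun x hx => ?_⟩
  obtain ⟨h1, h2⟩ := h x (Metric.ball_subset_ball (min_le_left _ _) hx)
  refine ⟨h1, fun t ht => ?_⟩
  have hmem : Φ (t, x) ∈ Metric.ball x₀ (r / 4) := by
    apply hball
    rw [← ball_prod_same]
    refine ⟨?_, Metric.ball_subset_ball (min_le_right _ _) hx⟩
    have := (abs_lt.2 ht).trans_le (min_le_right _ _)
    simpa using this
  refine ⟨hrU (Metric.ball_subset_ball (by linarith) hmem), ?_⟩
  have h3 := h2 t ⟨(neg_le_neg (min_le_left _ _)).trans_lt ht.1, ht.2.trans_le (min_le_left _ _)⟩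
  rwa [χ.one_of_mem_closedBall (Metric.ball_subset_closedBall hmem), one_smul] at h3

end SmoothFlow

end ContactLF

namespace ContactLF

/-! ### Forms, fields and maps read in charts -/

section Charts

open scoped Topology

variable {m : ℕ} {M : Type*} [TopologicalSpace M] [ChartedSpace (Model m) M]

/-- The expression of the 1-form `α` in the chart at `c`, as a map into the dual space. -/
noncomputable def repForm (α : OneForm m M) (c : M) (y : Model m) : Model m →L[ℝ] ℝ :=
  (α ((extChartAt (𝓡 (2 * m + 1)) c).symm y)).comp
    (mfderiv 𝓘(ℝ, Model m) (𝓡 (2 * m + 1)) (extChartAt (𝓡 (2 * m + 1)) c).symm y)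

/-- The expression of the vector field `X` in the chart at `c`. -/
noncomputable def repField (X : VField m M) (c : M) (y : Model m) : Model m :=
  mfderiv (𝓡 (2 * m + 1)) 𝓘(ℝ, Model m) (extChartAt (𝓡 (2 * m + 1)) c)
    ((extChartAt (𝓡 (2 * m + 1)) c).symm y) (X ((extChartAt (𝓡 (2 * m + 1)) c).symm y))

/-- The pull-back of a 1-form by a map. -/
noncomputable def pullForm (g : M → M) (α : OneForm m M) : OneForm m M := fun x =>
  (α (g x)).comp (mfderiv (𝓡 (2 * m + 1)) (𝓡 (2 * m + 1)) g x)

/-- The expression of the map `g` in the charts at `c` and `d`. -/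
noncomputable def repMap (g : M → M) (c d : M) (y : Model m) : Model m :=
  extChartAt (𝓡 (2 * m + 1)) d (g ((extChartAt (𝓡 (2 * m + 1)) c).symm y))

/-- All tangent spaces unfold to `Model m`, so an equality of base points can be used without casts
between fibres. -/
lemma apply_congr_base (α : OneForm m M) {x z : M} (h : z = x) (w : Model m) :
    (α z : Model m →L[ℝ] ℝ) w = (α x : Model m →L[ℝ] ℝ) w := by
  subst h; rfl

lemma isOpen_target (c : M) : IsOpen (extChartAt (𝓡 (2 * m + 1)) c).target :=
  isOpen_extChartAt_target c

lemma pullForm_id (α : OneForm m M) : pullForm id α = α := by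
  funext x
  rw [pullForm, mfderiv_id]
  rfl

variable [IsManifold (𝓡 (2 * m + 1)) ∞ M]

lemma contMDiffAt_symm_chart {c : M} {y : Model m}
    (hy : y ∈ (extChartAt (𝓡 (2 * m + 1)) c).target) :
    ContMDiffAt 𝓘(ℝ, Model m) (𝓡 (2 * m + 1)) ∞ (extChartAt (𝓡 (2 * m + 1)) c).symm y :=
  (contMDiffOn_extChartAt_symm c).contMDiffAt ((isOpen_target c).mem_nhds hy)

lemma contMDiffAt_chart {c x : M} (hx : x ∈ (extChartAt (𝓡 (2 * m + 1)) c).source) :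
    ContMDiffAt (𝓡 (2 * m + 1)) 𝓘(ℝ, Model m) ∞ (extChartAt (𝓡 (2 * m + 1)) c) x :=
  contMDiffAt_extChartAt' (by rwa [← extChartAt_source (𝓡 (2 * m + 1))])

lemma mdifferentiableAt_symm_chart {c : M} {y : Model m}
    (hy : y ∈ (extChartAt (𝓡 (2 * m + 1)) c).target) :
    MDifferentiableAt 𝓘(ℝ, Model m) (𝓡 (2 * m + 1)) (extChartAt (𝓡 (2 * m + 1)) c).symm y :=
  (contMDiffAt_symm_chart hy).mdifferentiableAt (by simp)

lemma mdifferentiableAt_chart {c x : M} (hx : x ∈ (extChartAt (𝓡 (2 * m + 1)) c).source) :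
    MDifferentiableAt (𝓡 (2 * m + 1)) 𝓘(ℝ, Model m) (extChartAt (𝓡 (2 * m + 1)) c) x :=
  (contMDiffAt_chart hx).mdifferentiableAt (by simp)

lemma mfderiv_symm_chart_comp {c x : M} (hx : x ∈ (extChartAt (𝓡 (2 * m + 1)) c).source)
    (v : Model m) :
    (mfderiv 𝓘(ℝ, Model m) (𝓡 (2 * m + 1)) (extChartAt (𝓡 (2 * m + 1)) c).symm
      (extChartAt (𝓡 (2 * m + 1)) c x) : Model m →L[ℝ] Model m)
      ((mfderiv (𝓡 (2 * m + 1)) 𝓘(ℝ, Model m) (extChartAt (𝓡 (2 * m + 1)) c) x :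
        Model m →L[ℝ] Model m) v) = v := by
  have : IsManifold (𝓡 (2 * m + 1)) 1 M := IsManifold.of_le (n := ∞) (by simp)
  have h := mfderivWithin_extChartAt_symm_comp_mfderiv_extChartAt' (I := 𝓡 (2 * m + 1)) hx
  rw [ModelWithCorners.range_eq_univ, mfderivWithin_univ] at h
  exact congrArg (fun L : Model m →L[ℝ] Model m => L v) h

lemma mfderiv_chart_comp_symm {c : M} {y : Model m}
    (hy : y ∈ (extChartAt (𝓡 (2 * m + 1)) c).target) (v : Model m) :
    (mfderiv (𝓡 (2 * m + 1)) 𝓘(ℝ, Model m) (extChartAt (𝓡 (2 * m + 1)) c)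
      ((extChartAt (𝓡 (2 * m + 1)) c).symm y) : Model m →L[ℝ] Model m)
      ((mfderiv 𝓘(ℝ, Model m) (𝓡 (2 * m + 1)) (extChartAt (𝓡 (2 * m + 1)) c).symm y :
        Model m →L[ℝ] Model m) v) = v := by
  have : IsManifold (𝓡 (2 * m + 1)) 1 M := IsManifold.of_le (n := ∞) (by simp)
  have h := mfderiv_extChartAt_comp_mfderivWithin_extChartAt_symm (I := 𝓡 (2 * m + 1)) hy
  rw [ModelWithCorners.range_eq_univ, mfderivWithin_univ] at h
  exact congrArg (fun L : Model m →L[ℝ] Model m => L v) h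

lemma mfderiv_symm_comp_chart {c : M} {y : Model m}
    (hy : y ∈ (extChartAt (𝓡 (2 * m + 1)) c).target) (v : Model m) :
    (mfderiv 𝓘(ℝ, Model m) (𝓡 (2 * m + 1)) (extChartAt (𝓡 (2 * m + 1)) c).symm y :
      Model m →L[ℝ] Model m)
      ((mfderiv (𝓡 (2 * m + 1)) 𝓘(ℝ, Model m) (extChartAt (𝓡 (2 * m + 1)) c)
        ((extChartAt (𝓡 (2 * m + 1)) c).symm y) : Model m →L[ℝ] Model m) v) = v := by
  have : IsManifold (𝓡 (2 * m + 1)) 1 M := IsManifold.of_le (n := ∞) (by simp)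
  have h := mfderivWithin_extChartAt_symm_comp_mfderiv_extChartAt (I := 𝓡 (2 * m + 1)) hy
  rw [ModelWithCorners.range_eq_univ, mfderivWithin_univ] at h
  exact congrArg (fun L : Model m →L[ℝ] Model m => L v) h

lemma repForm_chart_apply (α : OneForm m M) {c x : M}
    (hx : x ∈ (extChartAt (𝓡 (2 * m + 1)) c).source) (w : Model m) :
    repForm α c (extChartAt (𝓡 (2 * m + 1)) c x)
      ((mfderiv (𝓡 (2 * m + 1)) 𝓘(ℝ, Model m) (extChartAt (𝓡 (2 * m + 1)) c) x :
        Model m →L[ℝ] Model m) w) = (α x : Model m →L[ℝ] ℝ) w := by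
  have h := apply_congr_base α ((extChartAt (𝓡 (2 * m + 1)) c).left_inv hx) w
  rw [← h]
  exact congrArg _ (mfderiv_symm_chart_comp hx w)

lemma contDiffAt_repMap {g : M → M} {c d : M} {y : Model m}
    (hy : y ∈ (extChartAt (𝓡 (2 * m + 1)) c).target)
    (hg : ContMDiffAt (𝓡 (2 * m + 1)) (𝓡 (2 * m + 1)) ∞ g
      ((extChartAt (𝓡 (2 * m + 1)) c).symm y))
    (hd : g ((extChartAt (𝓡 (2 * m + 1)) c).symm y) ∈ (extChartAt (𝓡 (2 * m + 1)) d).source) :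
    ContDiffAt ℝ ∞ (repMap g c d) y := by
  rw [← contMDiffAt_iff_contDiffAt]
  exact (contMDiffAt_chart hd).comp y (hg.comp y (contMDiffAt_symm_chart hy))

lemma fderiv_repMap_apply {g : M → M} {c d : M} {y : Model m}
    (hy : y ∈ (extChartAt (𝓡 (2 * m + 1)) c).target)
    (hg : MDifferentiableAt (𝓡 (2 * m + 1)) (𝓡 (2 * m + 1)) g
      ((extChartAt (𝓡 (2 * m + 1)) c).symm y))
    (hd : g ((extChartAt (𝓡 (2 * m + 1)) c).symm y) ∈ (extChartAt (𝓡 (2 * m + 1)) d).source)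
    (v : Model m) :
    fderiv ℝ (repMap g c d) y v =
      (mfderiv (𝓡 (2 * m + 1)) 𝓘(ℝ, Model m) (extChartAt (𝓡 (2 * m + 1)) d)
        (g ((extChartAt (𝓡 (2 * m + 1)) c).symm y)) : Model m →L[ℝ] Model m)
      ((mfderiv (𝓡 (2 * m + 1)) (𝓡 (2 * m + 1)) g ((extChartAt (𝓡 (2 * m + 1)) c).symm y) :
          Model m →L[ℝ] Model m)
        ((mfderiv 𝓘(ℝ, Model m) (𝓡 (2 * m + 1)) (extChartAt (𝓡 (2 * m + 1)) c).symm y :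
          Model m →L[ℝ] Model m) v)) := by
  have h1 : HasMFDerivAt 𝓘(ℝ, Model m) 𝓘(ℝ, Model m) (repMap g c d) y _ :=
    (mdifferentiableAt_chart hd).hasMFDerivAt.comp y
      (hg.hasMFDerivAt.comp y (mdifferentiableAt_symm_chart hy).hasMFDerivAt)
  rw [← mfderiv_eq_fderiv, h1.mfderiv]
  rfl

lemma repForm_pullForm (α : OneForm m M) {g : M → M} {c d : M} {y : Model m}
    (hy : y ∈ (extChartAt (𝓡 (2 * m + 1)) c).target)
    (hg : MDifferentiableAt (𝓡 (2 * m + 1)) (𝓡 (2 * m + 1)) g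
      ((extChartAt (𝓡 (2 * m + 1)) c).symm y))
    (hd : g ((extChartAt (𝓡 (2 * m + 1)) c).symm y) ∈ (extChartAt (𝓡 (2 * m + 1)) d).source) :
    repForm (pullForm g α) c y =
      (repForm α d (repMap g c d y)).comp (fderiv ℝ (repMap g c d) y) := by
  ext1 v
  rw [ContinuousLinearMap.comp_apply, fderiv_repMap_apply hy hg hd]
  exact (repForm_chart_apply α hd _).symm

lemma eventually_mem_target_and {g : M → M} {c d : M} {y : Model m}
    (hy : y ∈ (extChartAt (𝓡 (2 * m + 1)) c).target)
    (hg : ContinuousAt g ((extChartAt (𝓡 (2 * m + 1)) c).symm y))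
    (hd : g ((extChartAt (𝓡 (2 * m + 1)) c).symm y) ∈ (extChartAt (𝓡 (2 * m + 1)) d).source) :
    ∀ᶠ z in 𝓝 y, z ∈ (extChartAt (𝓡 (2 * m + 1)) c).target ∧
      g ((extChartAt (𝓡 (2 * m + 1)) c).symm z) ∈ (extChartAt (𝓡 (2 * m + 1)) d).source := by
  refine Filter.Eventually.and ((isOpen_target c).mem_nhds hy) ?_
  have h : ContinuousAt (fun z => g ((extChartAt (𝓡 (2 * m + 1)) c).symm z)) y :=
    ContinuousAt.comp hg (contMDiffAt_symm_chart hy).continuousAt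
  exact h ((isOpen_extChartAt_source d).mem_nhds hd)

/-- Smoothness of a 1-form, read in the chart at each point. -/
lemma smoothOneForm_iff_contDiffAt (α : OneForm m M) :
    SmoothOneForm α ↔
      ∀ x, ContDiffAt ℝ ∞ (repForm α x) (extChartAt (𝓡 (2 * m + 1)) x x) := by
  have : IsManifold (𝓡 (2 * m + 1)) 1 M := IsManifold.of_le (n := ∞) (by simp)
  refine forall_congr' fun x₀ => ?_
  rw [contMDiffAt_hom_bundle]
  have hx₀ := mem_extChartAt_source (I := 𝓡 (2 * m + 1)) x₀
  -- The bundle coordinates of `α` around `x₀` are its chart expression, because the tangent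
  -- trivialization is the derivative of the chart.
  have hev : (fun x => ContinuousLinearMap.inCoordinates (Model m)
      (TangentSpace (𝓡 (2 * m + 1)) (M := M)) ℝ (Bundle.Trivial M ℝ) x₀ x x₀ x (α x)) =ᶠ[𝓝 x₀]
      fun x => repForm α x₀ (extChartAt (𝓡 (2 * m + 1)) x₀ x) := by
    filter_upwards [(isOpen_extChartAt_source (I := 𝓡 (2 * m + 1)) x₀).mem_nhds hx₀] with x hx
    ext1 v
    have h1 := TangentBundle.symmL_trivializationAt (I := 𝓡 (2 * m + 1)) (x₀ := x₀) (x := x)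
      (by rwa [← extChartAt_source (𝓡 (2 * m + 1))])
    rw [ModelWithCorners.range_eq_univ, mfderivWithin_univ] at h1
    have h2 := apply_congr_base α ((extChartAt (𝓡 (2 * m + 1)) x₀).left_inv hx)
    refine Eq.trans ?_ (h2 _).symm
    rw [ContinuousLinearMap.inCoordinates, h1]
    simp
    rfl
  constructor
  · rintro ⟨-, h⟩
    have h3 := (h.congr_of_eventuallyEq hev.symm)
    rw [← contMDiffAt_iff_contDiffAt]
    have h4 := h3.comp_of_eq (contMDiffAt_symm_chart (mem_extChartAt_target x₀))
      (extChartAt_to_inv x₀)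
    refine h4.congr_of_eventuallyEq ?_
    filter_upwards [(isOpen_target x₀).mem_nhds (mem_extChartAt_target x₀)] with y hy
    simp only [Function.comp_apply, (extChartAt (𝓡 (2 * m + 1)) x₀).right_inv hy]
  · intro h
    refine ⟨contMDiffAt_id, ContMDiffAt.congr_of_eventuallyEq ?_ hev⟩
    exact (contMDiffAt_iff_contDiffAt.2 h).comp x₀ (contMDiffAt_chart hx₀)

/-- Near `y` the pulled-back form is a composition with the chart expression of `g`, centred at the
image point, where smoothness is known. The case `g = id` transfers smoothness to an arbitrary
chart. -/
lemma SmoothOneForm.contDiffAt_repForm_pullForm {α : OneForm m M} (hα : SmoothOneForm α)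
    {g : M → M} {c : M} {y : Model m} (hy : y ∈ (extChartAt (𝓡 (2 * m + 1)) c).target)
    (hg : ContMDiff (𝓡 (2 * m + 1)) (𝓡 (2 * m + 1)) ∞ g) :
    ContDiffAt ℝ ∞ (repForm (pullForm g α) c) y := by
  set d := g ((extChartAt (𝓡 (2 * m + 1)) c).symm y) with hd
  have hsrc : g ((extChartAt (𝓡 (2 * m + 1)) c).symm y) ∈
      (extChartAt (𝓡 (2 * m + 1)) d).source := by
    rw [← hd]; exact mem_extChartAt_source d
  have hev : repForm (pullForm g α) c =ᶠ[𝓝 y]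
      fun y => (repForm α d (repMap g c d y)).comp (fderiv ℝ (repMap g c d) y) := by
    filter_upwards [eventually_mem_target_and hy hg.continuous.continuousAt hsrc] with z hz
    exact repForm_pullForm α hz.1 (hg.mdifferentiableAt (by simp)) hz.2
  refine ContDiffAt.congr_of_eventuallyEq ?_ hev
  have hT := contDiffAt_repMap hy hg.contMDiffAt hsrc
  exact ((((smoothOneForm_iff_contDiffAt α).1 hα d).comp y hT)).clm_comp
    (hT.fderiv_right (by simp))

lemma SmoothOneForm.contDiffAt_repForm {α : OneForm m M} (hα : SmoothOneForm α) {c : M}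
    {y : Model m} (hy : y ∈ (extChartAt (𝓡 (2 * m + 1)) c).target) :
    ContDiffAt ℝ ∞ (repForm α c) y := by
  have := hα.contDiffAt_repForm_pullForm hy contMDiff_id
  rwa [pullForm_id] at this

lemma SmoothOneForm.pullForm {α : OneForm m M} (hα : SmoothOneForm α) {g : M → M}
    (hg : ContMDiff (𝓡 (2 * m + 1)) (𝓡 (2 * m + 1)) ∞ g) : SmoothOneForm (pullForm g α) :=
  (smoothOneForm_iff_contDiffAt _).2 fun x =>
    hα.contDiffAt_repForm_pullForm (mem_extChartAt_target x) hg

lemma trivializationAt_snd_eq_repField (X : VField m M) {c x : M}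
    (hx : x ∈ (extChartAt (𝓡 (2 * m + 1)) c).source) :
    (trivializationAt (Model m) (TangentSpace (𝓡 (2 * m + 1)) (M := M)) c ⟨x, X x⟩).2 =
      repField X c (extChartAt (𝓡 (2 * m + 1)) c x) := by
  have : IsManifold (𝓡 (2 * m + 1)) 1 M := IsManifold.of_le (n := ∞) (by simp)
  have hx' : x ∈ (chartAt (Model m) c).source := by rwa [← extChartAt_source (𝓡 (2 * m + 1))]
  have h1 := TangentBundle.continuousLinearMapAt_trivializationAt (I := 𝓡 (2 * m + 1))
    (x₀ := c) (x := x) hx'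
  have h2 := Bundle.Trivialization.continuousLinearMapAt_apply ℝ
    (trivializationAt (Model m) (TangentSpace (𝓡 (2 * m + 1)) (M := M)) c) x
  rw [h1] at h2
  have h3 := congrFun h2 (X x)
  rw [Bundle.Trivialization.coe_linearMapAt_of_mem _ (by simpa using hx')] at h3
  rw [repField, (extChartAt (𝓡 (2 * m + 1)) c).left_inv hx]
  exact h3.symm

lemma SmoothVField.contDiffAt_repField {X : VField m M} (hX : SmoothVField X) {c : M}
    {y : Model m} (hy : y ∈ (extChartAt (𝓡 (2 * m + 1)) c).target) :
    ContDiffAt ℝ ∞ (repField X c) y := by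
  have hx := (extChartAt (𝓡 (2 * m + 1)) c).map_target hy
  have h := ((trivializationAt (Model m) (TangentSpace (𝓡 (2 * m + 1)) (M := M))
    c).contMDiffAt_section_iff (IB := 𝓡 (2 * m + 1)) (by simpa using hx)).1 (hX _)
  have hev : repField X c =ᶠ[𝓝 y] fun y => (trivializationAt (Model m)
      (TangentSpace (𝓡 (2 * m + 1)) (M := M)) c
        ⟨(extChartAt (𝓡 (2 * m + 1)) c).symm y, X ((extChartAt (𝓡 (2 * m + 1)) c).symm y)⟩).2 := by
    filter_upwards [(isOpen_target c).mem_nhds hy] with z hz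
    rw [trivializationAt_snd_eq_repField X ((extChartAt (𝓡 (2 * m + 1)) c).map_target hz),
      (extChartAt (𝓡 (2 * m + 1)) c).right_inv hz]
  rw [← contMDiffAt_iff_contDiffAt]
  exact (h.comp y (contMDiffAt_symm_chart hy)).congr_of_eventuallyEq hev

/-- Smoothness of a vector field, read in the chart at each point. -/
lemma smoothVField_of_contDiffAt {X : VField m M}
    (h : ∀ x, ContDiffAt ℝ ∞ (repField X x) (extChartAt (𝓡 (2 * m + 1)) x x)) :
    SmoothVField X := by
  intro x₀
  rw [Bundle.contMDiffAt_section]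
  have hx₀ := mem_extChartAt_source (I := 𝓡 (2 * m + 1)) x₀
  refine ContMDiffAt.congr_of_eventuallyEq
    ((contMDiffAt_iff_contDiffAt.2 (h x₀)).comp x₀ (contMDiffAt_chart hx₀)) ?_
  filter_upwards [(isOpen_extChartAt_source (I := 𝓡 (2 * m + 1)) x₀).mem_nhds hx₀] with x hx
  exact trivializationAt_snd_eq_repField X hx

end Charts

end ContactLF

namespace ContactLF

/-! ### The exterior derivative of a 1-form -/

section ExteriorDerivative

open scoped Topology

section Local

variable {E F : Type*} [NormedAddCommGroup E] [NormedSpace ℝ E]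
  [NormedAddCommGroup F] [NormedSpace ℝ F]

/-- The exterior derivative of a 1-form on a normed space, as a bilinear map. -/
noncomputable def dLoc (a : E → E →L[ℝ] ℝ) (y : E) : E →L[ℝ] E →L[ℝ] ℝ :=
  fderiv ℝ a y - (fderiv ℝ a y).flip

lemma dLoc_apply (a : E → E →L[ℝ] ℝ) (y u v : E) :
    dLoc a y u v = fderiv ℝ a y u v - fderiv ℝ a y v u := rfl

lemma dLoc_skew (a : E → E →L[ℝ] ℝ) (y u v : E) : dLoc a y u v = -dLoc a y v u := by
  rw [dLoc_apply, dLoc_apply, neg_sub]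

lemma dLoc_congr {a b : E → E →L[ℝ] ℝ} {y : E} (h : a =ᶠ[𝓝 y] b) : dLoc a y = dLoc b y := by
  rw [dLoc, dLoc, h.fderiv_eq]

/-- The terms containing the second derivative of `T` cancel on antisymmetrization, since that
derivative is symmetric. -/
lemma dLoc_pullback {a : F → F →L[ℝ] ℝ} {T : E → F} {y : E}
    (ha : DifferentiableAt ℝ a (T y)) (hT : ContDiffAt ℝ ∞ T y) (u v : E) :
    dLoc (fun y => (a (T y)).comp (fderiv ℝ T y)) y u v =
      dLoc a (T y) (fderiv ℝ T y u) (fderiv ℝ T y v) := by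
  have hT1 : HasFDerivAt T (fderiv ℝ T y) y := (hT.differentiableAt (by simp)).hasFDerivAt
  have hT2 : HasFDerivAt (fderiv ℝ T) (fderiv ℝ (fderiv ℝ T) y) y :=
    ((hT.fderiv_right (m := 1) (by
      rw [one_add_one_eq_two]; exact ENat.LEInfty.out)).differentiableAt (by simp)).hasFDerivAt
  have h := (ha.hasFDerivAt.comp y hT1).clm_comp hT2
  have hsymm : fderiv ℝ (fderiv ℝ T) y u v = fderiv ℝ (fderiv ℝ T) y v u :=
    (hT.isSymmSndFDerivAt (by
      rw [minSmoothness_of_isRCLikeNormedField]; exact ENat.LEInfty.out)) u v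
  rw [dLoc_apply, dLoc_apply]
  have h' : fderiv ℝ (fun y => (a (T y)).comp (fderiv ℝ T y)) y = _ := h.fderiv
  rw [h']
  simp [hsymm]

lemma dLoc_smul {a : E → E →L[ℝ] ℝ} {k : E → ℝ} {y : E}
    (ha : DifferentiableAt ℝ a y) (hk : DifferentiableAt ℝ k y) (u v : E) :
    dLoc (fun y => k y • a y) y u v =
      k y * dLoc a y u v + (fderiv ℝ k y u * a y v - fderiv ℝ k y v * a y u) := by
  rw [dLoc_apply, dLoc_apply]
  have h' : fderiv ℝ (fun y => k y • a y) y = _ := (hk.hasFDerivAt.smul ha.hasFDerivAt).fderiv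
  rw [h']
  simp
  ring

end Local

variable {m : ℕ} {M : Type*} [TopologicalSpace M] [ChartedSpace (Model m) M]

/-- Multiplication of a 1-form by a function. -/
noncomputable def smulForm (k : M → ℝ) (α : OneForm m M) : OneForm m M := fun x => k x • α x

/-- The differential of a function, as a linear form on the model space. -/
noncomputable def dFun (k : M → ℝ) (x : M) : Model m →L[ℝ] ℝ :=
  mfderiv (𝓡 (2 * m + 1)) 𝓘(ℝ, ℝ) k x

lemma repForm_smulForm (k : M → ℝ) (α : OneForm m M) (c : M) :
    repForm (smulForm k α) c =
      fun y => k ((extChartAt (𝓡 (2 * m + 1)) c).symm y) • repForm α c y := rfl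

variable [IsManifold (𝓡 (2 * m + 1)) ∞ M]

lemma mfderiv_chart_self (x : M) (u : Model m) :
    (mfderiv (𝓡 (2 * m + 1)) 𝓘(ℝ, Model m) (extChartAt (𝓡 (2 * m + 1)) x) x :
      Model m →L[ℝ] Model m) u = u := by
  have : IsManifold (𝓡 (2 * m + 1)) 1 M := IsManifold.of_le (n := ∞) (by simp)
  exact congrArg (fun L : Model m →L[ℝ] Model m => L u)
    (mfderiv_extChartAt_self (I := 𝓡 (2 * m + 1)) (x := x))

lemma mfderiv_symm_chart_self (x : M) (u : Model m) :
    (mfderiv 𝓘(ℝ, Model m) (𝓡 (2 * m + 1)) (extChartAt (𝓡 (2 * m + 1)) x).symm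
      (extChartAt (𝓡 (2 * m + 1)) x x) : Model m →L[ℝ] Model m) u = u := by
  have h := mfderiv_symm_chart_comp (mem_extChartAt_source (I := 𝓡 (2 * m + 1)) x) u
  rwa [mfderiv_chart_self] at h

/-- The exterior derivative at `x`, as a bilinear form. -/
noncomputable def dBilin (α : OneForm m M) (x : M) : Model m →L[ℝ] Model m →L[ℝ] ℝ :=
  dLoc (repForm α x) (extChartAt (𝓡 (2 * m + 1)) x x)

/-- The derivative at `x` of the chart at `x` is the identity, so the alternating-map definition
reduces to an antisymmetrized derivative, to which bilinear algebra applies. -/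
lemma dForm_eq_dBilin {α : OneForm m M} (hα : SmoothOneForm α) (x : M) (u v : Model m) :
    dForm α x u v = dBilin α x u v := by
  have hd : DifferentiableAt ℝ (repForm α x) (extChartAt (𝓡 (2 * m + 1)) x x) :=
    (hα.contDiffAt_repForm (mem_extChartAt_target x)).differentiableAt (by simp)
  let Λ := ContinuousAlternatingMap.ofSubsingletonLIE (𝕜 := ℝ) (E := Model m) (F := ℝ) (0 : Fin 1)
  have hω : DifferentiableAt ℝ (localForm α x) (extChartAt (𝓡 (2 * m + 1)) x x) :=
    (Λ.toContinuousLinearEquiv.differentiableAt).comp _ hd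
  have key (w : Fin 1 → Model m) (z : Model m) :
      fderiv ℝ (fun y => localForm α x y w) (extChartAt (𝓡 (2 * m + 1)) x x) z =
        fderiv ℝ (repForm α x) (extChartAt (𝓡 (2 * m + 1)) x x) z (w 0) := by
    have h1 : HasFDerivAt (fun y => repForm α x y (w 0)) _ (extChartAt (𝓡 (2 * m + 1)) x x) :=
      hd.hasFDerivAt.clm_apply (hasFDerivAt_const (w 0) _)
    have h2 : (fun y => localForm α x y w) = fun y => repForm α x y (w 0) := rfl
    rw [h2, h1.fderiv]
    simp
  have h0 : dForm α x u v =
      extDeriv (localForm α x) (extChartAt (𝓡 (2 * m + 1)) x x) ![u, v] := by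
    refine congrArg (extDeriv (localForm α x) (extChartAt (𝓡 (2 * m + 1)) x x)) ?_
    exact congrArg₂ (fun a b : Model m => ![a, b]) (mfderiv_chart_self x u)
      (mfderiv_chart_self x v)
  rw [h0, extDeriv_apply hω, Fin.sum_univ_two, key, key, dBilin, dLoc_apply]
  simp [sub_eq_add_neg, Fin.removeNth]

lemma dLoc_repForm_pullForm {α : OneForm m M} (hα : SmoothOneForm α) {g : M → M}
    (hg : ContMDiff (𝓡 (2 * m + 1)) (𝓡 (2 * m + 1)) ∞ g) {c d : M} {y : Model m}
    (hy : y ∈ (extChartAt (𝓡 (2 * m + 1)) c).target)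
    (hd : g ((extChartAt (𝓡 (2 * m + 1)) c).symm y) ∈ (extChartAt (𝓡 (2 * m + 1)) d).source)
    (u v : Model m) :
    dLoc (repForm (pullForm g α) c) y u v =
      dLoc (repForm α d) (repMap g c d y) (fderiv ℝ (repMap g c d) y u)
        (fderiv ℝ (repMap g c d) y v) := by
  rw [← dLoc_pullback (a := repForm α d) (T := repMap g c d)
    ((hα.contDiffAt_repForm ((extChartAt (𝓡 (2 * m + 1)) d).map_source hd)).differentiableAt
      (by simp)) (contDiffAt_repMap hy hg.contMDiffAt hd)]
  congr 2
  apply dLoc_congr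
  filter_upwards [eventually_mem_target_and hy hg.continuous.continuousAt hd] with z hz
  exact repForm_pullForm α hz.1 (hg.mdifferentiableAt (by simp)) hz.2

/-- The exterior derivative is natural under pull-back. -/
lemma dBilin_pullForm {α : OneForm m M} (hα : SmoothOneForm α) {g : M → M}
    (hg : ContMDiff (𝓡 (2 * m + 1)) (𝓡 (2 * m + 1)) ∞ g) (x : M) (u v : Model m) :
    dBilin (pullForm g α) x u v = dBilin α (g x)
      ((mfderiv (𝓡 (2 * m + 1)) (𝓡 (2 * m + 1)) g x : Model m →L[ℝ] Model m) u)
      ((mfderiv (𝓡 (2 * m + 1)) (𝓡 (2 * m + 1)) g x : Model m →L[ℝ] Model m) v) := by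
  have hx := mem_extChartAt_target (I := 𝓡 (2 * m + 1)) x
  have hinv := extChartAt_to_inv (I := 𝓡 (2 * m + 1)) x
  have hd : g ((extChartAt (𝓡 (2 * m + 1)) x).symm (extChartAt (𝓡 (2 * m + 1)) x x)) ∈
      (extChartAt (𝓡 (2 * m + 1)) (g x)).source := by
    rw [hinv]; exact mem_extChartAt_source _
  have hf (w : Model m) : fderiv ℝ (repMap g x (g x)) (extChartAt (𝓡 (2 * m + 1)) x x) w =
      (mfderiv (𝓡 (2 * m + 1)) (𝓡 (2 * m + 1)) g x : Model m →L[ℝ] Model m) w := by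
    rw [fderiv_repMap_apply hx (hg.mdifferentiableAt (by simp)) hd, mfderiv_symm_chart_self]
    rw [hinv]
    exact mfderiv_chart_self _ _
  rw [dBilin, dLoc_repForm_pullForm hα hg hx hd, hf, hf, repMap, hinv]
  rfl

/-- The exterior derivative, computed in any chart. -/
lemma dBilin_eq_chart {α : OneForm m M} (hα : SmoothOneForm α) {c x : M}
    (hx : x ∈ (extChartAt (𝓡 (2 * m + 1)) c).source) (u v : Model m) :
    dBilin α x u v = dLoc (repForm α c) (extChartAt (𝓡 (2 * m + 1)) c x)
      ((mfderiv (𝓡 (2 * m + 1)) 𝓘(ℝ, Model m) (extChartAt (𝓡 (2 * m + 1)) c) x :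
        Model m →L[ℝ] Model m) u)
      ((mfderiv (𝓡 (2 * m + 1)) 𝓘(ℝ, Model m) (extChartAt (𝓡 (2 * m + 1)) c) x :
        Model m →L[ℝ] Model m) v) := by
  have hxt := mem_extChartAt_target (I := 𝓡 (2 * m + 1)) x
  have hinv := extChartAt_to_inv (I := 𝓡 (2 * m + 1)) x
  have hd : id ((extChartAt (𝓡 (2 * m + 1)) x).symm (extChartAt (𝓡 (2 * m + 1)) x x)) ∈
      (extChartAt (𝓡 (2 * m + 1)) c).source := by
    rw [hinv]; exact hx
  have hf (w : Model m) : fderiv ℝ (repMap id x c) (extChartAt (𝓡 (2 * m + 1)) x x) w =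
      (mfderiv (𝓡 (2 * m + 1)) 𝓘(ℝ, Model m) (extChartAt (𝓡 (2 * m + 1)) c) x :
        Model m →L[ℝ] Model m) w := by
    rw [fderiv_repMap_apply hxt mdifferentiableAt_id hd, mfderiv_symm_chart_self, mfderiv_id]
    rw [hinv]
    rfl
  have h := dLoc_repForm_pullForm hα contMDiff_id hxt hd u v
  rw [pullForm_id] at h
  rw [dBilin, h, hf, hf, repMap, hinv]
  rfl

lemma contDiffAt_comp_symm_chart {k : M → ℝ} (hk : ContMDiff (𝓡 (2 * m + 1)) 𝓘(ℝ, ℝ) ∞ k)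
    {c : M} {y : Model m} (hy : y ∈ (extChartAt (𝓡 (2 * m + 1)) c).target) :
    ContDiffAt ℝ ∞ (fun y => k ((extChartAt (𝓡 (2 * m + 1)) c).symm y)) y :=
  contMDiffAt_iff_contDiffAt.1 (hk.contMDiffAt.comp y (contMDiffAt_symm_chart hy))

lemma fderiv_comp_symm_chart {k : M → ℝ} (hk : ContMDiff (𝓡 (2 * m + 1)) 𝓘(ℝ, ℝ) ∞ k)
    {c : M} {y : Model m} (hy : y ∈ (extChartAt (𝓡 (2 * m + 1)) c).target) (v : Model m) :
    fderiv ℝ (fun y => k ((extChartAt (𝓡 (2 * m + 1)) c).symm y)) y v =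
      dFun k ((extChartAt (𝓡 (2 * m + 1)) c).symm y)
      ((mfderiv 𝓘(ℝ, Model m) (𝓡 (2 * m + 1)) (extChartAt (𝓡 (2 * m + 1)) c).symm y :
        Model m →L[ℝ] Model m) v) := by
  have h1 : HasMFDerivAt 𝓘(ℝ, Model m) 𝓘(ℝ, ℝ)
      (fun y => k ((extChartAt (𝓡 (2 * m + 1)) c).symm y)) y _ :=
    (hk.mdifferentiableAt (by simp)).hasMFDerivAt.comp y
      (mdifferentiableAt_symm_chart hy).hasMFDerivAt
  rw [← mfderiv_eq_fderiv, h1.mfderiv]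
  rfl

lemma SmoothOneForm.smulForm {α : OneForm m M} (hα : SmoothOneForm α) {k : M → ℝ}
    (hk : ContMDiff (𝓡 (2 * m + 1)) 𝓘(ℝ, ℝ) ∞ k) : SmoothOneForm (smulForm k α) :=
  (smoothOneForm_iff_contDiffAt _).2 fun x =>
    (contDiffAt_comp_symm_chart hk (mem_extChartAt_target x)).smul
      (hα.contDiffAt_repForm (mem_extChartAt_target x))

lemma dBilin_smulForm {α : OneForm m M} (hα : SmoothOneForm α) {k : M → ℝ}
    (hk : ContMDiff (𝓡 (2 * m + 1)) 𝓘(ℝ, ℝ) ∞ k) (x : M) (u v : Model m) :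
    dBilin (smulForm k α) x u v = k x * dBilin α x u v +
      (dFun k x u *
          (α x : Model m →L[ℝ] ℝ) v -
        dFun k x v *
          (α x : Model m →L[ℝ] ℝ) u) := by
  have hx := mem_extChartAt_target (I := 𝓡 (2 * m + 1)) x
  have hinv := extChartAt_to_inv (I := 𝓡 (2 * m + 1)) x
  have hr (w : Model m) : repForm α x (extChartAt (𝓡 (2 * m + 1)) x x) w =
      (α x : Model m →L[ℝ] ℝ) w := by
    have := repForm_chart_apply α (mem_extChartAt_source (I := 𝓡 (2 * m + 1)) x) w
    rwa [mfderiv_chart_self] at this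
  have hf (w : Model m) : fderiv ℝ (fun y => k ((extChartAt (𝓡 (2 * m + 1)) x).symm y))
      (extChartAt (𝓡 (2 * m + 1)) x x) w =
      dFun k x w := by
    rw [fderiv_comp_symm_chart hk hx, mfderiv_symm_chart_self, hinv]
  rw [dBilin, repForm_smulForm, dLoc_smul ((hα.contDiffAt_repForm hx).differentiableAt (by simp))
    ((contDiffAt_comp_symm_chart hk hx).differentiableAt (by simp)), hf, hf, hr, hr, hinv]
  rfl

end ExteriorDerivative

end ContactLF

namespace ContactLF

/-! ### Linear algebra of `a ∧ B ∧ ⋯ ∧ B` in odd dimension -/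

section WedgeTop

variable {V : Type*} [AddCommGroup V] [Module ℝ V] {m : ℕ}

/-- Each index occurs in exactly one factor of the product: index `0` in `a`, and an index `i > 0`
in the factor number `(i - 1) / 2`, in the first or second slot according to the parity of `i`. The
other factors form a constant. -/
lemma exists_linearMap_update_eq (a : V →ₗ[ℝ] ℝ) (B : V →ₗ[ℝ] V →ₗ[ℝ] ℝ)
    (v : Fin (2 * m + 1) → V) (i : Fin (2 * m + 1)) :
    ∃ L : V →ₗ[ℝ] ℝ, ∀ x, a (Function.update v i x 0) * ∏ j : Fin m,
      B (Function.update v i x ⟨2 * (j : ℕ) + 1, by omega⟩)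
        (Function.update v i x ⟨2 * (j : ℕ) + 2, by omega⟩) = L x := by
  by_cases h0 : i = 0
  · subst h0
    refine ⟨(∏ j : Fin m, B (v ⟨2 * (j : ℕ) + 1, by omega⟩)
        (v ⟨2 * (j : ℕ) + 2, by omega⟩)) • a, fun x => ?_⟩
    simp [Fin.ext_iff, mul_comm]
  have hi0 : (i : ℕ) ≠ 0 := fun h => h0 (Fin.ext h)
  let j₀ : Fin m := ⟨((i : ℕ) - 1) / 2, by omega⟩
  let c : ℝ := a (v 0) * ∏ j ∈ Finset.univ.erase j₀, B (v ⟨2 * (j : ℕ) + 1, by omega⟩)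
    (v ⟨2 * (j : ℕ) + 2, by omega⟩)
  have hne (x : V) (k : Fin (2 * m + 1)) (hk : (k : ℕ) ≠ i) : Function.update v i x k = v k :=
    Function.update_of_ne (fun h => hk (congrArg Fin.val h)) _ _
  have hc (x : V) : a (Function.update v i x 0) * ∏ j : Fin m,
      B (Function.update v i x ⟨2 * (j : ℕ) + 1, by omega⟩)
        (Function.update v i x ⟨2 * (j : ℕ) + 2, by omega⟩) =
      c * B (Function.update v i x ⟨2 * (j₀ : ℕ) + 1, by omega⟩)
        (Function.update v i x ⟨2 * (j₀ : ℕ) + 2, by omega⟩) := by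
    rw [← Finset.mul_prod_erase Finset.univ _ (Finset.mem_univ j₀), hne x 0 (by simpa using hi0.symm)]
    have : ∏ j ∈ Finset.univ.erase j₀, B (Function.update v i x ⟨2 * (j : ℕ) + 1, by omega⟩)
        (Function.update v i x ⟨2 * (j : ℕ) + 2, by omega⟩) =
      ∏ j ∈ Finset.univ.erase j₀, B (v ⟨2 * (j : ℕ) + 1, by omega⟩)
        (v ⟨2 * (j : ℕ) + 2, by omega⟩) := by
      refine Finset.prod_congr rfl fun j hj => ?_
      have hj' : (j : ℕ) ≠ ((i : ℕ) - 1) / 2 := fun h =>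
        (Finset.ne_of_mem_erase hj) (Fin.ext h)
      rw [hne _ _ (by simp only; omega), hne _ _ (by simp only; omega)]
    rw [this]
    simp only [c]
    ring
  rcases Nat.even_or_odd' (i : ℕ) with ⟨q, hq | hq⟩
  · refine ⟨c • B (v ⟨2 * (j₀ : ℕ) + 1, by omega⟩), fun x => ?_⟩
    rw [hc, hne x ⟨2 * (j₀ : ℕ) + 1, by omega⟩ (by simp only [j₀]; omega)]
    have : (⟨2 * (j₀ : ℕ) + 2, by omega⟩ : Fin (2 * m + 1)) = i := Fin.ext (by simp only [j₀]; omega)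
    rw [this, Function.update_self]
    rfl
  · refine ⟨c • B.flip (v ⟨2 * (j₀ : ℕ) + 2, by omega⟩), fun x => ?_⟩
    rw [hc, hne x ⟨2 * (j₀ : ℕ) + 2, by omega⟩ (by simp only [j₀]; omega)]
    have : (⟨2 * (j₀ : ℕ) + 1, by omega⟩ : Fin (2 * m + 1)) = i := Fin.ext (by simp only [j₀]; omega)
    rw [this, Function.update_self]
    rfl

/-- The multilinear map whose alternatization is the wedge product `a ∧ B ∧ ⋯ ∧ B`. -/
noncomputable def wedgeMultilinear (m : ℕ) (a : V →ₗ[ℝ] ℝ) (B : V →ₗ[ℝ] V →ₗ[ℝ] ℝ) :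
    MultilinearMap ℝ (fun _ : Fin (2 * m + 1) => V) ℝ :=
  MultilinearMap.mk' (fun v => a (v 0) * ∏ j : Fin m, B (v ⟨2 * (j : ℕ) + 1, by omega⟩)
      (v ⟨2 * (j : ℕ) + 2, by omega⟩))
    (fun v i x y => by
      obtain ⟨L, hL⟩ := exists_linearMap_update_eq a B v i
      simp only [hL, map_add])
    (fun v i c x => by
      obtain ⟨L, hL⟩ := exists_linearMap_update_eq a B v i
      simp only [hL, map_smul])

/-- The wedge product `a ∧ B ∧ ⋯ ∧ B`, as an alternating map. -/
noncomputable def wedgeAlt (m : ℕ) (a : V →ₗ[ℝ] ℝ) (B : V →ₗ[ℝ] V →ₗ[ℝ] ℝ) :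
    V [⋀^Fin (2 * m + 1)]→ₗ[ℝ] ℝ :=
  (2 ^ m : ℝ)⁻¹ • MultilinearMap.alternatization (wedgeMultilinear m a B)

lemma wedgeAlt_apply (a : V →ₗ[ℝ] ℝ) (B : V →ₗ[ℝ] V →ₗ[ℝ] ℝ) (v : Fin (2 * m + 1) → V) :
    wedgeAlt m a B v = wedgeTop m a (fun u w => B u w) v := by
  rw [wedgeAlt, AlternatingMap.smul_apply, MultilinearMap.alternatization_apply, wedgeTop,
    smul_eq_mul]
  congr 1
  refine Finset.sum_congr rfl fun σ _ => ?_
  rw [Units.smul_def, zsmul_eq_mul]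
  rfl

variable (hV : Module.finrank ℝ V = 2 * m + 1)

include hV

/-- Alternating forms of top degree are multiples of the determinant of a basis. -/
lemma alternating_map_comp (f : V [⋀^Fin (2 * m + 1)]→ₗ[ℝ] ℝ) (L : V →ₗ[ℝ] V)
    (v : Fin (2 * m + 1) → V) : f (fun i => L (v i)) = LinearMap.det L * f v := by
  have : FiniteDimensional ℝ V := Module.finite_of_finrank_eq_succ hV
  let e : Module.Basis (Fin (2 * m + 1)) ℝ V := Module.finBasisOfFinrankEq ℝ V hV
  rw [f.eq_smul_basis_det e, AlternatingMap.smul_apply, AlternatingMap.smul_apply]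
  have := e.det_comp L v
  simp only [Function.comp_def] at this
  rw [this, smul_eq_mul, smul_eq_mul]
  ring

/-- If `v` is a basis, some coordinate `i` of `n` is nonzero, and replacing `v i` by `n` multiplies
the value by that coordinate. After the replacement every summand contains `a n`, `B n _` or `B _
n`, hence vanishes. -/
lemma wedgeTop_eq_zero (a : V →ₗ[ℝ] ℝ) (B : V →ₗ[ℝ] V →ₗ[ℝ] ℝ)
    (hB : ∀ u v, B u v = -B v u) {n : V} (hn : n ≠ 0) (han : a n = 0) (hBn : ∀ u, B n u = 0)
    (v : Fin (2 * m + 1) → V) : wedgeTop m a (fun u w => B u w) v = 0 := by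
  rw [← wedgeAlt_apply]
  by_cases hv : LinearIndependent ℝ v
  swap
  · exact AlternatingMap.map_linearDependent _ _ hv
  let e : Module.Basis (Fin (2 * m + 1)) ℝ V :=
    basisOfLinearIndependentOfCardEqFinrank hv (by simp [hV])
  have he : ⇑e = v := by simp [e]
  obtain ⟨i, hi⟩ : ∃ i, e.repr n i ≠ 0 := by
    by_contra! h
    exact hn (e.repr.map_eq_zero_iff.1 (Finsupp.ext h))
  have hsum : wedgeAlt m a B (Function.update v i n) = e.repr n i * wedgeAlt m a B v := by
    have h1 : n = ∑ j, e.repr n j • v j := by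
      rw [← he]; exact (e.sum_repr n).symm
    conv_lhs => rw [h1]
    rw [AlternatingMap.map_update_sum, Finset.sum_eq_single i]
    · rw [AlternatingMap.map_update_smul, Function.update_eq_self, smul_eq_mul]
    · intro j _ hj
      rw [AlternatingMap.map_update_smul, AlternatingMap.map_update_self _ _ hj.symm, smul_zero]
    · simp
  have hBn' (u : V) : B u n = 0 := by rw [hB, hBn, neg_zero]
  have hzero : wedgeAlt m a B (Function.update v i n) = 0 := by
    rw [wedgeAlt_apply, wedgeTop]
    refine mul_eq_zero_of_right _ (Finset.sum_eq_zero fun σ _ => mul_eq_zero_of_right _ ?_)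
    set w := Function.update v i n
    have hw : w (σ (σ.symm i)) = n := by simp [w]
    set k := σ.symm i
    by_cases hk : k = 0
    · rw [← hk, hw, han, zero_mul]
    refine mul_eq_zero_of_right _ ?_
    have hk0 : (k : ℕ) ≠ 0 := fun h => hk (Fin.ext h)
    refine Finset.prod_eq_zero (Finset.mem_univ (⟨((k : ℕ) - 1) / 2, by omega⟩ : Fin m)) ?_
    rcases Nat.even_or_odd' (k : ℕ) with ⟨q, hq | hq⟩
    · have : (⟨2 * (((k : ℕ) - 1) / 2) + 2, by omega⟩ : Fin (2 * m + 1)) = k :=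
        Fin.ext (by simp only; omega)
      simp only [this, hw, hBn']
    · have : (⟨2 * (((k : ℕ) - 1) / 2) + 1, by omega⟩ : Fin (2 * m + 1)) = k :=
        Fin.ext (by simp only; omega)
      simp only [this, hw, hBn]
  rw [hzero] at hsum
  exact (mul_eq_zero.1 hsum.symm).resolve_left hi

/-- The correction `η ∧ a` disappears because `a ∧ a = 0`. As both sides are alternating of top
degree, the identity is only checked on one basis adapted to `ker a`. -/
lemma wedgeTop_smul_add (a η : V →ₗ[ℝ] ℝ) (B B' : V →ₗ[ℝ] V →ₗ[ℝ] ℝ) (k : ℝ)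
    (hB' : ∀ u w, B' u w = k * B u w + (η u * a w - η w * a u)) (v : Fin (2 * m + 1) → V) :
    wedgeTop m (fun u => k * a u) (fun u w => B' u w) v =
      k ^ (m + 1) * wedgeTop m a (fun u w => B u w) v := by
  have : FiniteDimensional ℝ V := Module.finite_of_finrank_eq_succ hV
  by_cases ha : a = 0
  · simp [wedgeTop, ha]
  have hsurj : Function.Surjective a := LinearMap.surjective ha
  obtain ⟨R, hR⟩ := hsurj 1
  have hker : Module.finrank ℝ a.ker = 2 * m := by
    have h1 := LinearMap.finrank_range_add_finrank_ker a
    rw [LinearMap.range_eq_top.2 hsurj, finrank_top, Module.finrank_self, hV] at h1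
    omega
  let b : Module.Basis (Fin (2 * m)) ℝ a.ker := Module.finBasisOfFinrankEq ℝ _ hker
  -- First vector `R` with `a R = 1`, the others in `ker a`. Only permutations fixing `0`
  -- contribute, and for these the factors `B'` see `ker a`, where `B' = k B`.
  let e : Module.Basis (Fin (2 * m + 1)) ℝ V := Module.Basis.mkFinCons R b
    (fun c x hx h => by
      have := congrArg a h
      simpa [hR, LinearMap.mem_ker.1 hx] using this)
    (fun z => ⟨-a z, by simp [hR]⟩)
  have he (i : Fin (2 * m + 1)) (hi : i ≠ 0) : a (e i) = 0 := by
    obtain ⟨j, rfl⟩ := Fin.exists_succ_eq.2 hi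
    simp [e, Module.Basis.coe_mkFinCons]
  have hf : wedgeAlt m (k • a) B' e = k ^ (m + 1) * wedgeAlt m a B e := by
    rw [wedgeAlt_apply, wedgeAlt_apply, wedgeTop, wedgeTop, mul_left_comm]
    congr 1
    rw [Finset.mul_sum]
    refine Finset.sum_congr rfl fun σ _ => ?_
    rw [mul_left_comm (k ^ (m + 1))]
    congr 1
    by_cases hσ : σ 0 = 0
    · have hne (i : Fin (2 * m + 1)) (hi : (i : ℕ) ≠ 0) : a (e (σ i)) = 0 := by
        refine he _ fun h => hi ?_
        rw [← hσ] at h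
        exact congrArg Fin.val (σ.injective h)
      have hprod : ∏ j : Fin m, B' (e (σ ⟨2 * (j : ℕ) + 1, by omega⟩))
          (e (σ ⟨2 * (j : ℕ) + 2, by omega⟩)) = k ^ m *
          ∏ j : Fin m, B (e (σ ⟨2 * (j : ℕ) + 1, by omega⟩))
          (e (σ ⟨2 * (j : ℕ) + 2, by omega⟩)) := by
        have hcard : k ^ m = ∏ _j : Fin m, k := by simp
        rw [hcard, ← Finset.prod_mul_distrib]
        refine Finset.prod_congr rfl fun j _ => ?_
        rw [hB', hne _ (by simp), hne _ (by simp)]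
        ring
      rw [hprod, LinearMap.smul_apply, smul_eq_mul]
      ring
    · simp [he _ hσ]
  have h1 := congrArg (fun g : V [⋀^Fin (2 * m + 1)]→ₗ[ℝ] ℝ => g v)
    ((wedgeAlt m (k • a) B').eq_smul_basis_det e)
  have h2 := congrArg (fun g : V [⋀^Fin (2 * m + 1)]→ₗ[ℝ] ℝ => g v)
    ((wedgeAlt m a B).eq_smul_basis_det e)
  simp only [AlternatingMap.smul_apply, smul_eq_mul] at h1 h2
  rw [wedgeAlt_apply] at h1 h2
  rw [h2]
  refine h1.trans ?_
  rw [hf]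
  ring

/-- On an odd-dimensional space a skew-symmetric bilinear form is degenerate. -/
lemma exists_ne_zero_kernel (B : V →ₗ[ℝ] V →ₗ[ℝ] ℝ) (hB : ∀ u v, B u v = -B v u) :
    ∃ n : V, n ≠ 0 ∧ ∀ u, B n u = 0 := by
  have : FiniteDimensional ℝ V := Module.finite_of_finrank_eq_succ hV
  let e : Module.Basis (Fin (2 * m + 1)) ℝ V := Module.finBasisOfFinrankEq ℝ V hV
  let A : Matrix (Fin (2 * m + 1)) (Fin (2 * m + 1)) ℝ := Matrix.of fun i j => B (e i) (e j)
  have hA : A.transpose = -A := by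
    ext i j
    simp only [A, Matrix.transpose_apply, Matrix.of_apply, Matrix.neg_apply]
    exact hB _ _
  have hdet : A.det = 0 := by
    have h1 := A.det_transpose
    rw [hA, Matrix.det_neg, Fintype.card_fin, Odd.neg_one_pow ⟨m, rfl⟩] at h1
    linarith
  obtain ⟨c, hc, hcA⟩ := Matrix.exists_vecMul_eq_zero_iff.2 hdet
  refine ⟨∑ i, c i • e i, fun h => hc ?_, fun u => ?_⟩
  · funext i
    exact Fintype.linearIndependent_iff.1 e.linearIndependent c h i
  · have h2 : B (∑ i, c i • e i) = 0 := by
      refine e.ext fun j => ?_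
      have := congrFun hcA j
      simp only [Matrix.vecMul, dotProduct, A, Matrix.of_apply, Pi.zero_apply] at this
      simpa using this
    rw [h2]; rfl

end WedgeTop

end ContactLF

namespace ContactLF

/-! ### Contact forms and their Reeb vector fields -/

section ContactForms

open scoped Topology

set_option synthInstance.maxHeartbeats 200000 in
lemma _root_.ContDiffAt.dLoc {E : Type*} [NormedAddCommGroup E] [NormedSpace ℝ E]
    {a : E → E →L[ℝ] ℝ} {y : E} (ha : ContDiffAt ℝ ∞ a y) : ContDiffAt ℝ ∞ (dLoc a) y := by
  have hfa : ContDiffAt ℝ ∞ (fderiv ℝ a) y := ha.fderiv_right (by simp)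
  have h : ContDiff ℝ ∞ (fun L : E →L[ℝ] E →L[ℝ] ℝ => L.flip) :=
    IsBoundedLinearMap.contDiff ⟨⟨fun _ _ => rfl, fun _ _ => rfl⟩, 1, one_pos, fun L => by
      rw [ContinuousLinearMap.opNorm_flip, one_mul]⟩
  exact hfa.sub (ContDiffAt.comp (g := fun L : E →L[ℝ] E →L[ℝ] ℝ => L.flip) y h.contDiffAt hfa)

lemma _root_.ContDiffAt.smulRight_self {E : Type*} [NormedAddCommGroup E] [NormedSpace ℝ E]
    {a : E → E →L[ℝ] ℝ} {y : E} (ha : ContDiffAt ℝ ∞ a y) :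
    ContDiffAt ℝ ∞ (fun z => (a z).smulRight (a z)) y :=
  ha.smulRight ha

variable {m : ℕ} {M : Type*} [TopologicalSpace M] [ChartedSpace (Model m) M]

/-- The derivative of `g` at `x`, as a linear map of the model space. -/
noncomputable def der (g : M → M) (x : M) : Model m →L[ℝ] Model m :=
  mfderiv (𝓡 (2 * m + 1)) (𝓡 (2 * m + 1)) g x

/-- The value of a 1-form, as a linear form on the model space. -/
noncomputable def formAt (α : OneForm m M) (x : M) : Model m →L[ℝ] ℝ := α x

lemma pullForm_apply (g : M → M) (α : OneForm m M) (x : M) (v : Model m) :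
    formAt (pullForm g α) x v = formAt α (g x) (der g x v) := rfl

lemma smulForm_apply (k : M → ℝ) (α : OneForm m M) (x : M) (v : Model m) :
    formAt (smulForm k α) x v = k x * formAt α x v := rfl

lemma dBilin_skew (α : OneForm m M) (x : M) (u v : Model m) :
    dBilin α x u v = -dBilin α x v u := dLoc_skew _ _ _ _

/-- The derivative of a diffeomorphism, as a linear equivalence of the model space. -/
noncomputable def diffeoDeriv (g : M ≃ₘ⟮𝓡 (2 * m + 1), 𝓡 (2 * m + 1)⟯ M) (x : M) :
    Model m ≃L[ℝ] Model m :=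
  g.mfderivToContinuousLinearEquiv (by simp) x

lemma diffeoDeriv_apply (g : M ≃ₘ⟮𝓡 (2 * m + 1), 𝓡 (2 * m + 1)⟯ M) (x : M) (v : Model m) :
    diffeoDeriv g x v = der g x v := by
  have h := g.mfderivToContinuousLinearEquiv_coe (x := x) (by simp : (∞ : WithTop ℕ∞) ≠ 0)
  exact congrArg (fun L : Model m →L[ℝ] Model m => L v) h

lemma der_diffeoDeriv_symm (g : M ≃ₘ⟮𝓡 (2 * m + 1), 𝓡 (2 * m + 1)⟯ M) (x : M) (v : Model m) :
    der g x ((diffeoDeriv g x).symm v) = v :=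
  (diffeoDeriv_apply g x _).symm.trans ((diffeoDeriv g x).apply_symm_apply v)

variable [IsManifold (𝓡 (2 * m + 1)) ∞ M]

lemma wedgeTop_comp {V W : Type*} {m : ℕ} (f : V → W) (a : W → ℝ) (b : W → W → ℝ)
    (v : Fin (2 * m + 1) → V) :
    wedgeTop m (fun u => a (f u)) (fun u w => b (f u) (f w)) v = wedgeTop m a b (fun i => f (v i)) :=
  rfl

lemma finrank_model (m : ℕ) : Module.finrank ℝ (Model m) = 2 * m + 1 := by simp

/-- A continuous bilinear form as a bilinear map. -/
noncomputable def bilinToLinear {E : Type*} [NormedAddCommGroup E] [NormedSpace ℝ E]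
    (B : E →L[ℝ] E →L[ℝ] ℝ) : E →ₗ[ℝ] E →ₗ[ℝ] ℝ :=
  LinearMap.mk₂ ℝ (fun u v => B u v) (fun u v w => by simp) (fun c u v => by simp)
    (fun u v w => by simp) (fun c u v => by simp)

lemma topForm_eq {α : OneForm m M} (hα : SmoothOneForm α) (x : M)
    (v : Fin (2 * m + 1) → Model m) :
    topForm α x v = wedgeTop m (formAt α x).toLinearMap
      (fun u w => bilinToLinear (dBilin α x) u w) v := by
  have h : dForm α x = fun u w : Model m => dBilin α x u w := by
    funext u w; exact dForm_eq_dBilin hα x u w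
  exact congrArg (fun b => wedgeTop m (formAt α x) b v) h

/-- `v` is the value at `x` of the Reeb vector field of `α`. -/
def IsReebVector (α : OneForm m M) (x : M) (v : Model m) : Prop :=
  formAt α x v = 1 ∧ ∀ w, dBilin α x v w = 0

/-- A nonzero common kernel vector of `α` and `dα` would annihilate the top-degree form. -/
lemma IsContactForm.eq_zero_of_kernel {α : OneForm m M} (hα : IsContactForm α) {x : M}
    {n : Model m} (h : formAt α x n = 0) (h' : ∀ w, dBilin α x n w = 0) : n = 0 := by
  by_contra hn
  obtain ⟨v, hv⟩ := hα.2 x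
  exact hv ((topForm_eq hα.1 x v).trans (wedgeTop_eq_zero (finrank_model m) _ _
    (fun u w => dBilin_skew α x u w) hn h h' v))

/-- In odd dimension `dα` has a nonzero kernel vector; the contact condition makes `α` nonzero on
it, so it can be normalized. -/
lemma IsContactForm.exists_isReebVector {α : OneForm m M} (hα : IsContactForm α) (x : M) :
    ∃ v, IsReebVector α x v := by
  obtain ⟨n, hn, hB⟩ := exists_ne_zero_kernel (finrank_model m) (bilinToLinear (dBilin α x))
    (fun u w => dBilin_skew α x u w)
  have han : formAt α x n ≠ 0 := fun h => hn (hα.eq_zero_of_kernel h hB)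
  refine ⟨(formAt α x n)⁻¹ • n, ?_, fun w => ?_⟩
  · rw [map_smul, smul_eq_mul, inv_mul_cancel₀ han]
  · have : dBilin α x n w = 0 := hB w
    simp [this]

lemma IsContactForm.isReebVector_unique {α : OneForm m M} (hα : IsContactForm α) {x : M}
    {v w : Model m} (hv : IsReebVector α x v) (hw : IsReebVector α x w) : v = w := by
  refine sub_eq_zero.1 (hα.eq_zero_of_kernel (x := x) ?_ fun u => ?_)
  · rw [map_sub, hv.1, hw.1, sub_self]
  · simp [hv.2 u, hw.2 u]

lemma IsContactForm.isReebVector_reebField {α : OneForm m M} (hα : IsContactForm α) (x : M) :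
    IsReebVector α x (reebField α x) := by
  obtain ⟨v, hv⟩ := hα.exists_isReebVector x
  have h : ∃ v : TangentSpace (𝓡 (2 * m + 1)) x, α x v = 1 ∧ ∀ w, dForm α x v w = 0 :=
    ⟨v, hv.1, fun w => (dForm_eq_dBilin hα.1 x v w).trans (hv.2 w)⟩
  have h2 := Classical.epsilon_spec h
  exact ⟨h2.1, fun w => (dForm_eq_dBilin hα.1 x _ w).symm.trans (h2.2 w)⟩

lemma IsContactForm.reebField_eq {α : OneForm m M} (hα : IsContactForm α) {x : M} {v : Model m}
    (hv : IsReebVector α x v) : reebField α x = v :=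
  hα.isReebVector_unique (hα.isReebVector_reebField x) hv

lemma topForm_pullForm {α : OneForm m M} (hα : SmoothOneForm α) {g : M → M}
    (hg : ContMDiff (𝓡 (2 * m + 1)) (𝓡 (2 * m + 1)) ∞ g) (x : M)
    (v : Fin (2 * m + 1) → Model m) :
    topForm (pullForm g α) x v = topForm α (g x)
      (fun i => der g x (v i)) := by
  refine (topForm_eq (hα.pullForm hg) x v).trans (Eq.trans ?_ (topForm_eq hα _ _).symm)
  have h : (fun u w : Model m => bilinToLinear (dBilin (pullForm g α) x) u w) =
      fun u w => bilinToLinear (dBilin α (g x)) (der g x u) (der g x w) := by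
    funext u w; exact dBilin_pullForm hα hg x _ _
  exact (congrArg (fun b => wedgeTop m (formAt (pullForm g α) x) b v) h).trans
    (wedgeTop_comp (der g x) (formAt α (g x)) (fun u w => bilinToLinear (dBilin α (g x)) u w) v)

lemma topForm_smulForm {α : OneForm m M} (hα : SmoothOneForm α) {k : M → ℝ}
    (hk : ContMDiff (𝓡 (2 * m + 1)) 𝓘(ℝ, ℝ) ∞ k) (x : M) (v : Fin (2 * m + 1) → Model m) :
    topForm (smulForm k α) x v = k x ^ (m + 1) * topForm α x v := by
  refine (topForm_eq (hα.smulForm hk) x v).trans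
    (Eq.trans ?_ (congrArg _ (topForm_eq hα x v).symm))
  exact wedgeTop_smul_add (finrank_model m) (formAt α x).toLinearMap
    (dFun k x).toLinearMap (bilinToLinear (dBilin α x)) (bilinToLinear (dBilin (smulForm k α) x))
    (k x) (fun u w => dBilin_smulForm hα hk x u w) v

lemma IsContactForm.smulForm {α : OneForm m M} (hα : IsContactForm α) {k : M → ℝ}
    (hk : ContMDiff (𝓡 (2 * m + 1)) 𝓘(ℝ, ℝ) ∞ k) (hk0 : ∀ x, k x ≠ 0) :
    IsContactForm (smulForm k α) := by
  refine ⟨hα.1.smulForm hk, fun x => ?_⟩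
  obtain ⟨v, hv⟩ := hα.2 x
  exact ⟨v, (topForm_smulForm hα.1 hk x v).trans_ne (mul_ne_zero (pow_ne_zero _ (hk0 x)) hv)⟩

lemma IsContactForm.pullForm {α : OneForm m M} (hα : IsContactForm α)
    (g : M ≃ₘ⟮𝓡 (2 * m + 1), 𝓡 (2 * m + 1)⟯ M) : IsContactForm (pullForm g α) := by
  refine ⟨hα.1.pullForm g.contMDiff, fun x => ?_⟩
  obtain ⟨v, hv⟩ := hα.2 (g x)
  refine ⟨fun i => (diffeoDeriv g x).symm (v i), ?_⟩
  refine (topForm_pullForm hα.1 g.contMDiff x _).trans_ne ?_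
  have h : (fun i => der g x ((diffeoDeriv g x).symm (v i))) = v :=
    funext fun i => der_diffeoDeriv_symm g x (v i)
  exact (congrArg (topForm α (g x)) h).trans_ne hv

/-- The push-forward by `g` satisfies the two equations that characterize the Reeb vector of `α`, by
naturality of `d` and surjectivity of the derivative of `g`. -/
lemma IsContactForm.mfderiv_reebField_pullForm {α : OneForm m M} (hα : IsContactForm α)
    (g : M ≃ₘ⟮𝓡 (2 * m + 1), 𝓡 (2 * m + 1)⟯ M) (x : M) :
    der g x
      (reebField (ContactLF.pullForm g α) x) = reebField α (g x) := by
  have h := (hα.pullForm g).isReebVector_reebField x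
  refine (hα.reebField_eq ⟨h.1, fun w => ?_⟩).symm
  have h2 := h.2 ((diffeoDeriv g x).symm w)
  have h3 := (dBilin_pullForm hα.1 g.contMDiff x _ _).symm.trans h2
  exact (congrArg (dBilin α (g x) _) (der_diffeoDeriv_symm g x w)).symm.trans h3

/-- The Reeb vector field is smooth. -/
lemma IsContactForm.smoothVField_reebField {α : OneForm m M} (hα : IsContactForm α) :
    SmoothVField (reebField α) := by
  refine smoothVField_of_contDiffAt fun x => ?_
  set y₀ := extChartAt (𝓡 (2 * m + 1)) x x with hy₀
  have hy₀t : y₀ ∈ (extChartAt (𝓡 (2 * m + 1)) x).target := mem_extChartAt_target x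
  let a := repForm α x
  have ha : ContDiffAt ℝ ∞ a y₀ := hα.1.contDiffAt_repForm hy₀t
  -- The map `u ↦ dα(u, ·) + α(u) α` is invertible for a contact form and sends the Reeb vector to
  -- `α`. Thus the Reeb field is `Λ⁻¹ α`, smooth because inversion of operators is smooth.
  let Λ : Model m → Model m →L[ℝ] Model m →L[ℝ] ℝ := fun y => dLoc a y + (a y).smulRight (a y)
  have hΛ : ContDiffAt ℝ ∞ Λ y₀ := by
    exact ha.dLoc.add ha.smulRight_self
  have hΛR : ∀ y ∈ (extChartAt (𝓡 (2 * m + 1)) x).target,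
      Λ y (repField (reebField α) x y) = a y := by
    intro y hy
    have hsrc := (extChartAt (𝓡 (2 * m + 1)) x).map_target hy
    have hR := hα.isReebVector_reebField ((extChartAt (𝓡 (2 * m + 1)) x).symm y)
    ext1 w
    have h1 : a y (repField (reebField α) x y) = 1 := by
      have := repForm_chart_apply α hsrc (reebField α ((extChartAt (𝓡 (2 * m + 1)) x).symm y))
      rw [(extChartAt (𝓡 (2 * m + 1)) x).right_inv hy] at this
      exact this.trans hR.1
    have h2 : dLoc a y (repField (reebField α) x y) w = 0 := by
      have := dBilin_eq_chart hα.1 hsrc (reebField α ((extChartAt (𝓡 (2 * m + 1)) x).symm y))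
        ((mfderiv 𝓘(ℝ, Model m) (𝓡 (2 * m + 1)) (extChartAt (𝓡 (2 * m + 1)) x).symm y :
          Model m →L[ℝ] Model m) w)
      rw [(extChartAt (𝓡 (2 * m + 1)) x).right_inv hy] at this
      exact (congrArg (dLoc a y _) (mfderiv_chart_comp_symm hy w)).symm.trans
        (this.symm.trans (hR.2 _))
    simp [Λ, h1, h2]
  have hker : ∀ u, Λ y₀ u = 0 → u = 0 := by
    intro u hu
    -- Evaluating `Λ u = 0` on the Reeb vector gives `α(u) = 0`; then `dα(u, ·) = 0` as well, and
    -- the contact condition applies.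
    obtain ⟨R, hR⟩ := hα.exists_isReebVector x
    have har (w : Model m) : a y₀ w = formAt α x w := by
      have := repForm_chart_apply α (mem_extChartAt_source (I := 𝓡 (2 * m + 1)) x) w
      rwa [mfderiv_chart_self] at this
    have h0 (w : Model m) : dBilin α x u w + a y₀ u * a y₀ w = 0 :=
      congrArg (fun L : Model m →L[ℝ] ℝ => L w) hu
    have h1 : a y₀ u = 0 := by
      have := h0 R
      rw [dBilin_skew, hR.2, har R, hR.1] at this
      simpa using this
    refine hα.eq_zero_of_kernel (x := x) ((har u).symm.trans h1) fun w => ?_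
    have := h0 w
    rwa [h1, zero_mul, add_zero] at this
  have hinj : Function.Injective (Λ y₀) := by
    rw [← ContinuousLinearMap.coe_coe, ← LinearMap.ker_eq_bot, LinearMap.ker_eq_bot']
    exact hker
  have hfin : Module.finrank ℝ (Model m) = Module.finrank ℝ (Model m →L[ℝ] ℝ) := by
    rw [← LinearEquiv.finrank_eq (LinearMap.toContinuousLinearMap (𝕜 := ℝ) (E := Model m)
      (F' := ℝ))]
    exact (Subspace.dual_finrank_eq).symm
  let e : Model m ≃L[ℝ] (Model m →L[ℝ] ℝ) :=
    (LinearEquiv.ofInjectiveOfFinrankEq (Λ y₀).toLinearMap hinj hfin).toContinuousLinearEquiv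
  have he : (e : Model m →L[ℝ] (Model m →L[ℝ] ℝ)) = Λ y₀ := by
    ext1 u; rfl
  have hinvs : ContDiffAt ℝ ∞ (fun y => (Λ y).inverse (a y)) y₀ := by
    have h1 : ContDiffAt ℝ ∞ ContinuousLinearMap.inverse (Λ y₀) := by
      rw [← he]; exact contDiffAt_map_inverse e
    exact (h1.comp y₀ hΛ).clm_apply ha
  refine hinvs.congr_of_eventuallyEq ?_
  have hop : ∀ᶠ y in 𝓝 y₀, Λ y ∈ range ((↑) : (Model m ≃L[ℝ] (Model m →L[ℝ] ℝ)) → _) :=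
    hΛ.continuousAt.eventually (by rw [← he]; exact ContinuousLinearEquiv.nhds e)
  filter_upwards [hop, (isOpen_target x).mem_nhds hy₀t] with y ⟨f, hf⟩ hy
  rw [← hΛR y hy, ← hf, ContinuousLinearMap.inverse_equiv]
  exact (f.symm_apply_apply _).symm

end ContactForms

end ContactLF

namespace ContactLF

/-! ### Flows on closed manifolds -/

section Flows

open scoped Topology

variable {m : ℕ} {M : Type*} [TopologicalSpace M] [ChartedSpace (Model m) M]
  [IsManifold (𝓡 (2 * m + 1)) ∞ M]

lemma comp_toSpanSingleton {E F : Type*} [NormedAddCommGroup E] [NormedSpace ℝ E]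
    [NormedAddCommGroup F] [NormedSpace ℝ F] (A : E →L[ℝ] F) {v : E} {w : F} (h : A v = w) :
    A.comp (ContinuousLinearMap.toSpanSingleton ℝ v) = (1 : ℝ →L[ℝ] ℝ).smulRight w := by
  ext; simp [h]

lemma SmoothVField.exists_local_flow {X : VField m M} (hX : SmoothVField X) (x₀ : M) :
    ∃ δ > 0, ∃ W ∈ 𝓝 x₀, ∃ Φ : ℝ × M → M,
      (∀ t ∈ Ioo (-δ) δ, ∀ x ∈ W,
        ContMDiffAt (𝓘(ℝ, ℝ).prod (𝓡 (2 * m + 1))) (𝓡 (2 * m + 1)) ∞ Φ (t, x)) ∧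
      ∀ x ∈ W, Φ (0, x) = x ∧ IsMIntegralCurveOn (I := 𝓡 (2 * m + 1)) (fun t => Φ (t, x)) X
        (Ioo (-δ) δ) := by
  set e := extChartAt (𝓡 (2 * m + 1)) x₀ with he
  obtain ⟨δ, hδ, Φ, hΦ, hΦx⟩ := exists_contDiffOn_flow (isOpen_target x₀)
    (fun y hy => (hX.contDiffAt_repField hy).contDiffWithinAt) (mem_extChartAt_target x₀)
  let W : Set M := e.source ∩ e ⁻¹' Metric.ball (e x₀) δ
  have hWo : IsOpen W := (continuousOn_extChartAt x₀).isOpen_inter_preimage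
    (isOpen_extChartAt_source x₀) Metric.isOpen_ball
  refine ⟨δ, hδ, W, hWo.mem_nhds ⟨mem_extChartAt_source x₀, Metric.mem_ball_self hδ⟩,
    fun p => e.symm (Φ (p.1, e p.2)), fun t ht x hx => ?_, fun x hx => ⟨?_, fun t ht => ?_⟩⟩
  · have h1 : ContMDiffAt (𝓘(ℝ, ℝ).prod (𝓡 (2 * m + 1))) 𝓘(ℝ, ℝ × Model m) ∞
        (fun p : ℝ × M => (p.1, e p.2)) (t, x) := by
      rw [modelWithCornersSelf_prod, ← chartedSpaceSelf_prod]
      exact contMDiffAt_fst.prodMk ((contMDiffAt_chart hx.1).comp (t, x) contMDiffAt_snd)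
    have h2 : ContDiffAt ℝ ∞ Φ (t, e x) :=
      hΦ.contDiffAt ((isOpen_Ioo.prod Metric.isOpen_ball).mem_nhds ⟨ht, hx.2⟩)
    have h3 := (contMDiffAt_iff_contDiffAt.2 h2).comp (t, x) h1
    exact (contMDiffAt_symm_chart ((hΦx _ hx.2).2 t ht).1).comp (t, x) h3
  · show e.symm (Φ (0, e x)) = x
    rw [(hΦx _ hx.2).1, e.left_inv hx.1]
  · obtain ⟨hU, hd⟩ := (hΦx _ hx.2).2 t ht
    have h := (mdifferentiableAt_symm_chart hU).hasMFDerivAt.comp t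
      hd.hasFDerivAt.hasMFDerivAt
    have hL := comp_toSpanSingleton (E := Model m) (F := Model m) (mfderiv 𝓘(ℝ, Model m)
      (𝓡 (2 * m + 1)) e.symm (Φ (t, e x))) (v := repField X x₀ (Φ (t, e x)))
      (w := X (e.symm (Φ (t, e x)))) (mfderiv_symm_comp_chart hU _)
    exact (h.congr_mfderiv hL).hasMFDerivWithinAt

lemma SmoothVField.contMDiff_one {X : VField m M} (hX : SmoothVField X) :
    ContMDiff (𝓡 (2 * m + 1)) (𝓡 (2 * m + 1)).tangent 1
      (fun x => (⟨x, X x⟩ : TangentBundle (𝓡 (2 * m + 1)) M)) :=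
  ContMDiff.of_le hX (by simp)

variable [CompactSpace M] [T2Space M]

/-- Compactness gives a uniform time of existence, which forces completeness. -/
lemma SmoothVField.exists_integralCurve {X : VField m M} (hX : SmoothVField X) (x : M) :
    ∃ γ : ℝ → M, γ 0 = x ∧ IsMIntegralCurve (I := 𝓡 (2 * m + 1)) γ X := by
  have : IsManifold (𝓡 (2 * m + 1)) 1 M := IsManifold.of_le (n := ∞) (by simp)
  have h : ∃ ε > 0, ∀ x ∈ (univ : Set M), ∃ γ : ℝ → M, γ 0 = x ∧
      IsMIntegralCurveOn (I := 𝓡 (2 * m + 1)) γ X (Ioo (-ε) ε) := by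
    refine isCompact_univ.induction_on (p := fun s => ∃ ε > 0, ∀ x ∈ s, ∃ γ : ℝ → M, γ 0 = x ∧
      IsMIntegralCurveOn (I := 𝓡 (2 * m + 1)) γ X (Ioo (-ε) ε)) ⟨1, one_pos, by simp⟩ ?_ ?_ ?_
    · exact fun s t hst ⟨ε, hε, h⟩ => ⟨ε, hε, fun x hx => h x (hst hx)⟩
    · rintro s t ⟨ε, hε, h⟩ ⟨η, hη, h'⟩
      refine ⟨min ε η, lt_min hε hη, ?_⟩
      rintro x (hx | hx)
      · obtain ⟨γ, h0, hγ⟩ := h x hx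
        exact ⟨γ, h0, hγ.mono (Ioo_subset_Ioo (neg_le_neg (min_le_left _ _)) (min_le_left _ _))⟩
      · obtain ⟨γ, h0, hγ⟩ := h' x hx
        exact ⟨γ, h0, hγ.mono (Ioo_subset_Ioo (neg_le_neg (min_le_right _ _)) (min_le_right _ _))⟩
    · intro x _
      obtain ⟨δ, hδ, W, hW, Φ, -, hΦ⟩ := hX.exists_local_flow x
      exact ⟨W, mem_nhdsWithin_of_mem_nhds hW, δ, hδ, fun z hz => ⟨fun t => Φ (t, z), hΦ z hz⟩⟩
  obtain ⟨ε, hε, h⟩ := h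
  exact exists_isMIntegralCurve_of_isMIntegralCurveOn hX.contMDiff_one hε
    (fun x => h x (mem_univ x)) x

lemma SmoothVField.flow_spec {X : VField m M} (hX : SmoothVField X) (x : M) :
    flow X 0 x = x ∧ IsMIntegralCurve (I := 𝓡 (2 * m + 1)) (fun t => flow X t x) X :=
  Classical.epsilon_spec (hX.exists_integralCurve x)

lemma SmoothVField.flow_zero {X : VField m M} (hX : SmoothVField X) (x : M) : flow X 0 x = x :=
  (hX.flow_spec x).1

lemma SmoothVField.isMIntegralCurve_flow {X : VField m M} (hX : SmoothVField X) (x : M) :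
    IsMIntegralCurve (I := 𝓡 (2 * m + 1)) (fun t => flow X t x) X :=
  (hX.flow_spec x).2

/-- Uniqueness of integral curves makes `flow` independent of the choice in its definition; the
group law follows. -/
lemma SmoothVField.eq_flow {X : VField m M} (hX : SmoothVField X) {γ : ℝ → M}
    (hγ : IsMIntegralCurve (I := 𝓡 (2 * m + 1)) γ X) (t : ℝ) : γ t = flow X t (γ 0) := by
  have : IsManifold (𝓡 (2 * m + 1)) 1 M := IsManifold.of_le (n := ∞) (by simp)
  exact congrFun (isMIntegralCurve_Ioo_eq_of_contMDiff_boundaryless (t₀ := 0) hX.contMDiff_one hγ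
    (hX.isMIntegralCurve_flow (γ 0)) (hX.flow_zero _).symm) t

lemma SmoothVField.flow_add {X : VField m M} (hX : SmoothVField X) (s t : ℝ) (x : M) :
    flow X (s + t) x = flow X s (flow X t x) := by
  have h := hX.eq_flow ((hX.isMIntegralCurve_flow x).comp_add t) s
  simpa using h

lemma SmoothVField.flow_neg_flow {X : VField m M} (hX : SmoothVField X) (t : ℝ) (x : M) :
    flow X (-t) (flow X t x) = x := by
  rw [← hX.flow_add, neg_add_cancel, hX.flow_zero]

lemma SmoothVField.flow_flow_neg {X : VField m M} (hX : SmoothVField X) (t : ℝ) (x : M) :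
    flow X t (flow X (-t) x) = x := by
  rw [← hX.flow_add, add_neg_cancel, hX.flow_zero]

/-- The flow of a smooth vector field on a closed manifold is smooth. -/
lemma SmoothVField.contMDiff_flow {X : VField m M} (hX : SmoothVField X) :
    ContMDiff (𝓘(ℝ, ℝ).prod (𝓡 (2 * m + 1))) (𝓡 (2 * m + 1)) ∞
      (fun p : ℝ × M => flow X p.1 p.2) := by
  have : IsManifold (𝓡 (2 * m + 1)) 1 M := IsManifold.of_le (n := ∞) (by simp)
  have h : ∃ ε > 0, ∀ x ∈ (univ : Set M), ∀ t ∈ Ioo (-ε) ε,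
      ContMDiffAt (𝓘(ℝ, ℝ).prod (𝓡 (2 * m + 1))) (𝓡 (2 * m + 1)) ∞
      (fun p : ℝ × M => flow X p.1 p.2) (t, x) := by
    refine isCompact_univ.induction_on (p := fun s => ∃ ε > 0, ∀ x ∈ s, ∀ t ∈ Ioo (-ε) ε,
      ContMDiffAt (𝓘(ℝ, ℝ).prod (𝓡 (2 * m + 1))) (𝓡 (2 * m + 1)) ∞
      (fun p : ℝ × M => flow X p.1 p.2) (t, x)) ⟨1, one_pos, by simp⟩ ?_ ?_ ?_
    · exact fun s t hst ⟨ε, hε, h⟩ => ⟨ε, hε, fun x hx => h x (hst hx)⟩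
    · rintro s t ⟨ε, hε, h⟩ ⟨η, hη, h'⟩
      refine ⟨min ε η, lt_min hε hη, ?_⟩
      rintro x (hx | hx) τ hτ
      · exact h x hx τ (Ioo_subset_Ioo (neg_le_neg (min_le_left _ _)) (min_le_left _ _) hτ)
      · exact h' x hx τ (Ioo_subset_Ioo (neg_le_neg (min_le_right _ _)) (min_le_right _ _) hτ)
    · intro x₀ _
      obtain ⟨δ, hδ, W, hW, Φ, hΦ, hΦx⟩ := hX.exists_local_flow x₀
      have heq : ∀ t ∈ Ioo (-δ) δ, ∀ x ∈ W, flow X t x = Φ (t, x) := fun t ht x hx =>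
        isMIntegralCurveOn_Ioo_eqOn_of_contMDiff_boundaryless
          (show (0 : ℝ) ∈ Ioo (-δ) δ by simpa using hδ) hX.contMDiff_one
          ((hX.isMIntegralCurve_flow x).isMIntegralCurveOn _) (hΦx x hx).2
          ((hX.flow_zero x).trans (hΦx x hx).1.symm) ht
      refine ⟨interior W, mem_nhdsWithin_of_mem_nhds (interior_mem_nhds.2 hW), δ, hδ,
        fun z hz t ht => ?_⟩
      refine (hΦ t ht z (interior_subset hz)).congr_of_eventuallyEq ?_
      filter_upwards [(isOpen_Ioo.prod isOpen_interior).mem_nhds (x := (t, z)) ⟨ht, hz⟩] with p hp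
      exact heq p.1 hp.1 p.2 (interior_subset hp.2)
  obtain ⟨ε, hε, h⟩ := h
  -- Smoothness holds for `|t| < ε` by compactness, and the identity `φ^t = φ^{t/2} ∘ φ^{t/2}`
  -- doubles the time interval at each step.
  have hn (n : ℕ) : ∀ x : M, ∀ t : ℝ, |t| < 2 ^ n * ε →
      ContMDiffAt (𝓘(ℝ, ℝ).prod (𝓡 (2 * m + 1))) (𝓡 (2 * m + 1)) ∞
        (fun p : ℝ × M => flow X p.1 p.2) (t, x) := by
    induction n with
    | zero => exact fun x t ht => h x (mem_univ x) t (abs_lt.1 (by simpa using ht))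
    | succ n ih =>
      intro x t ht
      have ht2 : |t / 2| < 2 ^ n * ε := by
        rw [abs_div, abs_two, div_lt_iff₀ two_pos]
        calc |t| < 2 ^ (n + 1) * ε := ht
          _ = 2 ^ n * ε * 2 := by ring
      have hhalf : ContMDiffAt (𝓘(ℝ, ℝ).prod (𝓡 (2 * m + 1))) 𝓘(ℝ, ℝ) ∞
          (fun p : ℝ × M => p.1 / 2) (t, x) :=
        (contDiff_id.div_const 2).contDiffAt.contMDiffAt.comp (t, x) contMDiffAt_fst
      have h1 : ContMDiffAt (𝓘(ℝ, ℝ).prod (𝓡 (2 * m + 1))) (𝓡 (2 * m + 1)) ∞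
          (fun p : ℝ × M => flow X (p.1 / 2) p.2) (t, x) :=
        ContMDiffAt.comp (t, x) (g := fun p : ℝ × M => flow X p.1 p.2)
          (f := fun p : ℝ × M => (p.1 / 2, p.2)) (ih x (t / 2) ht2) (hhalf.prodMk contMDiffAt_snd)
      have h2 : ContMDiffAt (𝓘(ℝ, ℝ).prod (𝓡 (2 * m + 1))) (𝓡 (2 * m + 1)) ∞
          (fun p : ℝ × M => flow X (p.1 / 2) (flow X (p.1 / 2) p.2)) (t, x) :=
        ContMDiffAt.comp (t, x) (g := fun p : ℝ × M => flow X p.1 p.2)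
          (f := fun p : ℝ × M => (p.1 / 2, flow X (p.1 / 2) p.2)) (ih _ (t / 2) ht2)
          (hhalf.prodMk h1)
      refine h2.congr_of_eventuallyEq (Filter.Eventually.of_forall fun p => ?_)
      show flow X p.1 p.2 = flow X (p.1 / 2) (flow X (p.1 / 2) p.2)
      rw [← hX.flow_add, add_halves]
  rintro ⟨t, x⟩
  obtain ⟨n, hn'⟩ := pow_unbounded_of_one_lt (|t| / ε) (one_lt_two)
  exact hn n x t ((div_lt_iff₀ hε).1 hn')

lemma SmoothVField.contMDiff_flow_const {X : VField m M} (hX : SmoothVField X) (t : ℝ) :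
    ContMDiff (𝓡 (2 * m + 1)) (𝓡 (2 * m + 1)) ∞ (flow X t) :=
  hX.contMDiff_flow.comp (contMDiff_const.prodMk contMDiff_id)

/-- The flow at time `t`, as a diffeomorphism. -/
noncomputable def SmoothVField.flowDiffeo {X : VField m M} (hX : SmoothVField X) (t : ℝ) :
    M ≃ₘ⟮𝓡 (2 * m + 1), 𝓡 (2 * m + 1)⟯ M where
  toFun := flow X t
  invFun := flow X (-t)
  left_inv := hX.flow_neg_flow t
  right_inv := hX.flow_flow_neg t
  contMDiff_toFun := hX.contMDiff_flow_const t
  contMDiff_invFun := hX.contMDiff_flow_const (-t)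

end Flows

end ContactLF

namespace ContactLF

/-! ### Invariance of a contact form under its Reeb flow -/

section ReebFlow

open scoped Topology

/-- This is `L_X a = d(a(X)) + i_X da = 0` in coordinates: the first term vanishes because `a(X)` is
constant, the second by hypothesis. -/
lemma hasDerivAt_pullback_along_flow {E : Type*} [NormedAddCommGroup E] [NormedSpace ℝ E]
    {a : E → E →L[ℝ] ℝ} {T : ℝ × E → E} {X : E → E} {y₀ : E} (hT : ContDiffAt ℝ ∞ T (0, y₀))
    (ha : DifferentiableAt ℝ a y₀) (hT0 : ∀ᶠ y in 𝓝 y₀, T (0, y) = y)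
    (hTX : ∀ᶠ y in 𝓝 y₀, fderiv ℝ T (0, y) (1, 0) = X y) (haX : ∀ᶠ y in 𝓝 y₀, a y (X y) = 1)
    (hd : ∀ v, dLoc a y₀ (X y₀) v = 0) (v : E) :
    HasDerivAt (fun s => a (T (s, y₀)) (fderiv ℝ T (s, y₀) (0, v))) 0 0 := by
  have hTd : HasFDerivAt T (fderiv ℝ T (0, y₀)) (0, y₀) :=
    (hT.differentiableAt (by simp)).hasFDerivAt
  have hfd : ContDiffAt ℝ ∞ (fderiv ℝ T) (0, y₀) := hT.fderiv_right (by simp)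
  have hA := (hfd.differentiableAt (by simp)).hasFDerivAt
  set A := fderiv ℝ (fderiv ℝ T) (0, y₀) with hAdef
  have hsym : ∀ p q, A p q = A q p := hT.isSymmSndFDerivAt (n := ∞) (by
    rw [minSmoothness_of_isRCLikeNormedField]
    exact ENat.LEInfty.out)
  have hy₀ : T (0, y₀) = y₀ := hT0.self_of_nhds
  have hcurve : HasDerivAt (fun s : ℝ => (s, y₀)) ((1, 0) : ℝ × E) 0 :=
    (hasDerivAt_id 0).prodMk (hasDerivAt_const 0 y₀)
  have hslice : HasFDerivAt (fun y : E => ((0 : ℝ), y)) (ContinuousLinearMap.inr ℝ ℝ E) y₀ :=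
    hasFDerivAt_prodMk_right 0 y₀
  have h1 : HasDerivAt (fun s => fderiv ℝ T (s, y₀)) (A (1, 0)) 0 :=
    HasFDerivAt.comp_hasDerivAt (l := fderiv ℝ T) (f := fun s : ℝ => (s, y₀)) 0 hA hcurve
  have h1v : HasDerivAt (fun s => fderiv ℝ T (s, y₀) (0, v)) (A (1, 0) (0, v)) 0 := by
    simpa using h1.clm_apply (hasDerivAt_const (0 : ℝ) ((0, v) : ℝ × E))
  have h2 : HasDerivAt (fun s => T (s, y₀)) (X y₀) 0 := by
    have := HasFDerivAt.comp_hasDerivAt (l := T) (f := fun s : ℝ => (s, y₀)) 0 hTd hcurve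
    rwa [hTX.self_of_nhds] at this
  have h3 : HasDerivAt (fun s => a (T (s, y₀))) (fderiv ℝ a y₀ (X y₀)) 0 :=
    HasFDerivAt.comp_hasDerivAt (l := a) (f := fun s => T (s, y₀)) 0
      (by simpa only [hy₀] using ha.hasFDerivAt) h2
  have h4 : fderiv ℝ T (0, y₀) (0, v) = v := by
    have h := (HasFDerivAt.comp (g := T) (f := fun y : E => ((0 : ℝ), y)) y₀ hTd hslice)
    have h' := h.unique ((hasFDerivAt_id y₀).congr_of_eventuallyEq hT0)
    simpa using congrArg (fun L : E →L[ℝ] E => L v) h'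
  -- The spatial derivative of `X` is the mixed second derivative of the flow map at time `0`.
  have h5 : HasFDerivAt X ((A.comp (ContinuousLinearMap.inr ℝ ℝ E)).flip (1, 0)) y₀ := by
    have h := (HasFDerivAt.comp (g := fderiv ℝ T) (f := fun y : E => ((0 : ℝ), y)) y₀ hA
      hslice).clm_apply (hasFDerivAt_const ((1, 0) : ℝ × E) y₀)
    refine (h.congr_of_eventuallyEq (hTX.mono fun y hy => hy.symm)).congr_fderiv ?_
    ext w
    simp
  -- Differentiate `a(X) = 1` in the direction `v`.
  have h6 : fderiv ℝ a y₀ v (X y₀) + a y₀ (A (0, v) (1, 0)) = 0 := by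
    have h := (ha.hasFDerivAt.clm_apply h5).unique
      ((hasFDerivAt_const (1 : ℝ) y₀).congr_of_eventuallyEq haX)
    have h' := congrArg (fun L : E →L[ℝ] ℝ => L v) h
    simp at h'
    linarith
  have h7 := hd v
  rw [dLoc_apply] at h7
  refine (h3.clm_apply h1v).congr_deriv ?_
  rw [hy₀, h4, hsym]
  linarith

variable {m : ℕ} {M : Type*} [TopologicalSpace M] [ChartedSpace (Model m) M]
  [IsManifold (𝓡 (2 * m + 1)) ∞ M]

lemma formAt_eq_repForm (α : OneForm m M) (x : M) (v : Model m) :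
    formAt α x v = repForm α x (extChartAt (𝓡 (2 * m + 1)) x x) v := by
  have h := repForm_chart_apply α (mem_extChartAt_source (I := 𝓡 (2 * m + 1)) x) v
  rw [mfderiv_chart_self] at h
  exact h.symm

lemma repForm_reebField {α : OneForm m M} (hα : IsContactForm α) {c : M} {y : Model m}
    (hy : y ∈ (extChartAt (𝓡 (2 * m + 1)) c).target) :
    repForm α c y (repField (reebField α) c y) = 1 := by
  have h := repForm_chart_apply α ((extChartAt (𝓡 (2 * m + 1)) c).map_target hy)
    (reebField α ((extChartAt (𝓡 (2 * m + 1)) c).symm y))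
  rw [(extChartAt (𝓡 (2 * m + 1)) c).right_inv hy] at h
  exact h.trans (hα.isReebVector_reebField _).1

lemma repField_self (X : VField m M) (x : M) :
    repField X x (extChartAt (𝓡 (2 * m + 1)) x x) = X x := by
  have h : ∀ z, z = x → (mfderiv (𝓡 (2 * m + 1)) 𝓘(ℝ, Model m) (extChartAt (𝓡 (2 * m + 1)) x) z :
      Model m →L[ℝ] Model m) (X z) = X x := by
    rintro z rfl
    exact mfderiv_chart_self _ _
  exact h _ (extChartAt_to_inv x)

variable [CompactSpace M] [T2Space M]

/-- The flow of `X`, read in the chart at `c`. -/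
noncomputable def repFlow (X : VField m M) (c : M) (p : ℝ × Model m) : Model m :=
  repMap (flow X p.1) c c p.2

lemma SmoothVField.contDiffAt_repFlow {X : VField m M} (hX : SmoothVField X) {c : M} {y : Model m}
    (hy : y ∈ (extChartAt (𝓡 (2 * m + 1)) c).target) :
    ContDiffAt ℝ ∞ (repFlow X c) (0, y) := by
  have h1 : ContMDiffAt (𝓘(ℝ, ℝ).prod 𝓘(ℝ, Model m)) (𝓘(ℝ, ℝ).prod (𝓡 (2 * m + 1))) ∞
      (fun p : ℝ × Model m => (p.1, (extChartAt (𝓡 (2 * m + 1)) c).symm p.2)) (0, y) :=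
    contMDiffAt_fst.prodMk ((contMDiffAt_symm_chart hy).comp (0, y) contMDiffAt_snd)
  have h2 := (hX.contMDiff_flow (0, (extChartAt (𝓡 (2 * m + 1)) c).symm y)).comp (0, y) h1
  have hsrc : flow X 0 ((extChartAt (𝓡 (2 * m + 1)) c).symm y) ∈
      (extChartAt (𝓡 (2 * m + 1)) c).source := by
    rw [hX.flow_zero]
    exact (extChartAt (𝓡 (2 * m + 1)) c).map_target hy
  have h3 : ContMDiffAt (𝓘(ℝ, ℝ).prod 𝓘(ℝ, Model m)) 𝓘(ℝ, Model m) ∞ (repFlow X c) (0, y) :=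
    ContMDiffAt.comp (0, y) (g := extChartAt (𝓡 (2 * m + 1)) c) (contMDiffAt_chart hsrc) h2
  rw [← contMDiffAt_iff_contDiffAt, modelWithCornersSelf_prod, ← chartedSpaceSelf_prod]
  exact h3

lemma SmoothVField.repFlow_zero {X : VField m M} (hX : SmoothVField X) {c : M} {y : Model m}
    (hy : y ∈ (extChartAt (𝓡 (2 * m + 1)) c).target) : repFlow X c (0, y) = y := by
  show extChartAt (𝓡 (2 * m + 1)) c (flow X 0 ((extChartAt (𝓡 (2 * m + 1)) c).symm y)) = y
  rw [hX.flow_zero, (extChartAt (𝓡 (2 * m + 1)) c).right_inv hy]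

lemma SmoothVField.fderiv_repFlow {X : VField m M} (hX : SmoothVField X) {c : M} {y : Model m}
    (hy : y ∈ (extChartAt (𝓡 (2 * m + 1)) c).target) :
    fderiv ℝ (repFlow X c) (0, y) (1, 0) = repField X c y := by
  set x := (extChartAt (𝓡 (2 * m + 1)) c).symm y with hx
  have hsrc := (extChartAt (𝓡 (2 * m + 1)) c).map_target hy
  have h1 : HasMFDerivAt 𝓘(ℝ, ℝ) (𝓡 (2 * m + 1)) (fun t => flow X t x) 0
      ((1 : ℝ →L[ℝ] ℝ).smulRight (X (flow X 0 x))) := hX.isMIntegralCurve_flow x 0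
  have h0 : flow X 0 x = x := hX.flow_zero x
  have h2 : HasMFDerivAt 𝓘(ℝ, ℝ) 𝓘(ℝ, Model m) (fun t => repFlow X c (t, y)) 0 _ :=
    (mdifferentiableAt_chart (c := c) (x := flow X 0 x)
      (by rw [h0]; exact hsrc)).hasMFDerivAt.comp (0 : ℝ) h1
  have h3 := h2.hasFDerivAt
  have h4 : HasFDerivAt (fun t : ℝ => repFlow X c (t, y)) _ 0 :=
    HasFDerivAt.comp (g := repFlow X c) (f := fun t : ℝ => (t, y)) 0
      ((hX.contDiffAt_repFlow hy).differentiableAt (by simp)).hasFDerivAt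
      (hasFDerivAt_prodMk_left 0 y)
  have h5 := congrArg (fun L : ℝ →L[ℝ] Model m => L 1) (h4.unique h3)
  have h6 : ∀ z, z = x → (mfderiv (𝓡 (2 * m + 1)) 𝓘(ℝ, Model m) (extChartAt (𝓡 (2 * m + 1)) c) z :
      Model m →L[ℝ] Model m) ((1 : ℝ) • (X z : Model m)) = repField X c y := by
    rintro z rfl
    rw [one_smul]
    rfl
  exact h5.trans (h6 _ h0)

/-- Near time `0` the orbit of `x` stays in the chart at `x`, so the local computation applies. -/
lemma IsContactForm.hasDerivAt_zero_pullForm_flow {α : OneForm m M} (hα : IsContactForm α) (x : M)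
    (v : Model m) :
    HasDerivAt (fun s => formAt (ContactLF.pullForm (flow (reebField α) s) α) x v) 0 0 := by
  have hX := hα.smoothVField_reebField
  have hy := mem_extChartAt_target (I := 𝓡 (2 * m + 1)) x
  set y := extChartAt (𝓡 (2 * m + 1)) x x with hydef
  have hT := hX.contDiffAt_repFlow hy
  have hev := (isOpen_target x).mem_nhds hy
  have hsrc := mem_extChartAt_source (I := 𝓡 (2 * m + 1)) x
  have hinv : (extChartAt (𝓡 (2 * m + 1)) x).symm y = x := extChartAt_to_inv x
  have key := hasDerivAt_pullback_along_flow (a := repForm α x) (X := repField (reebField α) x) hT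
    ((hα.1.contDiffAt_repForm hy).differentiableAt (by simp))
    (Filter.mem_of_superset hev fun z hz => hX.repFlow_zero hz)
    (Filter.mem_of_superset hev fun z hz => hX.fderiv_repFlow hz)
    (Filter.mem_of_superset hev fun z hz => repForm_reebField hα hz)
    (fun w => by
      have h := (hα.isReebVector_reebField x).2 w
      rw [repField_self]
      exact h) v
  refine key.congr_of_eventuallyEq ?_
  have hsm : ∀ᶠ s : ℝ in 𝓝 0, DifferentiableAt ℝ (repFlow (reebField α) x) (s, y) := by
    have h1 : ∀ᶠ p in 𝓝 ((0 : ℝ), y), ContDiffAt ℝ 1 (repFlow (reebField α) x) p :=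
      (hT.of_le (by simp)).eventually (by simp)
    have hc : ContinuousAt (fun s : ℝ => (s, y)) 0 := by fun_prop
    exact (hc.eventually h1).mono fun s hs => hs.differentiableAt (by simp)
  have hcs : ∀ᶠ s : ℝ in 𝓝 0, flow (reebField α) s x ∈ (extChartAt (𝓡 (2 * m + 1)) x).source := by
    have hc : ContinuousAt (fun s => flow (reebField α) s x) 0 :=
      (hX.isMIntegralCurve_flow x).continuous.continuousAt
    refine hc.eventually ((isOpen_extChartAt_source x).mem_nhds ?_)
    show flow (reebField α) 0 x ∈ _
    rw [hX.flow_zero]; exact hsrc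
  filter_upwards [hsm, hcs] with s hs hs'
  have hd : flow (reebField α) s ((extChartAt (𝓡 (2 * m + 1)) x).symm y) ∈
      (extChartAt (𝓡 (2 * m + 1)) x).source := by rwa [hinv]
  rw [formAt_eq_repForm, repForm_pullForm α hy
    ((hX.contMDiff_flow_const s).mdifferentiableAt (by simp)) hd, ContinuousLinearMap.comp_apply]
  have hc : HasFDerivAt (repMap (flow (reebField α) s) x x) _ y :=
    HasFDerivAt.comp (g := repFlow (reebField α) x) (f := fun z => (s, z)) y hs.hasFDerivAt
      (hasFDerivAt_prodMk_right s y)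
  rw [hc.fderiv]
  rfl

/-- The Reeb flow preserves the contact form. -/
lemma IsContactForm.pullForm_flow {α : OneForm m M} (hα : IsContactForm α) (t : ℝ) :
    ContactLF.pullForm (flow (reebField α) t) α = α := by
  have hX := hα.smoothVField_reebField
  funext x
  refine ContinuousLinearMap.ext fun v => ?_
  let u : ℝ → ℝ := fun s => formAt (ContactLF.pullForm (flow (reebField α) s) α) x v
  have hu : ∀ s, HasDerivAt u 0 s := by
    intro s
    have h := hα.hasDerivAt_zero_pullForm_flow (flow (reebField α) s x)
      (der (flow (reebField α) s) x v)
    -- The group law moves the derivative at time `s` to the derivative at time `0` at the point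
    -- `flow (reebField α) s x`.
    have heq : u = fun r => formAt (ContactLF.pullForm (flow (reebField α) (r - s)) α)
        (flow (reebField α) s x) (der (flow (reebField α) s) x v) := by
      funext r
      have hcomp : flow (reebField α) r = flow (reebField α) (r - s) ∘ flow (reebField α) s := by
        funext z
        rw [Function.comp_apply, ← hX.flow_add, sub_add_cancel]
      have hder : der (flow (reebField α) r) x v =
          der (flow (reebField α) (r - s)) (flow (reebField α) s x)
            (der (flow (reebField α) s) x v) := by
        rw [hcomp, der, mfderiv_comp x ((hX.contMDiff_flow_const _).mdifferentiableAt (by simp))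
          ((hX.contMDiff_flow_const _).mdifferentiableAt (by simp))]
        rfl
      show formAt α (flow (reebField α) r x) (der (flow (reebField α) r) x v) =
        formAt α (flow (reebField α) (r - s) (flow (reebField α) s x)) _
      rw [hder, ← hX.flow_add, sub_add_cancel]
      rfl
    rw [heq]
    have h0 : HasDerivAt (fun r : ℝ => r - s) 1 s := (hasDerivAt_id s).sub_const s
    exact (HasDerivAt.scomp_of_eq s h h0 (sub_self s).symm).congr_deriv (smul_zero (1 : ℝ))
  have hconst : u t = u 0 :=
    is_const_of_deriv_eq_zero (fun s => (hu s).differentiableAt) (fun s => (hu s).deriv) t 0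
  refine Eq.trans hconst ?_
  have hid : flow (reebField α) 0 = id := funext fun z => hX.flow_zero z
  show formAt (ContactLF.pullForm (flow (reebField α) 0) α) x v = _
  rw [hid, pullForm_id]
  rfl

end ReebFlow

end ContactLF

namespace ContactLF

/-! ### The volume density of a contact form in charts -/

section Densities

open scoped Topology

lemma continuous_indicator_of_isClosed {X F : Type*} [TopologicalSpace X] [TopologicalSpace F]
    [Zero F] {f : X → F} {W C : Set X} (hW : IsOpen W) (hC : IsClosed C) (hCW : C ⊆ W)
    (hf : ContinuousOn f W) (h0 : ∀ x ∈ W, x ∉ C → f x = 0) : Continuous (W.indicator f) := by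
  rw [continuous_iff_continuousAt]
  intro x
  by_cases hx : x ∈ C
  · refine (hf.continuousAt (hW.mem_nhds (hCW hx))).congr ?_
    filter_upwards [hW.mem_nhds (hCW hx)] with z hz
    rw [indicator_of_mem hz]
  · refine (continuousAt_const (y := (0 : F))).congr ?_
    filter_upwards [hC.isOpen_compl.mem_nhds hx] with z hz
    by_cases hzW : z ∈ W
    · rw [indicator_of_mem hzW, h0 z hzW hz]
    · rw [indicator_of_notMem hzW]

/-- Every point has a neighbourhood contained in `W`, where nothing changes, or disjoint from `C`,
where the extension vanishes. It is used to extend functions cut off in a chart by zero. -/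
lemma contDiff_indicator_of_isClosed {X F : Type*} [NormedAddCommGroup X] [NormedSpace ℝ X]
    [NormedAddCommGroup F] [NormedSpace ℝ F] {n : ℕ∞ω}
    {f : X → F} {W C : Set X} (hW : IsOpen W) (hC : IsClosed C) (hCW : C ⊆ W)
    (hf : ContDiffOn ℝ n f W) (h0 : ∀ x ∈ W, x ∉ C → f x = 0) :
    ContDiff ℝ n (W.indicator f) := by
  rw [contDiff_iff_contDiffAt]
  intro x
  by_cases hx : x ∈ C
  · refine (hf.contDiffAt (hW.mem_nhds (hCW hx))).congr_of_eventuallyEq ?_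
    filter_upwards [hW.mem_nhds (hCW hx)] with z hz
    rw [indicator_of_mem hz]
  · refine (contDiffAt_const (c := (0 : F))).congr_of_eventuallyEq ?_
    filter_upwards [hC.isOpen_compl.mem_nhds hx] with z hz
    by_cases hzW : z ∈ W
    · rw [indicator_of_mem hzW, h0 z hzW hz]
    · rw [indicator_of_notMem hzW]

variable {m : ℕ} {M : Type*} [TopologicalSpace M] [ChartedSpace (Model m) M]

/-- The standard frame of the model space. -/
noncomputable def stdFrame (m : ℕ) (i : Fin (2 * m + 1)) : Model m :=
  EuclideanSpace.basisFun (Fin (2 * m + 1)) ℝ i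

/-- The form `α ∧ (dα)^m` in the chart at `c`. -/
noncomputable def topLoc (α : OneForm m M) (c : M) (y : Model m) :
    Model m [⋀^Fin (2 * m + 1)]→ₗ[ℝ] ℝ :=
  wedgeAlt m (repForm α c y).toLinearMap (bilinToLinear (dLoc (repForm α c) y))

lemma topLoc_apply (α : OneForm m M) (c : M) (y : Model m) (v : Fin (2 * m + 1) → Model m) :
    topLoc α c y v = wedgeTop m (fun u => repForm α c y u) (fun u w => dLoc (repForm α c) y u w) v :=
  wedgeAlt_apply _ _ _

lemma chartDensity_nonneg (α : OneForm m M) (c : M) (y : Model m) : 0 ≤ chartDensity α c y :=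
  abs_nonneg _

variable [IsManifold (𝓡 (2 * m + 1)) ∞ M]

lemma topForm_symm_chart {α : OneForm m M} (hα : SmoothOneForm α) {c : M} {y : Model m}
    (hy : y ∈ (extChartAt (𝓡 (2 * m + 1)) c).target) (v : Fin (2 * m + 1) → Model m) :
    topForm α ((extChartAt (𝓡 (2 * m + 1)) c).symm y) (fun j =>
      (mfderiv 𝓘(ℝ, Model m) (𝓡 (2 * m + 1)) (extChartAt (𝓡 (2 * m + 1)) c).symm y :
        Model m →L[ℝ] Model m) (v j)) = topLoc α c y v := by
  refine (topForm_eq hα _ _).trans ?_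
  set x := (extChartAt (𝓡 (2 * m + 1)) c).symm y with hx
  set D : Model m →L[ℝ] Model m := mfderiv 𝓘(ℝ, Model m) (𝓡 (2 * m + 1))
    (extChartAt (𝓡 (2 * m + 1)) c).symm y with hD
  refine (wedgeTop_comp D (formAt α x) (fun u w => bilinToLinear (dBilin α x) u w) v).symm.trans ?_
  have h : (fun u w : Model m => bilinToLinear (dBilin α x) (D u) (D w)) =
      fun u w => dLoc (repForm α c) y u w := by
    funext u w
    have h1 := dBilin_eq_chart hα ((extChartAt (𝓡 (2 * m + 1)) c).map_target hy) (D u) (D w)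
    rw [(extChartAt (𝓡 (2 * m + 1)) c).right_inv hy] at h1
    refine Eq.trans h1 ?_
    exact congrArg₂ (fun p q => dLoc (repForm α c) y p q) (mfderiv_chart_comp_symm hy u)
      (mfderiv_chart_comp_symm hy w)
  rw [topLoc_apply]
  exact congrArg (fun b => wedgeTop m (fun u => formAt α x (D u)) b v) h

lemma chartDensity_eq {α : OneForm m M} (hα : SmoothOneForm α) {c : M} {y : Model m}
    (hy : y ∈ (extChartAt (𝓡 (2 * m + 1)) c).target) :
    chartDensity α c y = |topLoc α c y (stdFrame m)| :=
  congrArg abs (topForm_symm_chart hα hy (stdFrame m))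

lemma continuousOn_topLoc {α : OneForm m M} (hα : SmoothOneForm α) (c : M) :
    ContinuousOn (fun y => topLoc α c y (stdFrame m)) (extChartAt (𝓡 (2 * m + 1)) c).target := by
  intro y hy
  have ha := hα.contDiffAt_repForm hy
  have h1 : ContinuousAt (repForm α c) y := ha.continuousAt
  have h2 : ContinuousAt (dLoc (repForm α c)) y := ha.dLoc.continuousAt
  refine ContinuousAt.continuousWithinAt ?_
  simp only [topLoc_apply]
  refine continuousAt_const.mul (tendsto_finsetSum _ fun σ _ => ?_)
  refine continuousAt_const.mul (ContinuousAt.mul (h1.clm_apply continuousAt_const) ?_)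
  exact tendsto_finsetProd _ fun j _ => (h2.clm_apply continuousAt_const).clm_apply
    continuousAt_const

lemma continuousOn_chartDensity {α : OneForm m M} (hα : SmoothOneForm α) (c : M) :
    ContinuousOn (chartDensity α c) (extChartAt (𝓡 (2 * m + 1)) c).target :=
  (continuousOn_topLoc hα c).abs.congr fun _ hy => chartDensity_eq hα hy

/-- A top-degree alternating form vanishing on the standard frame vanishes identically, which the
contact condition excludes. -/
lemma IsContactForm.chartDensity_pos {α : OneForm m M} (hα : IsContactForm α) {c : M}
    {y : Model m} (hy : y ∈ (extChartAt (𝓡 (2 * m + 1)) c).target) : 0 < chartDensity α c y := by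
  refine (chartDensity_nonneg α c y).lt_of_ne' fun h0 => ?_
  obtain ⟨v, hv⟩ := hα.2 ((extChartAt (𝓡 (2 * m + 1)) c).symm y)
  rw [chartDensity_eq hα.1 hy, abs_eq_zero] at h0
  have hsrc := (extChartAt (𝓡 (2 * m + 1)) c).map_target hy
  let w : Fin (2 * m + 1) → Model m := fun i =>
    (mfderiv (𝓡 (2 * m + 1)) 𝓘(ℝ, Model m) (extChartAt (𝓡 (2 * m + 1)) c)
      ((extChartAt (𝓡 (2 * m + 1)) c).symm y) : Model m →L[ℝ] Model m) (v i)
  let e := (EuclideanSpace.basisFun (Fin (2 * m + 1)) ℝ).toBasis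
  have hw : (fun i => e.constr ℝ w (stdFrame m i)) = w := by
    funext i
    have : stdFrame m i = e i := by simp [e, stdFrame]
    rw [this, e.constr_basis]
  have h1 : topLoc α c y w = 0 := by
    rw [← hw, alternating_map_comp (finrank_model m), h0, mul_zero]
  refine hv (Eq.trans ?_ ((topForm_symm_chart hα.1 hy w).trans h1))
  exact congrArg (topForm α _) (funext fun i => (mfderiv_symm_comp_chart hy (v i)).symm)

lemma chartDensity_smulForm {α : OneForm m M} (hα : SmoothOneForm α) {k : M → ℝ}
    (hk : ContMDiff (𝓡 (2 * m + 1)) 𝓘(ℝ, ℝ) ∞ k) (c : M) (y : Model m) :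
    chartDensity (smulForm k α) c y =
      |k ((extChartAt (𝓡 (2 * m + 1)) c).symm y)| ^ (m + 1) * chartDensity α c y := by
  refine (congrArg abs (topForm_smulForm hα hk _ _)).trans ?_
  rw [abs_mul, abs_pow]
  rfl

/-- Naturality of `d` shows that the local top form is pulled back by the derivative of the chart
expression of `g`, which scales it by the determinant. This is the factor in the change of variables
formula. -/
lemma chartDensity_pullForm {α : OneForm m M} (hα : SmoothOneForm α) {g : M → M}
    (hg : ContMDiff (𝓡 (2 * m + 1)) (𝓡 (2 * m + 1)) ∞ g) {c d : M} {y : Model m}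
    (hy : y ∈ (extChartAt (𝓡 (2 * m + 1)) c).target)
    (hd : g ((extChartAt (𝓡 (2 * m + 1)) c).symm y) ∈ (extChartAt (𝓡 (2 * m + 1)) d).source) :
    chartDensity (pullForm g α) c y =
      |(fderiv ℝ (repMap g c d) y).det| * chartDensity α d (repMap g c d y) := by
  have h0 : chartDensity α d (repMap g c d y) = |topLoc α d (repMap g c d y) (stdFrame m)| :=
    chartDensity_eq hα ((extChartAt (𝓡 (2 * m + 1)) d).map_source hd)
  rw [chartDensity_eq (hα.pullForm hg) hy, h0, ← abs_mul]
  set L := fderiv ℝ (repMap g c d) y with hL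
  have h := alternating_map_comp (finrank_model m) (topLoc α d (repMap g c d y)) L.toLinearMap
    (stdFrame m)
  refine congrArg abs (Eq.trans ?_ h)
  rw [topLoc_apply, topLoc_apply, repForm_pullForm α hy (hg.mdifferentiableAt (by simp)) hd]
  have hb : (fun u w : Model m => dLoc (repForm (pullForm g α) c) y u w) =
      fun u w => dLoc (repForm α d) (repMap g c d y) (L u) (L w) := by
    funext u w; exact dLoc_repForm_pullForm hα hg hy hd u w
  rw [hb]
  rfl

end Densities

end ContactLF

namespace ContactLF

/-! ### Integration against the volume density -/

section VolumeIntegral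

open scoped Topology

/-- The integral is the value at `0` of the convolution of `f` with `z ↦ A (s, -z)`, and
convolutions with a smooth, uniformly compactly supported parametric kernel are smooth. -/
lemma contDiff_integral_mul {E : Type*} [NormedAddCommGroup E] [NormedSpace ℝ E]
    [FiniteDimensional ℝ E] [MeasurableSpace E] [BorelSpace E] {μ : Measure E} [SFinite μ]
    [μ.IsAddHaarMeasure] {f : E → ℝ} {K : Set E} {A : ℝ × E → ℝ} (hf : LocallyIntegrable f μ)
    (hK : IsCompact K) (hA : ContDiff ℝ ∞ A) (h0 : ∀ s, ∀ y ∉ K, A (s, y) = 0) :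
    ContDiff ℝ ∞ (fun s => ∫ y, f y * A (s, y) ∂μ) := by
  have hg : ContDiff ℝ ∞ (fun p : ℝ × E => A (p.1, -p.2)) :=
    hA.comp (contDiff_fst.prodMk contDiff_snd.neg)
  have hconv := contDiffOn_convolution_right_with_param (μ := μ) (n := ⊤)
    (ContinuousLinearMap.mul ℝ ℝ) (f := f) (g := fun s z => A (s, -z)) (s := univ) (k := -K)
    isOpen_univ hK.neg (fun s z _ hz => h0 s _ fun h => hz h) hf hg.contDiffOn
  rw [univ_prod_univ, contDiffOn_univ] at hconv
  have h := hconv.comp (contDiff_id.prodMk (contDiff_const (c := (0 : E))))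
  convert! h using 1
  funext s
  rw [Function.comp_apply, convolution_def]
  simp

variable {m : ℕ} {M : Type*} [TopologicalSpace M] [ChartedSpace (Model m) M]

/-- The integral of the function `k` with respect to the density of `α`, in the chart at `c`. -/
noncomputable def chartIntegral (α : OneForm m M) (c : M) (k : M → ℝ) : ℝ :=
  ∫ y in (extChartAt (𝓡 (2 * m + 1)) c).target,
    k ((extChartAt (𝓡 (2 * m + 1)) c).symm y) * chartDensity α c y

/-- The image in the chart at `c` of the support of `k`. -/
def chartSupport (c : M) (k : M → ℝ) : Set (Model m) :=
  extChartAt (𝓡 (2 * m + 1)) c '' tsupport k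

lemma chartSupport_subset {c : M} {k : M → ℝ}
    (hs : tsupport k ⊆ (extChartAt (𝓡 (2 * m + 1)) c).source) :
    chartSupport c k ⊆ (extChartAt (𝓡 (2 * m + 1)) c).target := by
  rintro _ ⟨x, hx, rfl⟩
  exact (extChartAt (𝓡 (2 * m + 1)) c).map_source (hs hx)

lemma isCompact_chartSupport [CompactSpace M] {c : M} {k : M → ℝ}
    (hs : tsupport k ⊆ (extChartAt (𝓡 (2 * m + 1)) c).source) :
    IsCompact (chartSupport (m := m) c k) :=
  (isClosed_tsupport k).isCompact.image_of_continuousOn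
    ((continuousOn_extChartAt (I := 𝓡 (2 * m + 1)) c).mono hs)

lemma eq_zero_of_notMem_chartSupport {c : M} {k : M → ℝ} {y : Model m}
    (hy : y ∈ (extChartAt (𝓡 (2 * m + 1)) c).target) (h : y ∉ chartSupport c k) :
    k ((extChartAt (𝓡 (2 * m + 1)) c).symm y) = 0 := by
  by_contra h0
  exact h ⟨_, subset_tsupport k h0, (extChartAt (𝓡 (2 * m + 1)) c).right_inv hy⟩

/-- The density of `k` times the volume form of `α` in the chart at `c`, extended by zero. -/
noncomputable def chartFun (α : OneForm m M) (c : M) (k : M → ℝ) : Model m → ℝ :=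
  (extChartAt (𝓡 (2 * m + 1)) c).target.indicator
    fun y => k ((extChartAt (𝓡 (2 * m + 1)) c).symm y) * chartDensity α c y

lemma chartIntegral_eq (α : OneForm m M) (c : M) (k : M → ℝ) :
    chartIntegral α c k = ∫ y, chartFun α c k y :=
  (integral_indicator (isOpen_target c).measurableSet).symm

lemma chartFun_chart (α : OneForm m M) {c x : M} (k : M → ℝ)
    (hx : x ∈ (extChartAt (𝓡 (2 * m + 1)) c).source) :
    chartFun α c k (extChartAt (𝓡 (2 * m + 1)) c x) =
      k x * chartDensity α c (extChartAt (𝓡 (2 * m + 1)) c x) := by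
  rw [chartFun, indicator_of_mem ((extChartAt (𝓡 (2 * m + 1)) c).map_source hx),
    (extChartAt (𝓡 (2 * m + 1)) c).left_inv hx]

lemma chartFun_nonneg (α : OneForm m M) (c : M) {k : M → ℝ} (hk : ∀ x, 0 ≤ k x) :
    0 ≤ chartFun α c k :=
  indicator_nonneg fun _ _ => mul_nonneg (hk _) (chartDensity_nonneg α c _)

lemma hasCompactSupport_chartFun [CompactSpace M] (α : OneForm m M) {c : M} {k : M → ℝ}
    (hs : tsupport k ⊆ (extChartAt (𝓡 (2 * m + 1)) c).source) :
    HasCompactSupport (chartFun α c k) := by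
  refine HasCompactSupport.intro (isCompact_chartSupport hs) fun y hy => ?_
  by_cases h : y ∈ (extChartAt (𝓡 (2 * m + 1)) c).target
  · rw [chartFun, indicator_of_mem h, eq_zero_of_notMem_chartSupport h hy, zero_mul]
  · rw [chartFun, indicator_of_notMem h]

variable [IsManifold (𝓡 (2 * m + 1)) ∞ M]

lemma chartIntegral_smulForm {α : OneForm m M} (hα : SmoothOneForm α) {u : M → ℝ}
    (hu : ContMDiff (𝓡 (2 * m + 1)) 𝓘(ℝ, ℝ) ∞ u) (c : M) (k : M → ℝ) :
    chartIntegral (smulForm u α) c k = chartIntegral α c (fun x => k x * |u x| ^ (m + 1)) := by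
  simp only [chartIntegral, chartDensity_smulForm hα hu, mul_assoc]

/-- The support conditions let both integrals be restricted, without change, to the domain `U` of
the chart expression of `g` and to its image; there the change of variables formula applies. -/
lemma chartIntegral_pullForm {α : OneForm m M} (hα : SmoothOneForm α)
    (g : M ≃ₘ⟮𝓡 (2 * m + 1), 𝓡 (2 * m + 1)⟯ M) {c d : M} {k : M → ℝ}
    (hk : ∀ x, k x ≠ 0 → g x ∈ (extChartAt (𝓡 (2 * m + 1)) d).source)
    (hk' : ∀ x, k x ≠ 0 → x ∈ (extChartAt (𝓡 (2 * m + 1)) c).source) :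
    chartIntegral (pullForm g α) c k = chartIntegral α d (k ∘ g.symm) := by
  set e := extChartAt (𝓡 (2 * m + 1)) c with he
  set e' := extChartAt (𝓡 (2 * m + 1)) d with he'
  set T := repMap (m := m) g c d with hT
  let U : Set (Model m) := e.target ∩ (fun y => g (e.symm y)) ⁻¹' e'.source
  have hU : IsOpen U :=
    ContinuousOn.isOpen_inter_preimage
      (g.continuous.comp_continuousOn (continuousOn_extChartAt_symm c))
      (isOpen_target c) (isOpen_extChartAt_source d)
  have hTU (y : Model m) (hy : y ∈ U) : e'.symm (T y) = g (e.symm y) := e'.left_inv hy.2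
  have hinj : InjOn T U := by
    intro y hy z hz hyz
    have h1 : g (e.symm y) = g (e.symm z) := by rw [← hTU y hy, ← hTU z hz, hyz]
    exact e.symm.injOn hy.1 hz.1 (g.injective h1)
  have hsub : T '' U ⊆ e'.target := by
    rintro _ ⟨y, hy, rfl⟩
    exact e'.map_source hy.2
  have h1 : chartIntegral (pullForm g α) c k =
      ∫ y in U, k (e.symm y) * chartDensity (pullForm g α) c y := by
    refine (setIntegral_eq_of_subset_of_forall_sdiff_eq_zero (isOpen_target c).measurableSet
      inter_subset_left fun y hy => ?_)
    have : k (e.symm y) = 0 := by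
      by_contra h0
      exact hy.2 ⟨hy.1, hk _ h0⟩
    rw [this, zero_mul]
  have h2 : chartIntegral α d (k ∘ g.symm) =
      ∫ z in T '' U, k (g.symm (e'.symm z)) * chartDensity α d z := by
    refine (setIntegral_eq_of_subset_of_forall_sdiff_eq_zero (isOpen_target d).measurableSet
      hsub fun z hz => ?_)
    have : k (g.symm (e'.symm z)) = 0 := by
      by_contra h0
      refine hz.2 ⟨e (g.symm (e'.symm z)), ⟨e.map_source (hk' _ h0), ?_⟩, ?_⟩
      · show g (e.symm (e (g.symm (e'.symm z)))) ∈ e'.source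
        rw [e.left_inv (hk' _ h0), g.apply_symm_apply]
        exact e'.map_target hz.1
      · show e' (g (e.symm (e (g.symm (e'.symm z))))) = z
        rw [e.left_inv (hk' _ h0), g.apply_symm_apply, e'.right_inv hz.1]
    show k (g.symm (e'.symm z)) * _ = 0
    rw [this, zero_mul]
  have hder : ∀ y ∈ U, HasFDerivWithinAt T (fderiv ℝ T y) U y := fun y hy =>
    ((contDiffAt_repMap hy.1 g.contMDiff.contMDiffAt hy.2).differentiableAt
      (by simp)).hasFDerivAt.hasFDerivWithinAt
  rw [h1, h2, integral_image_eq_integral_abs_det_fderiv_smul volume hU.measurableSet hder hinj]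
  refine setIntegral_congr_fun hU.measurableSet fun y hy => ?_
  show _ = |(fderiv ℝ T y).det| * (k (g.symm (e'.symm (T y))) * chartDensity α d (T y))
  rw [hTU y hy, g.symm_apply_apply]
  show k (e.symm y) * chartDensity (pullForm g α) c y = _
  rw [chartDensity_pullForm hα g.contMDiff hy.1 hy.2]
  ring

variable [CompactSpace M]

lemma continuous_chartFun {α : OneForm m M} (hα : SmoothOneForm α) {c : M} {k : M → ℝ}
    (hs : tsupport k ⊆ (extChartAt (𝓡 (2 * m + 1)) c).source) (hk : Continuous k) :
    Continuous (chartFun α c k) :=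
  continuous_indicator_of_isClosed (isOpen_target c) (isCompact_chartSupport hs).isClosed
    (chartSupport_subset hs)
    ((hk.comp_continuousOn (continuousOn_extChartAt_symm c)).mul (continuousOn_chartDensity hα c))
    fun y hy hy' => by rw [eq_zero_of_notMem_chartSupport hy hy', zero_mul]

lemma integrableOn_chart {α : OneForm m M} (hα : SmoothOneForm α) {c : M} {k : M → ℝ}
    (hs : tsupport k ⊆ (extChartAt (𝓡 (2 * m + 1)) c).source) (hk : Continuous k) : IntegrableOn
    (fun y => k ((extChartAt (𝓡 (2 * m + 1)) c).symm y) * chartDensity α c y)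
    (extChartAt (𝓡 (2 * m + 1)) c).target := by
  rw [← integrable_indicator_iff (isOpen_target c).measurableSet]
  exact (continuous_chartFun hα hs hk).integrable_of_hasCompactSupport
    (hasCompactSupport_chartFun α hs)

lemma chartIntegral_sum {α : OneForm m M} (hα : SmoothOneForm α) {c : M} {ι : Type*}
    (s : Finset ι) {k : ι → M → ℝ}
    (hs : ∀ i, tsupport (k i) ⊆ (extChartAt (𝓡 (2 * m + 1)) c).source)
    (hk : ∀ i, Continuous (k i)) :
    chartIntegral α c (fun x => ∑ i ∈ s, k i x) = ∑ i ∈ s, chartIntegral α c (k i) := by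
  simp only [chartIntegral, Finset.sum_mul]
  exact integral_finsetSum s fun i _ => integrableOn_chart hα (hs i) (hk i)

lemma chartIntegral_add {α : OneForm m M} (hα : SmoothOneForm α) {c : M} {k l : M → ℝ}
    (hs : tsupport k ⊆ (extChartAt (𝓡 (2 * m + 1)) c).source) (hk : Continuous k)
    (hs' : tsupport l ⊆ (extChartAt (𝓡 (2 * m + 1)) c).source) (hl : Continuous l) :
    chartIntegral α c (fun x => k x + l x) = chartIntegral α c k + chartIntegral α c l := by
  simp only [chartIntegral, add_mul]
  exact integral_add (integrableOn_chart hα hs hk) (integrableOn_chart hα hs' hl)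

variable [T2Space M]

lemma finite_chartPartition (m : ℕ) (M : Type*) [TopologicalSpace M] [ChartedSpace (Model m) M]
    [IsManifold (𝓡 (2 * m + 1)) ∞ M] [CompactSpace M] [T2Space M] :
    {c : M | (Function.support (chartPartition (m := m) M c)).Nonempty}.Finite :=
  (chartPartition (m := m) M).locallyFinite.finite_nonempty_of_compact

/-- The centers of the charts used by the partition of unity. -/
noncomputable def chartCenters (m : ℕ) (M : Type*) [TopologicalSpace M] [ChartedSpace (Model m) M]
    [IsManifold (𝓡 (2 * m + 1)) ∞ M] [CompactSpace M] [T2Space M] : Finset M :=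
  (finite_chartPartition m M).toFinset

lemma chartPartition_eq_zero {c : M} (hc : c ∉ chartCenters m M) (x : M) :
    chartPartition (m := m) M c x = 0 := by
  by_contra h
  exact hc ((finite_chartPartition m M).mem_toFinset.2 ⟨x, h⟩)

lemma sum_chartPartition (x : M) :
    ∑ c ∈ chartCenters m M, chartPartition (m := m) M c x = 1 := by
  rw [← (chartPartition (m := m) M).sum_eq_one (mem_univ x)]
  refine (finsum_eq_sum_of_support_subset _ fun c hc => ?_).symm
  by_contra h
  exact hc (chartPartition_eq_zero h x)

lemma tsupport_chartPartition_subset (c : M) :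
    tsupport (chartPartition (m := m) M c) ⊆ (extChartAt (𝓡 (2 * m + 1)) c).source := by
  rw [extChartAt_source]
  exact chartPartition_isSubordinate M c

lemma tsupport_chartPartition_mul_subset (c : M) (k : M → ℝ) :
    tsupport (fun x => chartPartition (m := m) M c x * k x) ⊆
      (extChartAt (𝓡 (2 * m + 1)) c).source :=
  (tsupport_mul_subset_left).trans (tsupport_chartPartition_subset c)

lemma tsupport_mul_chartPartition_subset (c : M) (k : M → ℝ) :
    tsupport (fun x => k x * chartPartition (m := m) M c x) ⊆
      (extChartAt (𝓡 (2 * m + 1)) c).source :=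
  (tsupport_mul_subset_right).trans (tsupport_chartPartition_subset c)

lemma continuous_chartPartition (c : M) : Continuous (chartPartition (m := m) M c) :=
  (chartPartition (m := m) M c).2.continuous

/-- The integral of a function with respect to the volume density of `α`. -/
noncomputable def volInt (α : OneForm m M) (k : M → ℝ) : ℝ :=
  ∑ c ∈ chartCenters m M, chartIntegral α c (fun x => chartPartition (m := m) M c x * k x)

lemma contactVolume_eq_volInt (α : OneForm m M) : contactVolume α = volInt α (fun _ => 1) := by
  rw [contactVolume, volInt]
  simp only [mul_one]
  refine finsum_eq_sum_of_support_subset _ fun c hc => ?_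
  by_contra h
  refine hc ?_
  simp [chartPartition_eq_zero h]

lemma contactVolume_smulForm {α : OneForm m M} (hα : SmoothOneForm α) {u : M → ℝ}
    (hu : ContMDiff (𝓡 (2 * m + 1)) 𝓘(ℝ, ℝ) ∞ u) :
    contactVolume (smulForm u α) = volInt α (fun x => |u x| ^ (m + 1)) := by
  rw [contactVolume_eq_volInt, volInt, volInt]
  simp only [mul_one, chartIntegral_smulForm hα hu]

/-- The contact volume is invariant under diffeomorphisms. -/
lemma contactVolume_pullForm {α : OneForm m M} (hα : SmoothOneForm α)
    (g : M ≃ₘ⟮𝓡 (2 * m + 1), 𝓡 (2 * m + 1)⟯ M) :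
    contactVolume (pullForm g α) = contactVolume α := by
  have hα' := hα.pullForm g.contMDiff
  have h1 (c : M) : chartIntegral (pullForm g α) c (chartPartition (m := m) M c) =
      ∑ d ∈ chartCenters m M, chartIntegral α d (fun x =>
        chartPartition (m := m) M c (g.symm x) * chartPartition (m := m) M d x) := by
    -- Inserting the partition of unity pulled back by `g` localizes each term both in a chart of
    -- the source and in a chart of the target; the sum over `c` is collapsed afterwards.
    have h2 : (chartPartition (m := m) M c : M → ℝ) = fun x => ∑ d ∈ chartCenters m M,
        chartPartition (m := m) M c x * chartPartition (m := m) M d (g x) := by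
      funext x
      rw [← Finset.mul_sum, sum_chartPartition, mul_one]
    rw [congrArg (chartIntegral (pullForm g α) c) h2, chartIntegral_sum hα' _
      (k := fun d x => chartPartition (m := m) M c x * chartPartition (m := m) M d (g x))
      (fun d => tsupport_chartPartition_mul_subset c _)
      fun d => (continuous_chartPartition c).mul ((continuous_chartPartition d).comp g.continuous)]
    refine Finset.sum_congr rfl fun d _ => ?_
    rw [chartIntegral_pullForm hα g (d := d)]
    · congr 1
      funext x
      simp only [Function.comp_apply, g.apply_symm_apply]
    · intro x hx
      exact tsupport_chartPartition_subset d (subset_tsupport _ (right_ne_zero_of_mul hx))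
    · intro x hx
      exact tsupport_chartPartition_subset c (subset_tsupport _ (left_ne_zero_of_mul hx))
  rw [contactVolume_eq_volInt, contactVolume_eq_volInt, volInt, volInt]
  simp only [mul_one, h1]
  rw [Finset.sum_comm]
  refine Finset.sum_congr rfl fun d _ => ?_
  rw [← chartIntegral_sum hα _ (k := fun c x => chartPartition (m := m) M c (g.symm x) *
    chartPartition (m := m) M d x) (fun c => tsupport_mul_chartPartition_subset d _)
      fun c => ((continuous_chartPartition c).comp g.symm.continuous).mul
        (continuous_chartPartition d)]
  congr 1
  funext x
  rw [← Finset.sum_mul, sum_chartPartition, one_mul]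

lemma volInt_add {α : OneForm m M} (hα : SmoothOneForm α) {k l : M → ℝ} (hk : Continuous k)
    (hl : Continuous l) : volInt α (fun x => k x + l x) = volInt α k + volInt α l := by
  rw [volInt, volInt, volInt, ← Finset.sum_add_distrib]
  refine Finset.sum_congr rfl fun c _ => ?_
  simp only [mul_add]
  exact chartIntegral_add hα (tsupport_chartPartition_mul_subset c _)
    ((continuous_chartPartition c).mul hk) (tsupport_chartPartition_mul_subset c _)
    ((continuous_chartPartition c).mul hl)

lemma volInt_const_mul (α : OneForm m M) (r : ℝ) (k : M → ℝ) :
    volInt α (fun x => r * k x) = r * volInt α k := by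
  rw [volInt, volInt, Finset.mul_sum]
  refine Finset.sum_congr rfl fun c _ => ?_
  rw [chartIntegral, chartIntegral, ← integral_const_mul]
  congr 1
  funext y
  ring

/-- Some function of the partition is nonzero at `p`, and in its chart the integrand is continuous,
nonnegative and positive at the image of `p`. -/
lemma volInt_pos {α : OneForm m M} (hα : IsContactForm α) {k : M → ℝ} (hk : Continuous k)
    (h0 : ∀ x, 0 ≤ k x) {p : M} (hp : 0 < k p) : 0 < volInt α k := by
  have hnn (c x : M) : 0 ≤ chartPartition (m := m) M c x * k x :=
    mul_nonneg ((chartPartition (m := m) M).nonneg c _) (h0 _)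
  obtain ⟨c, hc, hcp⟩ : ∃ c ∈ chartCenters m M, chartPartition (m := m) M c p ≠ 0 := by
    by_contra! h
    have := sum_chartPartition (m := m) p
    rw [Finset.sum_eq_zero h] at this
    exact zero_ne_one this
  refine Finset.sum_pos' (fun c _ => ?_) ⟨c, hc, ?_⟩
  · rw [chartIntegral_eq]
    exact integral_nonneg (chartFun_nonneg α c (hnn c))
  · rw [chartIntegral_eq]
    have hs : p ∈ (extChartAt (𝓡 (2 * m + 1)) c).source :=
      tsupport_chartPartition_subset c (subset_tsupport _ hcp)
    have ht := (extChartAt (𝓡 (2 * m + 1)) c).map_source hs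
    refine (continuous_chartFun hα.1 (tsupport_chartPartition_mul_subset c k)
      ((continuous_chartPartition c).mul hk)).integral_pos_of_hasCompactSupport_nonneg_nonzero
      (hasCompactSupport_chartFun α (tsupport_chartPartition_mul_subset c k))
      (chartFun_nonneg α c (hnn c)) (x := extChartAt (𝓡 (2 * m + 1)) c p) ?_
    rw [chartFun_chart α _ hs]
    exact mul_ne_zero (mul_ne_zero hcp hp.ne') (hα.chartDensity_pos ht).ne'

lemma volInt_lt {α : OneForm m M} (hα : IsContactForm α) {k l : M → ℝ} (hk : Continuous k)
    (hl : Continuous l) (h : ∀ x, k x ≤ l x) {p : M} (hp : k p < l p) :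
    volInt α k < volInt α l := by
  have h1 := volInt_pos hα (hl.sub hk) (fun x => sub_nonneg.2 (h x)) (sub_pos.2 hp)
  have h2 := volInt_add hα.1 hk (hl.sub hk)
  have h3 : (fun x => k x + (l - k) x) = l := by funext x; simp
  rw [h3] at h2
  linarith

lemma contactVolume_pos [Nonempty M] {α : OneForm m M} (hα : IsContactForm α) :
    0 < contactVolume α := by
  rw [contactVolume_eq_volInt]
  exact volInt_pos hα continuous_const (fun _ => zero_le_one) (p := Classical.arbitrary M)
    zero_lt_one

/-- The product of `H s` and a function of the partition of unity, in a chart, extended by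
zero. -/
noncomputable def chartParam (c : M) (H : ℝ → M → ℝ) (p : ℝ × Model m) : ℝ :=
  (univ ×ˢ (extChartAt (𝓡 (2 * m + 1)) c).target : Set (ℝ × Model m)).indicator (fun p =>
    chartPartition (m := m) M c ((extChartAt (𝓡 (2 * m + 1)) c).symm p.2) *
      H p.1 ((extChartAt (𝓡 (2 * m + 1)) c).symm p.2)) p

lemma contDiff_chartPartition_mul (c : M) {H : ℝ → M → ℝ}
    (hH : ContMDiff (𝓘(ℝ, ℝ).prod (𝓡 (2 * m + 1))) 𝓘(ℝ, ℝ) ∞ (fun p : ℝ × M => H p.1 p.2)) :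
    ContDiff ℝ ∞ (chartParam (m := m) c H) := by
  have hs := tsupport_chartPartition_subset (m := m) c
  refine contDiff_indicator_of_isClosed
    (C := univ ×ˢ chartSupport (m := m) c (chartPartition (m := m) M c))
    (isOpen_univ.prod (isOpen_target c)) (isClosed_univ.prod (isCompact_chartSupport hs).isClosed)
    (prod_mono_right (chartSupport_subset hs)) ?_ fun p hp hpK => by
      rw [eq_zero_of_notMem_chartSupport (k := chartPartition (m := m) M c) hp.2
        (fun h => hpK ⟨mem_univ _, h⟩), zero_mul]
  rintro ⟨s, y⟩ hy
  refine ContDiffAt.contDiffWithinAt ?_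
  have h1 : ContMDiffAt (𝓘(ℝ, ℝ).prod 𝓘(ℝ, Model m)) (𝓡 (2 * m + 1)) ∞
      (fun p : ℝ × Model m => (extChartAt (𝓡 (2 * m + 1)) c).symm p.2) (s, y) :=
    (contMDiffAt_symm_chart hy.2).comp (s, y) contMDiffAt_snd
  have h2 : ContMDiffAt (𝓘(ℝ, ℝ).prod 𝓘(ℝ, Model m)) 𝓘(ℝ, ℝ) ∞
      (fun p : ℝ × Model m => chartPartition (m := m) M c
        ((extChartAt (𝓡 (2 * m + 1)) c).symm p.2)) (s, y) :=
    ContMDiffAt.comp (s, y) (g := chartPartition (m := m) M c)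
      (chartPartition (m := m) M c).contMDiff.contMDiffAt h1
  have h3 : ContMDiffAt (𝓘(ℝ, ℝ).prod 𝓘(ℝ, Model m)) 𝓘(ℝ, ℝ) ∞
      (fun p : ℝ × Model m => H p.1 ((extChartAt (𝓡 (2 * m + 1)) c).symm p.2)) (s, y) :=
    ContMDiffAt.comp (s, y) (g := fun p : ℝ × M => H p.1 p.2)
      (f := fun p : ℝ × Model m => (p.1, (extChartAt (𝓡 (2 * m + 1)) c).symm p.2))
      (hH _) (contMDiffAt_fst.prodMk h1)
  rw [← contMDiffAt_iff_contDiffAt, modelWithCornersSelf_prod, ← chartedSpaceSelf_prod]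
  exact h2.mul h3

/-- Integrals depend smoothly on parameters. -/
lemma contDiff_volInt {α : OneForm m M} (hα : SmoothOneForm α) {H : ℝ → M → ℝ}
    (hH : ContMDiff (𝓘(ℝ, ℝ).prod (𝓡 (2 * m + 1))) 𝓘(ℝ, ℝ) ∞ (fun p : ℝ × M => H p.1 p.2)) :
    ContDiff ℝ ∞ (fun s => volInt α (H s)) := by
  refine ContDiff.sum fun c _ => ?_
  have hs := tsupport_chartPartition_subset (m := m) c
  have hK := isCompact_chartSupport hs
  set K := chartSupport (m := m) c (chartPartition (m := m) M c) with hKdef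
  have hKt : K ⊆ (extChartAt (𝓡 (2 * m + 1)) c).target := chartSupport_subset hs
  -- The density is only known to be continuous on the chart, so it plays the part of the locally
  -- integrable factor. All smoothness in `s` is carried by `chartParam`, which is supported over
  -- `K`.
  have hf : Integrable (K.indicator (chartDensity α c)) := by
    rw [integrable_indicator_iff hK.measurableSet]
    exact ((continuousOn_chartDensity hα c).mono hKt).integrableOn_compact hK
  have hsm := contDiff_integral_mul hf.locallyIntegrable hK
    (contDiff_chartPartition_mul c hH) fun s y hy => by
      by_cases h : y ∈ (extChartAt (𝓡 (2 * m + 1)) c).target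
      · rw [chartParam, indicator_of_mem (show (s, y) ∈ univ ×ˢ _ from ⟨mem_univ _, h⟩),
          eq_zero_of_notMem_chartSupport (k := chartPartition (m := m) M c) h hy, zero_mul]
      · rw [chartParam, indicator_of_notMem (fun h' => h h'.2)]
  convert! hsm using 1
  funext s
  rw [chartIntegral_eq]
  refine integral_congr_ae (Filter.Eventually.of_forall fun y => ?_)
  simp only
  by_cases h : y ∈ (extChartAt (𝓡 (2 * m + 1)) c).target
  · rw [chartParam, chartFun, indicator_of_mem h,
      indicator_of_mem (show (s, y) ∈ univ ×ˢ _ from ⟨mem_univ _, h⟩)]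
    by_cases hyK : y ∈ K
    · rw [indicator_of_mem hyK]
      ring
    · rw [eq_zero_of_notMem_chartSupport (k := chartPartition (m := m) M c) h hyK]
      ring
  · rw [chartParam, chartFun, indicator_of_notMem h, indicator_of_notMem (fun h' => h (hKt h')),
      zero_mul]

end VolumeIntegral

end ContactLF

namespace ContactLF

/-! ### Velocities of curves and generators of paths -/

section Velocities

open scoped Topology

variable {m : ℕ} {M : Type*} [TopologicalSpace M] [ChartedSpace (Model m) M]

/-- The value of a vector field, as a vector of the model space. -/
def vecAt (X : VField m M) (x : M) : Model m := X x

/-- The curve `γ` has velocity `v` at time `t`. -/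
def HasVelocity (γ : ℝ → M) (v : Model m) (t : ℝ) : Prop :=
  HasMFDerivAt 𝓘(ℝ, ℝ) (𝓡 (2 * m + 1)) γ t ((1 : ℝ →L[ℝ] ℝ).smulRight v : ℝ →L[ℝ] Model m)

lemma comp_smulRight_one {E F : Type*} [NormedAddCommGroup E] [NormedSpace ℝ E]
    [NormedAddCommGroup F] [NormedSpace ℝ F] (A : E →L[ℝ] F) (v : E) :
    A.comp ((1 : ℝ →L[ℝ] ℝ).smulRight v) = (1 : ℝ →L[ℝ] ℝ).smulRight (A v) := by
  ext; simp

lemma HasVelocity.comp {γ : ℝ → M} {v : Model m} {t : ℝ} (h : HasVelocity γ v t) {g : M → M}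
    (hg : MDifferentiableAt (𝓡 (2 * m + 1)) (𝓡 (2 * m + 1)) g (γ t)) :
    HasVelocity (fun τ => g (γ τ)) (der g (γ t) v) t :=
  (hg.hasMFDerivAt.comp t h).congr_mfderiv (comp_smulRight_one (der g (γ t)) v)

lemma HasVelocity.hasDerivAt_comp {γ : ℝ → M} {v : Model m} {t : ℝ} (h : HasVelocity γ v t)
    {f : M → ℝ} (hf : MDifferentiableAt (𝓡 (2 * m + 1)) 𝓘(ℝ, ℝ) f (γ t)) :
    HasDerivAt (fun τ => f (γ τ)) (dFun f (γ t) v) t := by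
  have h1 : HasMFDerivAt 𝓘(ℝ, ℝ) 𝓘(ℝ, ℝ) (fun τ => f (γ τ)) t
      ((1 : ℝ →L[ℝ] ℝ).smulRight (dFun f (γ t) v) : ℝ →L[ℝ] ℝ) :=
    (hf.hasMFDerivAt.comp t h).congr_mfderiv (comp_smulRight_one (dFun f (γ t)) v)
  have h2 : HasFDerivAt (fun τ => f (γ τ))
      ((1 : ℝ →L[ℝ] ℝ).smulRight (dFun f (γ t) v) : ℝ →L[ℝ] ℝ) t := h1.hasFDerivAt
  simpa using h2.hasDerivAt

lemma HasVelocity.comp_mul {γ : ℝ → M} {v : Model m} {b t : ℝ} (h : HasVelocity γ v (b * t)) :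
    HasVelocity (fun τ => γ (b * τ)) (b • v) t := by
  have h1 : HasMFDerivAt 𝓘(ℝ, ℝ) 𝓘(ℝ, ℝ) (fun τ : ℝ => b * τ) t
      ((1 : ℝ →L[ℝ] ℝ).smulRight b : ℝ →L[ℝ] ℝ) := by
    have h2 : HasDerivAt (fun τ : ℝ => b * τ) b t := by simpa using (hasDerivAt_id t).const_mul b
    exact (h2.hasFDerivAt.congr_fderiv (by ext; simp)).hasMFDerivAt
  have h3 := HasMFDerivAt.comp (g := γ) (f := fun τ : ℝ => b * τ) t h h1
  refine h3.congr_mfderiv ?_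
  refine (comp_smulRight_one (E := ℝ) (F := Model m) ((1 : ℝ →L[ℝ] ℝ).smulRight v) b).trans ?_
  ext1
  simp

/-- The generator of a path of surjective maps is determined by the velocities. -/
lemma generator_eq {T t : ℝ} (hT : 0 < T) (ht : t ∈ Icc 0 T) {ψ : ℝ → M → M}
    (hψ : Function.Surjective (ψ t)) {X : VField m M}
    (hX : ∀ x, HasVelocity (fun τ => ψ τ x) (X (ψ t x)) t) : generator T ψ t = X := by
  have hX' : ∀ x, HasMFDerivWithinAt 𝓘(ℝ, ℝ) (𝓡 (2 * m + 1)) (fun τ => ψ τ x) (Icc 0 T) t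
      ((1 : ℝ →L[ℝ] ℝ).smulRight (X (ψ t x))) := fun x => (hX x).hasMFDerivWithinAt
  have hgen := Classical.epsilon_spec (p := fun X : VField m M => ∀ x,
    HasMFDerivWithinAt 𝓘(ℝ, ℝ) (𝓡 (2 * m + 1)) (fun τ => ψ τ x) (Icc 0 T) t
      ((1 : ℝ →L[ℝ] ℝ).smulRight (X (ψ t x)))) ⟨X, hX'⟩
  -- One-sided derivatives at the endpoints of `[0, T]` are still unique; together with surjectivity
  -- of `ψ t` this determines the generator at every point.
  have hu : UniqueMDiffWithinAt 𝓘(ℝ, ℝ) (Icc 0 T) t := by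
    rw [uniqueMDiffWithinAt_iff_uniqueDiffWithinAt]
    exact uniqueDiffOn_Icc hT t ht
  funext y
  obtain ⟨x, rfl⟩ := hψ y
  have h := hu.eq (hgen x) (hX' x)
  have h1 := congrArg (fun L : ℝ →L[ℝ] Model m => L 1) h
  have h2 (v : Model m) : ((1 : ℝ →L[ℝ] ℝ).smulRight v : ℝ →L[ℝ] Model m) 1 = v := by simp
  exact (h2 _).symm.trans (h1.trans (h2 _))

variable [IsManifold (𝓡 (2 * m + 1)) ∞ M] [CompactSpace M] [T2Space M]

lemma SmoothVField.hasVelocity_flow {X : VField m M} (hX : SmoothVField X) (t : ℝ) (x : M) :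
    HasVelocity (fun t => flow X t x) (X (flow X t x)) t := hX.isMIntegralCurve_flow x t

/-- The velocity of a curve moved by a flow. -/
lemma SmoothVField.hasVelocity_flow_comp {X : VField m M} (hX : SmoothVField X) {b t : ℝ}
    {γ : ℝ → M} {v : Model m} (h : HasVelocity γ v t) :
    HasVelocity (fun τ => flow X (b * τ) (γ τ))
      (b • vecAt X (flow X (b * t) (γ t)) + der (flow X (b * t)) (γ t) v) t := by
  let f : ℝ × M → M := fun p => flow X (b * p.1) p.2
  have hb : ContMDiff (𝓘(ℝ, ℝ).prod (𝓡 (2 * m + 1))) 𝓘(ℝ, ℝ) ∞ (fun p : ℝ × M => b * p.1) :=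
    (contDiff_const.mul contDiff_id : ContDiff ℝ ∞ fun τ : ℝ => b * τ).contMDiff.comp contMDiff_fst
  have hf : ContMDiff (𝓘(ℝ, ℝ).prod (𝓡 (2 * m + 1))) (𝓡 (2 * m + 1)) ∞ f :=
    hX.contMDiff_flow.comp (hb.prodMk contMDiff_snd)
  have hfd := hf.mdifferentiableAt (x := (t, γ t)) (by simp)
  have hc : HasMFDerivAt 𝓘(ℝ, ℝ) (𝓘(ℝ, ℝ).prod (𝓡 (2 * m + 1))) (fun τ : ℝ => (τ, γ τ)) t _ :=
    (hasMFDerivAt_id t).prodMk h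
  have hcomp := HasMFDerivAt.comp (g := f) (f := fun τ : ℝ => (τ, γ τ)) t hfd.hasMFDerivAt hc
  refine hcomp.congr_mfderiv ?_
  refine ContinuousLinearMap.ext_ring ?_
  -- The derivative of `(τ, x) ↦ flow X (b τ) x` splits into its two partial derivatives, giving the
  -- two summands of the velocity.
  have h1 := mfderiv_prod_eq_add_apply (v := ((1 : ℝ), v)) hfd
  have h2 : HasVelocity (fun τ => f (τ, γ t)) (b • vecAt X (flow X (b * t) (γ t))) t :=
    (hX.hasVelocity_flow (b * t) (γ t)).comp_mul
  have h3 := congrArg (fun L : ℝ →L[ℝ] Model m => L 1) (HasMFDerivAt.mfderiv h2)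
  have h4 (w : Model m) : ((1 : ℝ →L[ℝ] ℝ).smulRight w : ℝ →L[ℝ] Model m) 1 = w := by simp
  refine Eq.trans ?_ (h4 _).symm
  refine Eq.trans ?_ (congrArg (fun w : Model m => w + der (flow X (b * t)) (γ t) v)
    (h3.trans (h4 _)))
  refine Eq.trans ?_ h1
  refine congrArg (fun w : ℝ × Model m => (mfderiv (𝓘(ℝ, ℝ).prod (𝓡 (2 * m + 1)))
    (𝓡 (2 * m + 1)) f (t, γ t) : ℝ × Model m →L[ℝ] Model m) w) ?_
  exact Prod.ext rfl (h4 v)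

end Velocities

/-! ### Forms defining a contact structure -/

section DefiningForms

open scoped Topology

variable {m : ℕ} {M : Type*} [TopologicalSpace M] [ChartedSpace (Model m) M]

lemma pullForm_comp (α : OneForm m M) {f g : M → M}
    (hf : MDifferentiable (𝓡 (2 * m + 1)) (𝓡 (2 * m + 1)) f)
    (hg : MDifferentiable (𝓡 (2 * m + 1)) (𝓡 (2 * m + 1)) g) :
    pullForm g (pullForm f α) = pullForm (fun x => f (g x)) α := by
  funext x
  refine ContinuousLinearMap.ext fun v => ?_
  have h := mfderiv_comp x (hf (g x)) (hg x)
  exact congrArg (formAt α (f (g x))) (congrArg (fun L : Model m →L[ℝ] Model m => L v) h).symm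

lemma pullForm_smulForm (u : M → ℝ) (α : OneForm m M) (g : M → M) :
    pullForm g (smulForm u α) = smulForm (fun x => u (g x)) (pullForm g α) := rfl

lemma smulForm_smulForm (u w : M → ℝ) (α : OneForm m M) :
    smulForm u (smulForm w α) = smulForm (fun x => u x * w x) α := by
  funext x
  exact smul_smul (u x) (w x) (α x)

lemma smulForm_one (α : OneForm m M) : smulForm (fun _ => 1) α = α := by
  funext x
  exact one_smul ℝ (α x)

variable [IsManifold (𝓡 (2 * m + 1)) ∞ M] {ξ : ContactStructure m M} {α : OneForm m M}

namespace ContactStructure.IsDefiningForm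

lemma mem_ker (hα : ξ.IsDefiningForm α) (x : M) (v : Model m) :
    v ∈ ξ.ker x ↔ formAt α x v = 0 := by
  have h := (hα.2 x).1
  constructor
  · intro hv
    rw [h] at hv
    exact hv
  · intro hv
    rw [h]
    exact hv

lemma mem_pos (hα : ξ.IsDefiningForm α) (x : M) (v : Model m) :
    v ∈ ξ.pos x ↔ 0 < formAt α x v := by
  have h := (hα.2 x).2
  constructor
  · intro hv
    rw [h] at hv
    exact hv
  · intro hv
    rw [h]
    exact hv

lemma of_mem {β : OneForm m M} (hβ : IsContactForm β)
    (h1 : ∀ (x : M) (v : Model m), v ∈ ξ.ker x ↔ formAt β x v = 0)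
    (h2 : ∀ (x : M) (v : Model m), v ∈ ξ.pos x ↔ 0 < formAt β x v) : ξ.IsDefiningForm β :=
  ⟨hβ, fun x => ⟨Submodule.ext fun v => h1 x v, Set.ext fun v => h2 x v⟩⟩

lemma smulForm (hα : ξ.IsDefiningForm α) {u : M → ℝ}
    (hu : ContMDiff (𝓡 (2 * m + 1)) 𝓘(ℝ, ℝ) ∞ u) (hu0 : ∀ x, 0 < u x) :
    ξ.IsDefiningForm (smulForm u α) := by
  refine of_mem (hα.1.smulForm hu fun x => (hu0 x).ne') (fun x v => ?_) fun x v => ?_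
  · rw [hα.mem_ker, smulForm_apply, mul_eq_zero, or_iff_right (hu0 x).ne']
  · rw [hα.mem_pos, smulForm_apply, mul_pos_iff_of_pos_left (hu0 x)]

lemma pullForm (hα : ξ.IsDefiningForm α) (g : M ≃ₘ⟮𝓡 (2 * m + 1), 𝓡 (2 * m + 1)⟯ M)
    (hg : ξ.Preserves g) : ξ.IsDefiningForm (pullForm g α) := by
  refine of_mem (hα.1.pullForm g) (fun x v => ?_) fun x v => ?_
  · rw [pullForm_apply, ← hα.mem_ker]
    exact (hg x v).1.symm
  · rw [pullForm_apply, ← hα.mem_pos]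
    exact (hg x v).2.symm

lemma preserves (hα : ξ.IsDefiningForm α) {g : M → M} (hg : ContactLF.pullForm g α = α) :
    ξ.Preserves g := by
  intro x v
  have h : formAt α (g x) (der g x v) = formAt α x v :=
    congrArg (fun β : OneForm m M => formAt β x v) hg
  refine ⟨(hα.mem_ker (g x) (der g x v)).trans ?_, (hα.mem_pos (g x) (der g x v)).trans ?_⟩
  · rw [h]
    exact (hα.mem_ker x v).symm
  · rw [h]
    exact (hα.mem_pos x v).symm

/-- The kernels coincide and both forms take the value `1` on the common Reeb vector, which spans a
complement. -/
lemma eq_of_reebField_eq (hα : ξ.IsDefiningForm α) {β : OneForm m M} (hβ : ξ.IsDefiningForm β)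
    (h : reebField α = reebField β) : α = β := by
  funext x
  refine ContinuousLinearMap.ext fun v => ?_
  have hRα : formAt α x (reebField α x) = 1 := (hα.1.isReebVector_reebField x).1
  have hRβ : formAt β x (reebField α x) = 1 := by
    rw [h]; exact (hβ.1.isReebVector_reebField x).1
  have key (v R : Model m) (hR : formAt α x R = 1) (hR' : formAt β x R = 1) :
      formAt α x v = formAt β x v := by
    have h1 : formAt α x (v - formAt α x v • R) = 0 := by
      rw [map_sub, map_smul, hR, smul_eq_mul, mul_one, sub_self]
    have h2 := (hβ.mem_ker x _).1 ((hα.mem_ker x _).2 h1)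
    rw [map_sub, map_smul, hR', smul_eq_mul, mul_one, sub_eq_zero] at h2
    exact h2.symm
  exact key v (reebField α x) hRα hRβ

variable [CompactSpace M] [T2Space M]

lemma isPositiveContactVField (hα : ξ.IsDefiningForm α) :
    ξ.IsPositiveContactVField (reebField α) := by
  refine ⟨⟨hα.1.smoothVField_reebField, fun t => hα.preserves (hα.1.pullForm_flow t)⟩, fun x => ?_⟩
  refine (hα.mem_pos x (reebField α x)).2 ?_
  have : formAt α x (reebField α x) = 1 := (hα.1.isReebVector_reebField x).1
  rw [this]
  exact one_pos

/-- The form chosen in the definition of `V` must be `α`, by uniqueness of the defining form with a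
given Reeb field. -/
lemma V_reebField (hα : ξ.IsDefiningForm α) :
    ξ.V (reebField α) = contactVolume α ^ (-(1 / ((m : ℝ) + 1))) := by
  have h := Classical.epsilon_spec (p := fun β : OneForm m M =>
    ξ.IsDefiningForm β ∧ reebField α = reebField β) ⟨α, hα, rfl⟩
  have h2 := hα.eq_of_reebField_eq h.1 h.2
  rw [ContactStructure.V, ← h2]

end ContactStructure.IsDefiningForm

lemma ContactStructure.Preserves.comp {f g : M → M} (hf : ξ.Preserves f) (hg : ξ.Preserves g)
    (hfd : MDifferentiable (𝓡 (2 * m + 1)) (𝓡 (2 * m + 1)) f)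
    (hgd : MDifferentiable (𝓡 (2 * m + 1)) (𝓡 (2 * m + 1)) g) :
    ξ.Preserves (fun x => f (g x)) := by
  intro x v
  have h := congrArg (fun L : Model m →L[ℝ] Model m => L v) (mfderiv_comp x (hfd (g x)) (hgd x))
  have h' : der (fun x => f (g x)) x v = der f (g x) (der g x v) := h
  have h1 := hf (g x) (der g x v)
  rw [← hg x v |>.1, ← hg x v |>.2]
  exact ⟨(Iff.of_eq (congrArg (fun w => w ∈ ξ.ker (f (g x))) h')).trans h1.1,
    (Iff.of_eq (congrArg (fun w => w ∈ ξ.pos (f (g x))) h')).trans h1.2⟩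

end DefiningForms

/-! ### Contact Hamiltonians: Reeb fields of rescaled forms -/

section RescaledReeb

variable {m : ℕ} {M : Type*} [TopologicalSpace M] [ChartedSpace (Model m) M]

lemma dFun_comp {f : ℝ → ℝ} {f' : ℝ} {k : M → ℝ} {x : M} (hf : HasDerivAt f f' (k x))
    (hk : MDifferentiableAt (𝓡 (2 * m + 1)) 𝓘(ℝ, ℝ) k x) (v : Model m) :
    dFun (fun z => f (k z)) x v = f' * dFun k x v := by
  have h := (HasMFDerivAt.comp (g := f) x hf.hasFDerivAt.hasMFDerivAt hk.hasMFDerivAt).mfderiv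
  refine (congrArg (fun L : Model m →L[ℝ] ℝ => L v) h).trans ?_
  exact mul_comm _ _

variable [IsManifold (𝓡 (2 * m + 1)) ∞ M] {α : OneForm m M} {F : M → ℝ}

/-- For `Y` the Reeb field of `α / F`, the function `F` is its contact Hamiltonian. The identities
come from expanding `i_Y d(α / F) = 0`; evaluation on the Reeb vector of `α` determines `dF(Y)`. -/
lemma IsContactForm.dBilin_reebField_smulForm_inv (hα : IsContactForm α)
    (hF : ContMDiff (𝓡 (2 * m + 1)) 𝓘(ℝ, ℝ) ∞ F) (hF0 : ∀ x, 0 < F x) (x : M) :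
    formAt α x (reebField (ContactLF.smulForm (fun z => (F z)⁻¹) α) x) = F x ∧
    (dFun F x (reebField (ContactLF.smulForm (fun z => (F z)⁻¹) α) x) =
      F x * dFun F x (reebField α x)) ∧
    ∀ w, dBilin α x (reebField (ContactLF.smulForm (fun z => (F z)⁻¹) α) x) w =
      dFun F x (reebField α x) * formAt α x w - dFun F x w := by
  have hFi : ContMDiff (𝓡 (2 * m + 1)) 𝓘(ℝ, ℝ) ∞ (fun z => (F z)⁻¹) :=
    fun z => (contDiffAt_inv ℝ (hF0 z).ne').contMDiffAt.comp z (hF z)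
  have hβ := hα.smulForm hFi fun z => inv_ne_zero (hF0 z).ne'
  obtain ⟨h1, h2⟩ := hβ.isReebVector_reebField x
  have hR1 : formAt α x (reebField α x) = 1 := (hα.isReebVector_reebField x).1
  have hR2 := (hα.isReebVector_reebField x).2
  set Y : Model m := reebField (ContactLF.smulForm (fun z => (F z)⁻¹) α) x with hY
  set R : Model m := reebField α x with hR
  have hFx := (hF0 x).ne'
  have h1' : (F x)⁻¹ * formAt α x Y = 1 := h1
  have hαY : formAt α x Y = F x := by field_simp at h1'; linarith
  have hd (w : Model m) : dFun (fun z => (F z)⁻¹) x w = -(F x ^ 2)⁻¹ * dFun F x w :=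
    dFun_comp (hasDerivAt_inv hFx) (hF.mdifferentiableAt (by simp)) w
  have h2' (w : Model m) : (F x)⁻¹ * dBilin α x Y w + (-(F x ^ 2)⁻¹ * dFun F x Y * formAt α x w -
      -(F x ^ 2)⁻¹ * dFun F x w * F x) = 0 := by
    have h3 := (dBilin_smulForm hα.1 hFi x Y w).symm.trans (h2 w)
    rw [hd, hd] at h3
    have h3' : (F x)⁻¹ * dBilin α x Y w + (-(F x ^ 2)⁻¹ * dFun F x Y * formAt α x w -
      -(F x ^ 2)⁻¹ * dFun F x w * formAt α x Y) = 0 := h3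
    rwa [hαY] at h3'
  have h4 (w : Model m) : dBilin α x Y w =
      (F x)⁻¹ * dFun F x Y * formAt α x w - dFun F x w := by
    have := h2' w
    field_simp at this ⊢
    linarith
  have h5 : (F x)⁻¹ * dFun F x Y = dFun F x R := by
    have h6 := h4 R
    rw [dBilin_skew, hR2, hR1] at h6
    linarith
  refine ⟨hαY, ?_, fun w => ?_⟩
  · rw [← h5, mul_inv_cancel_left₀ hFx]
  · rw [h4, h5]

/-- The Reeb vector field of `α / (b (1 + F))` is `b` times the sum of those of `α` and `α / F`. -/
lemma IsContactForm.reebField_smulForm_add (hα : IsContactForm α)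
    (hF : ContMDiff (𝓡 (2 * m + 1)) 𝓘(ℝ, ℝ) ∞ F) (hF0 : ∀ x, 0 < F x) {b : ℝ} (hb : 0 < b)
    (x : M) : reebField (ContactLF.smulForm (fun z => (b * (1 + F z))⁻¹) α) x =
      b • (vecAt (reebField α) x +
        vecAt (reebField (ContactLF.smulForm (fun z => (F z)⁻¹) α)) x) := by
  have hpos (z : M) : 0 < b * (1 + F z) := mul_pos hb (by linarith [hF0 z])
  have hk : ContMDiff (𝓡 (2 * m + 1)) 𝓘(ℝ, ℝ) ∞ (fun z => (b * (1 + F z))⁻¹) := fun z => by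
    have h : ContDiffAt ℝ ∞ (fun r : ℝ => (b * (1 + r))⁻¹) (F z) :=
      (contDiffAt_const.mul (contDiffAt_const.add contDiffAt_id)).inv (hpos z).ne'
    exact h.contMDiffAt.comp z (hF z)
  have hγ := hα.smulForm hk fun z => inv_ne_zero (hpos z).ne'
  obtain ⟨h1, h2, h3⟩ := hα.dBilin_reebField_smulForm_inv hF hF0 x
  have hR1 : formAt α x (reebField α x) = 1 := (hα.isReebVector_reebField x).1
  have hR2 := (hα.isReebVector_reebField x).2
  set Y : Model m := reebField (ContactLF.smulForm (fun z => (F z)⁻¹) α) x with hY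
  set R : Model m := reebField α x with hR
  have hx := hpos x
  have hFx : 1 + F x ≠ 0 := by linarith [hF0 x]
  have hd (w : Model m) : dFun (fun z => (b * (1 + F z))⁻¹) x w =
      -(b / (b * (1 + F x)) ^ 2) * dFun F x w := by
    have h4 : HasDerivAt (fun r : ℝ => (b * (1 + r))⁻¹) (-(b / (b * (1 + F x)) ^ 2)) (F x) := by
      have h5 : HasDerivAt (fun r : ℝ => b * (1 + r)) b (F x) := by
        simpa using ((hasDerivAt_id (F x)).const_add 1).const_mul b
      exact (h5.inv hx.ne').congr_deriv (by ring)
    exact dFun_comp h4 (hF.mdifferentiableAt (by simp)) w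
  -- The candidate is checked against the two Reeb equations. The identities for `Y` express
  -- everything through `dF(R) α(w) - dF(w)`, and the two contributions cancel.
  refine hγ.reebField_eq ⟨?_, fun w => ?_⟩
  · show (b * (1 + F x))⁻¹ * formAt α x (b • (R + Y)) = 1
    rw [map_smul, map_add, hR1, h1, smul_eq_mul]
    exact inv_mul_cancel₀ hx.ne'
  · refine (dBilin_smulForm hα.1 hk x (b • (R + Y)) w).trans ?_
    show (b * (1 + F x))⁻¹ * dBilin α x (b • (R + Y)) w +
      (dFun (fun z => (b * (1 + F z))⁻¹) x (b • (R + Y)) * formAt α x w -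
        dFun (fun z => (b * (1 + F z))⁻¹) x w * formAt α x (b • (R + Y))) = 0
    have hB : dBilin α x (b • (R + Y)) w = b * dBilin α x Y w := by
      rw [map_smul, map_add, smul_apply, add_apply, hR2,
        zero_add, smul_eq_mul]
    rw [hB, hd, hd, map_smul, map_smul, map_add, map_add, h1, h2, h3, hR1]
    simp only [smul_eq_mul]
    field_simp
    ring

end RescaledReeb

end ContactLF

namespace ContactLF

/-! ### Fixed points of the twisted maps -/

section Twist

open scoped Topology

variable {m : ℕ} {M : Type*} [TopologicalSpace M] [ChartedSpace (Model m) M]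

/-- The flow of `X` at time `p`, composed with the conjugate of the same map by the flow of `Z` at
time `s`. -/
noncomputable def twist (X Z : VField m M) (s p : ℝ) (x : M) : M :=
  flow X p (flow Z s (flow X p (flow Z (-s) x)))

variable [IsManifold (𝓡 (2 * m + 1)) ∞ M] [CompactSpace M] [T2Space M] {X Z : VField m M}

lemma contMDiff_twist (hX : SmoothVField X) (hZ : SmoothVField Z) :
    ContMDiff (𝓘(ℝ, ℝ).prod (𝓘(ℝ, ℝ).prod (𝓡 (2 * m + 1)))) (𝓡 (2 * m + 1)) ∞
      (fun z : ℝ × ℝ × M => twist X Z z.1 z.2.1 z.2.2) := by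
  have hs : ContMDiff (𝓘(ℝ, ℝ).prod (𝓘(ℝ, ℝ).prod (𝓡 (2 * m + 1)))) 𝓘(ℝ, ℝ) ∞
      (fun z : ℝ × ℝ × M => z.1) := contMDiff_fst
  have hns : ContMDiff (𝓘(ℝ, ℝ).prod (𝓘(ℝ, ℝ).prod (𝓡 (2 * m + 1)))) 𝓘(ℝ, ℝ) ∞
      (fun z : ℝ × ℝ × M => -z.1) := (contDiff_neg (𝕜 := ℝ) (F := ℝ)).contMDiff.comp hs
  have hp : ContMDiff (𝓘(ℝ, ℝ).prod (𝓘(ℝ, ℝ).prod (𝓡 (2 * m + 1)))) 𝓘(ℝ, ℝ) ∞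
      (fun z : ℝ × ℝ × M => z.2.1) := contMDiff_fst.comp contMDiff_snd
  have hx : ContMDiff (𝓘(ℝ, ℝ).prod (𝓘(ℝ, ℝ).prod (𝓡 (2 * m + 1)))) (𝓡 (2 * m + 1)) ∞
      (fun z : ℝ × ℝ × M => z.2.2) := contMDiff_snd.comp contMDiff_snd
  have h1 := hZ.contMDiff_flow.comp (hns.prodMk hx)
  have h2 := hX.contMDiff_flow.comp (hp.prodMk h1)
  have h3 := hZ.contMDiff_flow.comp (hs.prodMk h2)
  exact hX.contMDiff_flow.comp (hp.prodMk h3)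

lemma twist_zero_right (hX : SmoothVField X) (hZ : SmoothVField Z) (s : ℝ) (x : M) :
    twist X Z s 0 x = x := by
  rw [twist, hX.flow_zero, hX.flow_zero, hZ.flow_flow_neg]

lemma twist_zero_left (hX : SmoothVField X) (hZ : SmoothVField Z) (p : ℝ) (x : M) :
    twist X Z 0 p x = flow X (2 * p) x := by
  rw [twist, neg_zero, hZ.flow_zero, hZ.flow_zero, ← hX.flow_add, two_mul]

/-- Moving a factor `φ^{T/2}` past `ζ^s` collects a full period, which is the identity. Times near
`T / 2` are thereby reduced to times near `0`. -/
lemma twist_sub (hX : SmoothVField X) {T : ℝ} (hT : ∀ x, flow X T x = x)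
    (hc : ∀ s x, flow X (T / 2) (flow Z s x) = flow Z s (flow X (T / 2) x)) (s p : ℝ) (x : M) :
    twist X Z s (p - T / 2) x = twist X Z s p x := by
  have h1 (y : M) : flow X p y = flow X (p - T / 2) (flow X (T / 2) y) := by
    rw [← hX.flow_add, sub_add_cancel]
  have h2 (y : M) : flow X (T / 2) (flow X p y) = flow X (p - T / 2) y := by
    rw [← hX.flow_add, show T / 2 + p = (p - T / 2) + T by ring, hX.flow_add, hT]
  rw [twist, twist, h1 (flow Z s _), hc, h2]

/-- In the coordinate `ℓ` around `x₀` the displacement has derivative `2` in `p` at the base point.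
Strict differentiability makes the estimate `|displacement - 2p| ≤ |p|` uniform in nearby `s` and
`x`, so the displacement is nonzero for `p ≠ 0`. -/
lemma eventually_twist_ne (hX : SmoothVField X) (hZ : SmoothVField Z) {x₀ : M}
    (ℓ : Model m →L[ℝ] ℝ) (hℓ : ℓ (X x₀) = 1) :
    ∀ᶠ z : ℝ × ℝ × M in 𝓝 (0, 0, x₀), z.2.1 ≠ 0 → twist X Z z.1 z.2.1 z.2.2 ≠ z.2.2 := by
  set e := extChartAt (𝓡 (2 * m + 1)) x₀ with he
  have hsrc : x₀ ∈ e.source := mem_extChartAt_source x₀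
  have htgt : e x₀ ∈ e.target := mem_extChartAt_target x₀
  let u : ℝ × ℝ × Model m → ℝ := fun z => ℓ (e (twist X Z z.1 z.2.1 (e.symm z.2.2)))
  have htw0 : twist X Z 0 0 (e.symm (e x₀)) = x₀ := by
    rw [twist_zero_right hX hZ, e.left_inv hsrc]
  have hu : ContDiffAt ℝ ∞ u (0, 0, e x₀) := by
    have h1 : ContMDiffAt (𝓘(ℝ, ℝ).prod (𝓘(ℝ, ℝ).prod 𝓘(ℝ, Model m))) (𝓡 (2 * m + 1)) ∞
        (fun z : ℝ × ℝ × Model m => e.symm z.2.2) (0, 0, e x₀) :=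
      ContMDiffAt.comp (0, 0, e x₀) (g := e.symm) (f := fun z : ℝ × ℝ × Model m => z.2.2)
        (contMDiffAt_symm_chart htgt) (contMDiffAt_snd.comp _ contMDiffAt_snd)
    have h2 : ContMDiffAt (𝓘(ℝ, ℝ).prod (𝓘(ℝ, ℝ).prod 𝓘(ℝ, Model m))) (𝓡 (2 * m + 1)) ∞
        (fun z : ℝ × ℝ × Model m => twist X Z z.1 z.2.1 (e.symm z.2.2)) (0, 0, e x₀) :=
      ContMDiffAt.comp (0, 0, e x₀) (g := fun z : ℝ × ℝ × M => twist X Z z.1 z.2.1 z.2.2)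
        (f := fun z : ℝ × ℝ × Model m => (z.1, z.2.1, e.symm z.2.2)) (contMDiff_twist hX hZ _)
        (contMDiffAt_fst.prodMk ((contMDiffAt_fst.comp _ contMDiffAt_snd).prodMk h1))
    have h3 : ContMDiffAt (𝓘(ℝ, ℝ).prod (𝓘(ℝ, ℝ).prod 𝓘(ℝ, Model m))) 𝓘(ℝ, Model m) ∞
        (fun z : ℝ × ℝ × Model m => e (twist X Z z.1 z.2.1 (e.symm z.2.2))) (0, 0, e x₀) :=
      ContMDiffAt.comp (0, 0, e x₀) (g := e) (contMDiffAt_chart (by rw [htw0]; exact hsrc)) h2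
    have h4 : ContMDiffAt (𝓘(ℝ, ℝ).prod (𝓘(ℝ, ℝ).prod 𝓘(ℝ, Model m))) 𝓘(ℝ, ℝ) ∞ u
        (0, 0, e x₀) := ℓ.contDiff.contMDiff.contMDiffAt.comp (0, 0, e x₀) h3
    rw [← contMDiffAt_iff_contDiffAt, modelWithCornersSelf_prod, modelWithCornersSelf_prod,
      ← chartedSpaceSelf_prod, ← chartedSpaceSelf_prod]
    exact h4
  have hstrict := hu.hasStrictFDerivAt (by simp)
  set L := fderiv ℝ u (0, 0, e x₀) with hL
  -- For `s = 0` the twisted map is `flow X (2 * p)`, and `ℓ (X x₀) = 1`.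
  have hL2 : L (0, 1, 0) = 2 := by
    have h1 : HasDerivAt (fun p : ℝ => u (0, p, e x₀)) (L (0, 1, 0)) 0 := by
      have hc : HasDerivAt (fun p : ℝ => ((0 : ℝ), p, e x₀)) ((0, 1, 0) : ℝ × ℝ × Model m) 0 :=
        (hasDerivAt_const 0 0).prodMk ((hasDerivAt_id 0).prodMk (hasDerivAt_const 0 (e x₀)))
      exact HasFDerivAt.comp_hasDerivAt (l := u) (f := fun p : ℝ => ((0 : ℝ), p, e x₀)) 0
        hstrict.hasFDerivAt hc
    have h2 : HasDerivAt (fun t : ℝ => repFlow X x₀ (t, e x₀)) (X x₀) 0 := by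
      have hc : HasDerivAt (fun t : ℝ => (t, e x₀)) ((1, 0) : ℝ × Model m) 0 :=
        (hasDerivAt_id 0).prodMk (hasDerivAt_const 0 (e x₀))
      have h3 := HasFDerivAt.comp_hasDerivAt (l := repFlow X x₀) (f := fun t : ℝ => (t, e x₀)) 0
        ((hX.contDiffAt_repFlow htgt).differentiableAt (by simp)).hasFDerivAt hc
      exact h3.congr_deriv ((hX.fderiv_repFlow htgt).trans (repField_self X x₀))
    have h4 : HasDerivAt (fun p : ℝ => ℓ (repFlow X x₀ (2 * p, e x₀))) (2 : ℝ) 0 := by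
      have hm : HasDerivAt (fun p : ℝ => 2 * p) 2 0 := by
        simpa using (hasDerivAt_id (0 : ℝ)).const_mul 2
      have h5 := HasDerivAt.scomp_of_eq (h := fun p : ℝ => 2 * p) 0 h2 hm (mul_zero 2).symm
      have h6 := (ℓ.hasFDerivAt).comp_hasDerivAt (0 : ℝ) h5
      refine h6.congr_deriv ?_
      have h7 : ℓ ((2 : ℝ) • vecAt X x₀) = 2 := by
        rw [map_smul, show ℓ (vecAt X x₀) = 1 from hℓ, smul_eq_mul, mul_one]
      exact h7
    refine h1.unique (h4.congr_of_eventuallyEq (Filter.Eventually.of_forall fun p => ?_))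
    show ℓ (e (twist X Z 0 p (e.symm (e x₀)))) = ℓ (e (flow X (2 * p) (e.symm (e x₀))))
    rw [twist_zero_left hX hZ]
  -- The bound compares the points with times `p` and `0`, at which `u` has equal values when `x` is
  -- a fixed point. It would then read `2 |p| ≤ |p|`.
  have hbound := hstrict.isLittleO.bound (c := 1) one_pos
  have hcont : ContinuousAt (fun z : ℝ × ℝ × M => (((z.1, z.2.1, e z.2.2), (z.1, (0 : ℝ), e z.2.2)) :
      (ℝ × ℝ × Model m) × (ℝ × ℝ × Model m))) (0, 0, x₀) := by
    have hce : ContinuousAt (fun z : ℝ × ℝ × M => e z.2.2) (0, 0, x₀) :=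
      ContinuousAt.comp (g := e) (f := fun z : ℝ × ℝ × M => z.2.2) (x := (0, 0, x₀))
        (continuousAt_extChartAt x₀) (by fun_prop)
    exact (continuousAt_fst.prodMk ((continuousAt_fst.comp continuousAt_snd).prodMk hce)).prodMk
      (continuousAt_fst.prodMk (continuousAt_const.prodMk hce))
  have hsrcev : ∀ᶠ z : ℝ × ℝ × M in 𝓝 (0, 0, x₀), z.2.2 ∈ e.source := by
    have hc : ContinuousAt (fun z : ℝ × ℝ × M => z.2.2) (0, 0, x₀) := by fun_prop
    exact hc.eventually ((isOpen_extChartAt_source x₀).mem_nhds hsrc)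
  filter_upwards [hcont.eventually hbound, hsrcev] with z hz hzs hp heq
  have h1 : u (z.1, z.2.1, e z.2.2) = ℓ (e z.2.2) := by
    show ℓ (e (twist X Z z.1 z.2.1 (e.symm (e z.2.2)))) = _
    rw [e.left_inv hzs, heq]
  have h2 : u (z.1, 0, e z.2.2) = ℓ (e z.2.2) := by
    show ℓ (e (twist X Z z.1 0 (e.symm (e z.2.2)))) = _
    rw [e.left_inv hzs, twist_zero_right hX hZ]
  have h3 : ((z.1, z.2.1, e z.2.2) : ℝ × ℝ × Model m) - (z.1, 0, e z.2.2) =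
      z.2.1 • ((0, 1, 0) : ℝ × ℝ × Model m) := by
    ext <;> simp
  have h4 : ‖z.2.1 • ((0, 1, 0) : ℝ × ℝ × Model m)‖ = |z.2.1| := by
    rw [norm_smul, Prod.norm_def, Prod.norm_def]
    simp
  simp only [h1, h2, h3, h4, map_smul, hL2, sub_self, zero_sub, norm_neg, norm_smul,
    Real.norm_eq_abs, abs_two, one_mul] at hz
  have := abs_pos.2 hp
  linarith

/-- For small `s`, the maps `twist X Z s p` have no fixed points. -/
lemma eventually_forall_twist_ne (hX : SmoothVField X) (hZ : SmoothVField Z)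
    (ℓ : M → Model m →L[ℝ] ℝ) (hℓ : ∀ x, ℓ x (X x) = 1) {T : ℝ} (hT : ∀ x, flow X T x = x)
    (hne : ∀ t ∈ Ioo 0 T, ∀ x, flow X t x ≠ x)
    (hc : ∀ s x, flow X (T / 2) (flow Z s x) = flow Z s (flow X (T / 2) x)) :
    ∀ᶠ s in 𝓝 (0 : ℝ), ∀ p ∈ Ioo 0 (T / 2), ∀ x, twist X Z s p x ≠ x := by
  have hK : IsCompact (Icc 0 (T / 2) ×ˢ (univ : Set M)) := isCompact_Icc.prod isCompact_univ
  have key : ∀ᶠ s in 𝓝 (0 : ℝ), ∀ z ∈ Icc 0 (T / 2) ×ˢ (univ : Set M),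
      z.1 ≠ 0 → z.1 ≠ T / 2 → twist X Z s z.1 z.2 ≠ z.2 := by
    -- By compactness only a neighbourhood of each `(0, p, x)` matters: the displacement estimate at
    -- `p = 0`, its translate by the half period at `p = T / 2`, and openness of the condition of
    -- not being fixed in between.
    refine hK.eventually_forall_of_forall_eventually fun z hz => ?_
    obtain ⟨p, x⟩ := z
    rcases eq_or_ne p 0 with rfl | hp0
    · filter_upwards [eventually_twist_ne hX hZ (ℓ x) (hℓ x)] with w hw h0 _
      exact hw h0
    rcases eq_or_ne p (T / 2) with rfl | hpT
    · have hcont : ContinuousAt (fun w : ℝ × ℝ × M => (w.1, w.2.1 - T / 2, w.2.2))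
          (0, T / 2, x) := by fun_prop
      have h := hcont.tendsto
      simp only [sub_self] at h
      filter_upwards [h.eventually (eventually_twist_ne hX hZ (ℓ x) (hℓ x))] with w hw _ hT'
      have h2 := hw (sub_ne_zero.2 hT')
      rwa [twist_sub hX hT hc] at h2
    · have hcont := (contMDiff_twist hX hZ).continuous
      have hopen : IsOpen {w : ℝ × ℝ × M | twist X Z w.1 w.2.1 w.2.2 ≠ w.2.2} :=
        isOpen_ne_fun hcont (by fun_prop)
      have hmem : ((0 : ℝ), p, x) ∈ {w : ℝ × ℝ × M | twist X Z w.1 w.2.1 w.2.2 ≠ w.2.2} := by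
        show twist X Z 0 p x ≠ x
        rw [twist_zero_left hX hZ]
        have h1 := hz.1.1.lt_of_ne' hp0
        have h2 := hz.1.2.lt_of_ne hpT
        exact hne _ ⟨by linarith, by linarith⟩ x
      filter_upwards [hopen.mem_nhds hmem] with w hw _ _
      exact hw
  filter_upwards [key] with s hs p hp x
  exact hs (p, x) ⟨⟨hp.1.le, hp.2.le⟩, mem_univ x⟩ hp.1.ne' hp.2.ne

end Twist

/-! ### Zoll forms and functions invariant under the half period -/

section Zoll

open scoped Topology

variable {m : ℕ} {M : Type*} [TopologicalSpace M] [ChartedSpace (Model m) M]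
  [IsManifold (𝓡 (2 * m + 1)) ∞ M] [CompactSpace M] [T2Space M] {α : OneForm m M} {T : ℝ}

lemma IsZoll.flow_period (hα : IsContactForm α) (hZ : IsZoll α T) (x : M) :
    flow (reebField α) T x = x := by
  have h := (hZ.2 x).1.2 0
  simp only [zero_add] at h
  exact h.trans (hα.smoothVField_reebField.flow_zero x)

lemma IsZoll.flow_ne (hα : IsContactForm α) (hZ : IsZoll α T) {t : ℝ} (ht : t ∈ Ioo 0 T) (x : M) :
    flow (reebField α) t x ≠ x := by
  intro h
  refine absurd ((hZ.2 x).2 ⟨ht.1, fun τ => ?_⟩) (not_le.2 ht.2)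
  show flow (reebField α) (τ + t) x = flow (reebField α) τ x
  rw [hα.smoothVField_reebField.flow_add, h]

/-- There is a positive function, invariant under the half-period map, that is not constant along
the orbits of the Reeb flow. -/
lemma IsZoll.exists_invariant_function [Nonempty M] (hα : IsContactForm α) (hZ : IsZoll α T) :
    ∃ h : M → ℝ, ContMDiff (𝓡 (2 * m + 1)) 𝓘(ℝ, ℝ) ∞ h ∧ (∀ x, 0 < h x) ∧
      (∀ x, h (flow (reebField α) (T / 2) x) = h x) ∧ ∃ p, dFun h p (reebField α p) ≠ 0 := by
  have hX := hα.smoothVField_reebField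
  have hT := hZ.1
  set Φ := flow (reebField α) with hΦ
  let p : M := Classical.arbitrary M
  have hdist (a c : ℝ) (hac : c - a ∈ Ioo 0 T) : Φ c p ≠ Φ a p := by
    intro h
    have h2 : Φ (c - a) (Φ a p) = Φ a p := by
      rw [hΦ, ← hX.flow_add, sub_add_cancel]; exact h
    exact hZ.flow_ne hα hac _ h2
  have hdisj : Disjoint ({Φ (T / 4) p, Φ (3 * T / 4) p} : Set M) {Φ 0 p, Φ (T / 2) p} := by
    rw [Set.disjoint_left]
    rintro z (rfl | rfl) (h | h)
    · exact hdist 0 (T / 4) ⟨by linarith, by linarith⟩ h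
    · exact hdist (T / 4) (T / 2) ⟨by linarith, by linarith⟩ h.symm
    · exact hdist 0 (3 * T / 4) ⟨by linarith, by linarith⟩ h
    · exact hdist (T / 2) (3 * T / 4) ⟨by linarith, by linarith⟩ h
  -- The four points at times `0`, `T/4`, `T/2`, `3T/4` are distinct by minimality of the period.
  -- Adding to `f` its translate by the half period gives values `3` and `1` at times `0` and `T/4`,
  -- so the invariant function is not constant on this orbit.
  obtain ⟨f, hf0, hf1, hf01⟩ := exists_contMDiffMap_zero_one_of_isClosed (n := ⊤)
    (𝓡 (2 * m + 1)) (Set.toFinite _).isClosed (Set.toFinite _).isClosed hdisj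
  have hΦ2 (x : M) : Φ (T / 2) (Φ (T / 2) x) = x := by
    rw [hΦ, ← hX.flow_add, add_halves]; exact hZ.flow_period hα x
  have hsm : ContMDiff (𝓡 (2 * m + 1)) 𝓘(ℝ, ℝ) ∞ (fun x => 1 + f x + f (Φ (T / 2) x)) :=
    (contMDiff_const.add f.contMDiff).add (f.contMDiff.comp (hX.contMDiff_flow_const (T / 2)))
  refine ⟨fun x => 1 + f x + f (Φ (T / 2) x), hsm, fun x => ?_, fun x => ?_, ?_⟩
  · linarith [(hf01 x).1, (hf01 (Φ (T / 2) x)).1]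
  · simp only [hΦ2]
    ring
  · by_contra! hz
    let u : ℝ → ℝ := fun t => 1 + f (Φ t p) + f (Φ (T / 2) (Φ t p))
    have hu (t : ℝ) : HasDerivAt u 0 t :=
      ((hX.hasVelocity_flow t p).hasDerivAt_comp (hsm.mdifferentiableAt (by simp))).congr_deriv
        (hz _)
    have hconst : u 0 = u (T / 4) :=
      is_const_of_deriv_eq_zero (fun s => (hu s).differentiableAt) (fun s => (hu s).deriv) _ _
    have e1 : Φ (T / 2) (Φ 0 p) = Φ (T / 2) p := by rw [hΦ, hX.flow_zero]
    have e2 : Φ (T / 2) (Φ (T / 4) p) = Φ (3 * T / 4) p := by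
      rw [hΦ, ← hX.flow_add]; congr 1; ring
    simp only [u, e1, e2] at hconst
    have g1 : f (Φ 0 p) = 1 := hf1 (by simp)
    have g2 : f (Φ (T / 2) p) = 1 := hf1 (by simp)
    have g3 : f (Φ (T / 4) p) = 0 := hf0 (by simp)
    have g4 : f (Φ (3 * T / 4) p) = 0 := hf0 (by simp)
    rw [g1, g2, g3, g4] at hconst
    norm_num at hconst

/-- A diffeomorphism preserving a contact form commutes with its Reeb flow. -/
lemma IsContactForm.comm_flow (hα : IsContactForm α)
    (g : M ≃ₘ⟮𝓡 (2 * m + 1), 𝓡 (2 * m + 1)⟯ M) (hg : ContactLF.pullForm g α = α) (s : ℝ) (x : M) :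
    g (flow (reebField α) s x) = flow (reebField α) s (g x) := by
  have hX := hα.smoothVField_reebField
  have hγ : IsMIntegralCurve (I := 𝓡 (2 * m + 1)) (fun t => g (flow (reebField α) t x))
      (reebField α) := by
    intro t
    have h1 := (hX.hasVelocity_flow t x).comp (g.contMDiff.mdifferentiableAt (n := ∞) (by simp))
    have h2 := hα.mfderiv_reebField_pullForm g (flow (reebField α) t x)
    rw [hg] at h2
    have h3 : HasVelocity (fun t => g (flow (reebField α) t x))
        (reebField α (g (flow (reebField α) t x))) t := by
      rw [← h2]; exact h1
    exact h3
  have h := hX.eq_flow hγ s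
  simpa only [hX.flow_zero] using h

end Zoll

end ContactLF

namespace ContactLF

/-! ### The conformal factor and the volume inequality -/

section ConformalFactor

open scoped Topology

variable {m : ℕ} {M : Type*} [TopologicalSpace M] [ChartedSpace (Model m) M]

/-- The Reeb vector field of `α / h`. -/
noncomputable def rescaledReeb (α : OneForm m M) (h : M → ℝ) : VField m M :=
  reebField (smulForm (fun x => (h x)⁻¹) α)

/-- The function `F` such that the pull-back of `α` by the time `-s` of the Reeb flow of `α / h`
is `α / F`. -/
noncomputable def conformalFactor (α : OneForm m M) (h : M → ℝ) (s : ℝ) (x : M) : ℝ :=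
  h x / h (flow (rescaledReeb α h) (-s) x)

variable {α : OneForm m M} {h : M → ℝ}

lemma contMDiff_inv_of_pos (hh : ContMDiff (𝓡 (2 * m + 1)) 𝓘(ℝ, ℝ) ∞ h) (h0 : ∀ x, 0 < h x) :
    ContMDiff (𝓡 (2 * m + 1)) 𝓘(ℝ, ℝ) ∞ (fun x => (h x)⁻¹) :=
  fun x => (contDiffAt_inv ℝ (h0 x).ne').contMDiffAt.comp x (hh x)

lemma conformalFactor_pos (h0 : ∀ x, 0 < h x) (s : ℝ) (x : M) : 0 < conformalFactor α h s x :=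
  div_pos (h0 _) (h0 _)

variable [IsManifold (𝓡 (2 * m + 1)) ∞ M] (hα : IsContactForm α) (hh : ContMDiff (𝓡 (2 * m + 1)) 𝓘(ℝ, ℝ) ∞ h)
  (h0 : ∀ x, 0 < h x)

include hα hh h0

lemma isContactForm_rescaled : IsContactForm (smulForm (fun x => (h x)⁻¹) α) :=
  hα.smulForm (contMDiff_inv_of_pos hh h0) fun x => inv_ne_zero (h0 x).ne'

lemma smoothVField_rescaledReeb : SmoothVField (rescaledReeb α h) :=
  (isContactForm_rescaled hα hh h0).smoothVField_reebField

variable [CompactSpace M] [T2Space M]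

lemma conformalFactor_zero (x : M) : conformalFactor α h 0 x = 1 := by
  rw [conformalFactor, neg_zero, (smoothVField_rescaledReeb hα hh h0).flow_zero,
    div_self (h0 x).ne']

lemma contMDiff_conformalFactor :
    ContMDiff (𝓘(ℝ, ℝ).prod (𝓡 (2 * m + 1))) 𝓘(ℝ, ℝ) ∞
      (fun z : ℝ × M => conformalFactor α h z.1 z.2) := by
  have hns : ContMDiff (𝓘(ℝ, ℝ).prod (𝓡 (2 * m + 1))) 𝓘(ℝ, ℝ) ∞ (fun z : ℝ × M => -z.1) :=
    (contDiff_neg (𝕜 := ℝ) (F := ℝ)).contMDiff.comp contMDiff_fst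
  have h1 := (smoothVField_rescaledReeb hα hh h0).contMDiff_flow.comp (hns.prodMk contMDiff_snd)
  have h2 := (contMDiff_inv_of_pos hh h0).comp h1
  have h3 := (hh.comp (contMDiff_snd (I := 𝓘(ℝ, ℝ)) (M := ℝ))).mul h2
  exact h3

lemma contMDiff_conformalFactor_const (s : ℝ) :
    ContMDiff (𝓡 (2 * m + 1)) 𝓘(ℝ, ℝ) ∞ (conformalFactor α h s) :=
  (contMDiff_conformalFactor hα hh h0).comp (contMDiff_const.prodMk contMDiff_id)

/-- Write `α = h · (α / h)`: the flow preserves `α / h`, so only the factor `h` is transported. -/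
lemma pullForm_flow_rescaledReeb (s : ℝ) :
    pullForm (flow (rescaledReeb α h) (-s)) α =
      smulForm (fun x => (conformalFactor α h s x)⁻¹) α := by
  have h1 : α = smulForm h (smulForm (fun x => (h x)⁻¹) α) := by
    rw [smulForm_smulForm]
    simp only [mul_inv_cancel₀ (h0 _).ne', smulForm_one]
  have h2 : pullForm (flow (rescaledReeb α h) (-s)) (smulForm (fun x => (h x)⁻¹) α) =
      smulForm (fun x => (h x)⁻¹) α := (isContactForm_rescaled hα hh h0).pullForm_flow (-s)
  rw [show pullForm (flow (rescaledReeb α h) (-s)) α = _ from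
    congrArg (pullForm (flow (rescaledReeb α h) (-s))) h1, pullForm_smulForm, h2, smulForm_smulForm]
  congr 1
  funext x
  rw [conformalFactor, inv_div, div_eq_mul_inv]

/-- At `p` the derivative of `h` along the Reeb field of `α / h` is `h(p)` times its derivative
along that of `α`, hence nonzero; so `h` leaves its initial value for small nonzero times. -/
lemma eventually_conformalFactor_ne {p : M} (hp : dFun h p (reebField α p) ≠ 0) :
    ∀ᶠ s in 𝓝[≠] (0 : ℝ), conformalFactor α h s p ≠ 1 := by
  have hZ := smoothVField_rescaledReeb hα hh h0
  have h1 : HasDerivAt (fun t => h (flow (rescaledReeb α h) t p))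
      (dFun h p (rescaledReeb α h p)) 0 := by
    have h2 := (hZ.hasVelocity_flow 0 p).hasDerivAt_comp (hh.mdifferentiableAt (by simp))
    have h3 : ∀ z, z = p → dFun h z (rescaledReeb α h z) = dFun h p (rescaledReeb α h p) := by
      rintro z rfl; rfl
    exact h2.congr_deriv (h3 _ (hZ.flow_zero p))
  have h4 : HasDerivAt (fun s => h (flow (rescaledReeb α h) (-s) p))
      (-dFun h p (rescaledReeb α h p)) 0 := by
    have h5 := HasDerivAt.comp_of_eq (h := fun s : ℝ => -s) (0 : ℝ) h1 (hasDerivAt_neg 0)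
      neg_zero.symm
    exact h5.congr_deriv (by ring)
  have h6 : dFun h p (rescaledReeb α h p) ≠ 0 := by
    rw [rescaledReeb, (hα.dBilin_reebField_smulForm_inv hh h0 p).2.1]
    exact mul_ne_zero (h0 p).ne' hp
  filter_upwards [h4.eventually_ne (c := h p) (neg_ne_zero.2 h6)] with s hs hs1
  rw [conformalFactor, div_eq_one_iff_eq (h0 _).ne'] at hs1
  exact hs hs1.symm

/-- The integral of `(1 + F)⁻ⁿ`, where `F` is the conformal factor, depends smoothly on `s`. -/
lemma contDiff_volInt_conformalFactor :
    ContDiff ℝ ∞ (fun s => volInt α (fun x => ((1 + conformalFactor α h s x)⁻¹) ^ (m + 1))) := by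
  refine contDiff_volInt hα.1 fun z => ?_
  have hF := contMDiff_conformalFactor hα hh h0 z
  have h1 : ContDiffAt ℝ ∞ (fun r : ℝ => ((1 + r)⁻¹) ^ (m + 1)) (conformalFactor α h z.1 z.2) :=
    ((contDiffAt_const.add contDiffAt_id).inv
      (add_pos one_pos (conformalFactor_pos h0 z.1 z.2)).ne').pow _
  exact h1.contMDiffAt.comp z hF

omit hα hh h0 in
-- The harmonic mean of `1` and `F⁻¹` is at most their arithmetic mean, with difference `(F - 1)² /
-- (2F(1 + F))`, and the power of the mean is at most the mean of the powers. Strictness comes from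
-- the first step, so it also holds for `m = 0`.
lemma inv_pow_le {F : ℝ} (hF : 0 < F) (m : ℕ) :
    2 ^ (m + 1) * ((1 + F)⁻¹) ^ (m + 1) ≤ (1 + (F⁻¹) ^ (m + 1)) / 2 ∧
    (F ≠ 1 → 2 ^ (m + 1) * ((1 + F)⁻¹) ^ (m + 1) < (1 + (F⁻¹) ^ (m + 1)) / 2) := by
  have hF1 : 0 < 1 + F := by linarith
  have h1 : ((1 + F⁻¹) / 2) ^ (m + 1) ≤ (1 + (F⁻¹) ^ (m + 1)) / 2 := by
    have h2 := add_pow_le zero_le_one (inv_pos.2 hF).le (m + 1)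
    rw [one_pow, Nat.add_sub_cancel] at h2
    rw [div_pow, div_le_div_iff₀ (by positivity) two_pos]
    calc (1 + F⁻¹) ^ (m + 1) * 2 ≤ 2 ^ m * (1 + F⁻¹ ^ (m + 1)) * 2 := by gcongr
      _ = (1 + F⁻¹ ^ (m + 1)) * 2 ^ (m + 1) := by ring
  have h3 : 2 * (1 + F)⁻¹ ≤ (1 + F⁻¹) / 2 := by
    rw [← sub_nonneg]
    have : (1 + F⁻¹) / 2 - 2 * (1 + F)⁻¹ = (F - 1) ^ 2 / (2 * F * (1 + F)) := by
      field_simp; ring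
    rw [this]; positivity
  have h4 : 0 ≤ 2 * (1 + F)⁻¹ := by positivity
  rw [← mul_pow]
  refine ⟨(pow_le_pow_left₀ h4 h3 _).trans h1, fun hne => ?_⟩
  have h5 : 2 * (1 + F)⁻¹ < (1 + F⁻¹) / 2 := by
    rw [← sub_pos]
    have : (1 + F⁻¹) / 2 - 2 * (1 + F)⁻¹ = (F - 1) ^ 2 / (2 * F * (1 + F)) := by
      field_simp; ring
    rw [this]
    have := sub_ne_zero.2 hne
    positivity
  exact (pow_lt_pow_left₀ h5 h4 (Nat.succ_ne_zero m)).trans_le h1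

/-- The left side is the volume of the pull-back of `α` by a diffeomorphism. -/
lemma volInt_conformalFactor_inv_pow (s : ℝ) :
    volInt α (fun x => ((conformalFactor α h s x)⁻¹) ^ (m + 1)) = contactVolume α := by
  have hF := contMDiff_conformalFactor_const hα hh h0 s
  have h1 := contactVolume_smulForm hα.1
    (contMDiff_inv_of_pos hF fun x => conformalFactor_pos h0 s x)
  rw [← pullForm_flow_rescaledReeb hα hh h0 s] at h1
  have h2 := contactVolume_pullForm hα.1 ((smoothVField_rescaledReeb hα hh h0).flowDiffeo (-s))
  have h3 : contactVolume (pullForm (flow (rescaledReeb α h) (-s)) α) = contactVolume α := h2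
  rw [← h3, h1]
  congr 1
  funext x
  rw [abs_of_pos (inv_pos.2 (conformalFactor_pos h0 s x))]

/-- Integrating the pointwise inequality, with `F⁻ⁿ` and `1` having the same integral, bounds the
left side by the volume; strictness at the single point `p` suffices by continuity. -/
lemma volInt_conformalFactor_lt {s : ℝ} {p : M} (hp : conformalFactor α h s p ≠ 1) :
    2 ^ (m + 1) * volInt α (fun x => ((1 + conformalFactor α h s x)⁻¹) ^ (m + 1)) <
      contactVolume α := by
  have hF := (contMDiff_conformalFactor_const hα hh h0 s).continuous
  have hpos := fun x => conformalFactor_pos (α := α) h0 s x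
  have hc1 : Continuous fun x => ((1 + conformalFactor α h s x)⁻¹) ^ (m + 1) :=
    ((continuous_const.add hF).inv₀ fun x => (add_pos one_pos (hpos x)).ne').pow _
  have hc2 : Continuous fun x => ((conformalFactor α h s x)⁻¹) ^ (m + 1) :=
    (hF.inv₀ fun x => (hpos x).ne').pow _
  have h1 := volInt_lt hα (continuous_const.mul hc1) (continuous_const.mul
    (continuous_const.add hc2)) (k := fun x => 2 ^ (m + 1) *
      ((1 + conformalFactor α h s x)⁻¹) ^ (m + 1)) (l := fun x => 2⁻¹ *
        (1 + ((conformalFactor α h s x)⁻¹) ^ (m + 1))) (fun x => by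
      have := (inv_pow_le (hpos x) m).1
      rw [div_eq_inv_mul] at this
      exact this) (p := p) (by
      have := (inv_pow_le (hpos p) m).2 hp
      rw [div_eq_inv_mul] at this
      exact this)
  rw [volInt_const_mul, volInt_const_mul, volInt_add hα.1 continuous_const hc2,
    ← contactVolume_eq_volInt, volInt_conformalFactor_inv_pow hα hh h0] at h1
  linarith

lemma volInt_conformalFactor_pos [Nonempty M] (s : ℝ) :
    0 < volInt α (fun x => ((1 + conformalFactor α h s x)⁻¹) ^ (m + 1)) := by
  have hF := (contMDiff_conformalFactor_const hα hh h0 s).continuous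
  have hpos := fun x => conformalFactor_pos (α := α) h0 s x
  have hp1 := fun x => add_pos one_pos (hpos x)
  exact volInt_pos hα (((continuous_const.add hF).inv₀ fun x => (hp1 x).ne').pow _)
    (fun x => (pow_pos (inv_pos.2 (hp1 x)) _).le) (p := Classical.arbitrary M)
    (pow_pos (inv_pos.2 (hp1 _)) _)

end ConformalFactor

/-! ### The speed that normalizes the volume -/

section Speed

open scoped Topology

variable {m : ℕ} {M : Type*} [TopologicalSpace M] [ChartedSpace (Model m) M]
  [IsManifold (𝓡 (2 * m + 1)) ∞ M] [CompactSpace M] [T2Space M]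

/-- The speed for which the twisted path has the length of the Reeb flow. -/
noncomputable def speed (α : OneForm m M) (h : M → ℝ) (s : ℝ) : ℝ :=
  (volInt α (fun x => ((1 + conformalFactor α h s x)⁻¹) ^ (m + 1)) / contactVolume α) ^
    (1 / ((m : ℝ) + 1))

variable [Nonempty M] {α : OneForm m M} {h : M → ℝ} (hα : IsContactForm α)
  (hh : ContMDiff (𝓡 (2 * m + 1)) 𝓘(ℝ, ℝ) ∞ h) (h0 : ∀ x, 0 < h x)

include hα hh h0

lemma ratio_pos (s : ℝ) : 0 < volInt α (fun x =>
    ((1 + conformalFactor α h s x)⁻¹) ^ (m + 1)) / contactVolume α :=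
  div_pos (volInt_conformalFactor_pos hα hh h0 s) (contactVolume_pos hα)

lemma speed_pos (s : ℝ) : 0 < speed α h s := Real.rpow_pos_of_pos (ratio_pos hα hh h0 s) _

lemma speed_pow (s : ℝ) : speed α h s ^ (m + 1) = volInt α (fun x =>
    ((1 + conformalFactor α h s x)⁻¹) ^ (m + 1)) / contactVolume α := by
  rw [speed, ← Real.rpow_natCast, ← Real.rpow_mul (ratio_pos hα hh h0 s).le]
  have : (1 / ((m : ℝ) + 1)) * ((m + 1 : ℕ) : ℝ) = 1 := by
    push_cast
    have : (m : ℝ) + 1 ≠ 0 := by positivity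
    field_simp
  rw [this, Real.rpow_one]

lemma contDiff_speed : ContDiff ℝ ∞ (speed α h) := by
  rw [contDiff_iff_contDiffAt]
  intro s
  exact ((contDiff_volInt_conformalFactor hα hh h0).div_const _).contDiffAt.rpow_const_of_ne
    (ratio_pos hα hh h0 s).ne'

lemma speed_zero : speed α h 0 = 1 / 2 := by
  have h1 : volInt α (fun x => ((1 + conformalFactor α h 0 x)⁻¹) ^ (m + 1)) =
      (1 / 2) ^ (m + 1) * contactVolume α := by
    rw [contactVolume_eq_volInt, ← volInt_const_mul]
    congr 1
    funext x
    rw [conformalFactor_zero hα hh h0]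
    norm_num
  have h2 : speed α h 0 ^ (m + 1) = (1 / 2) ^ (m + 1) := by
    rw [speed_pow hα hh h0, h1, mul_div_cancel_right₀ _ (contactVolume_pos hα).ne']
  exact (pow_left_inj₀ (speed_pos hα hh h0 0).le (by norm_num) (Nat.succ_ne_zero m)).1 h2

/-- This is the decisive gain: up to time `T₀` the parameter of the twisted path stays strictly
below the half period. -/
lemma speed_lt {s : ℝ} {p : M} (hp : conformalFactor α h s p ≠ 1) : speed α h s < 1 / 2 := by
  refine lt_of_pow_lt_pow_left₀ (m + 1) (by norm_num) ?_
  rw [speed_pow hα hh h0, div_lt_iff₀ (contactVolume_pos hα), one_div, inv_pow]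
  have h1 := volInt_conformalFactor_lt hα hh h0 hp
  rw [← div_eq_inv_mul, lt_div_iff₀ (by positivity)]
  linarith

/-- The form `α / (b (1 + F))`, where `b` is the speed and `F` the conformal factor, has the volume
of `α`. -/
lemma contactVolume_speed (s : ℝ) : contactVolume (smulForm (fun x =>
    (speed α h s * (1 + conformalFactor α h s x))⁻¹) α) = contactVolume α := by
  have hb := speed_pos hα hh h0 s
  have hpos := fun x => conformalFactor_pos (α := α) h0 s x
  have hk : ContMDiff (𝓡 (2 * m + 1)) 𝓘(ℝ, ℝ) ∞
      (fun x => speed α h s * (1 + conformalFactor α h s x)) :=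
    contMDiff_const.mul (contMDiff_const.add (contMDiff_conformalFactor_const hα hh h0 s))
  have hkp (x : M) : 0 < speed α h s * (1 + conformalFactor α h s x) :=
    mul_pos hb (add_pos one_pos (hpos x))
  rw [contactVolume_smulForm hα.1 (contMDiff_inv_of_pos hk hkp)]
  have h1 : (fun x => |(speed α h s * (1 + conformalFactor α h s x))⁻¹| ^ (m + 1)) = fun x =>
      (speed α h s ^ (m + 1))⁻¹ * ((1 + conformalFactor α h s x)⁻¹) ^ (m + 1) := by
    funext x
    rw [abs_of_pos (inv_pos.2 (hkp x)), mul_inv, mul_pow, inv_pow (speed α h s)]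
  rw [h1, volInt_const_mul, speed_pow hα hh h0, inv_div, div_mul_cancel₀]
  exact (volInt_conformalFactor_pos hα hh h0 s).ne'

end Speed

end ContactLF

namespace ContactLF

/-! ### The contact forms generating the twisted path -/

section TwistedPath

variable {m : ℕ} {M : Type*} [TopologicalSpace M] [ChartedSpace (Model m) M]
  [IsManifold (𝓡 (2 * m + 1)) ∞ M] [CompactSpace M] [T2Space M]

lemma SmoothVField.mdifferentiable_flow {X : VField m M} (hX : SmoothVField X) (t : ℝ) :
    MDifferentiable (𝓡 (2 * m + 1)) (𝓡 (2 * m + 1)) (flow X t) :=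
  (hX.contMDiff_flow_const t).mdifferentiable (by simp)

lemma SmoothVField.pullForm_flow_pullForm_flow_neg {X : VField m M} (hX : SmoothVField X) (t : ℝ)
    (β : OneForm m M) : pullForm (flow X t) (pullForm (flow X (-t)) β) = β := by
  rw [pullForm_comp β (hX.mdifferentiable_flow (-t)) (hX.mdifferentiable_flow t)]
  have h : (fun x => flow X (-t) (flow X t x)) = id := funext (hX.flow_neg_flow t)
  rw [h]
  funext x
  refine ContinuousLinearMap.ext fun v => ?_
  exact congrArg (formAt β x) (congrArg (fun L : Model m →L[ℝ] Model m => L v) mfderiv_id)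

lemma IsContactForm.der_flow_reebField {α : OneForm m M} (hα : IsContactForm α) (t : ℝ) (x : M) :
    der (flow (reebField α) t) x (vecAt (reebField α) x) =
      vecAt (reebField α) (flow (reebField α) t x) := by
  have h := hα.mfderiv_reebField_pullForm (hα.smoothVField_reebField.flowDiffeo t) x
  have h2 : ContactLF.pullForm (hα.smoothVField_reebField.flowDiffeo t) α = α := hα.pullForm_flow t
  rw [h2] at h
  exact h

variable {α : OneForm m M} {h : M → ℝ} (hα : IsContactForm α)
  (hh : ContMDiff (𝓡 (2 * m + 1)) 𝓘(ℝ, ℝ) ∞ h) (h0 : ∀ x, 0 < h x)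

include hα hh h0

lemma isContactForm_conformalFactor (s : ℝ) :
    IsContactForm (smulForm (fun x => (conformalFactor α h s x)⁻¹) α) :=
  hα.smulForm (contMDiff_inv_of_pos (contMDiff_conformalFactor_const hα hh h0 s)
    fun x => conformalFactor_pos h0 s x) fun x => inv_ne_zero (conformalFactor_pos h0 s x).ne'

/-- The flow of `α / h` at time `s` pulls `α / F` back to `α`, so it carries the one Reeb field to
the other. -/
lemma der_flow_rescaledReeb (s : ℝ) (x : M) :
    der (flow (rescaledReeb α h) s) x (vecAt (reebField α) x) =
      vecAt (reebField (smulForm (fun x => (conformalFactor α h s x)⁻¹) α))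
        (flow (rescaledReeb α h) s x) := by
  have hZ := smoothVField_rescaledReeb hα hh h0
  have h1 := (isContactForm_conformalFactor hα hh h0 s).mfderiv_reebField_pullForm
    (hZ.flowDiffeo s) x
  have h2 : pullForm (hZ.flowDiffeo s) (smulForm (fun x => (conformalFactor α h s x)⁻¹) α) = α := by
    rw [← pullForm_flow_rescaledReeb hα hh h0 s]
    exact hZ.pullForm_flow_pullForm_flow_neg s α
  rw [h2] at h1
  exact h1

omit hα hh h0 in
/-- The contact form whose Reeb vector field generates the twisted path at time `t`. -/
noncomputable def twistForm (α : OneForm m M) (h : M → ℝ) (s t : ℝ) : OneForm m M :=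
  pullForm (flow (reebField α) (-(speed α h s * t)))
    (smulForm (fun x => (speed α h s * (1 + conformalFactor α h s x))⁻¹) α)

variable [Nonempty M]

lemma contMDiff_twistFactor (s : ℝ) : ContMDiff (𝓡 (2 * m + 1)) 𝓘(ℝ, ℝ) ∞
    (fun x => (speed α h s * (1 + conformalFactor α h s x))⁻¹) :=
  contMDiff_inv_of_pos
    (contMDiff_const.mul (contMDiff_const.add (contMDiff_conformalFactor_const hα hh h0 s)))
    fun x => mul_pos (speed_pos hα hh h0 s) (add_pos one_pos (conformalFactor_pos h0 s x))

lemma twistFactor_pos (s : ℝ) (x : M) : 0 < (speed α h s * (1 + conformalFactor α h s x))⁻¹ :=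
  inv_pos.2 (mul_pos (speed_pos hα hh h0 s) (add_pos one_pos (conformalFactor_pos h0 s x)))

lemma isContactForm_twistForm (s t : ℝ) : IsContactForm (twistForm α h s t) :=
  (hα.smulForm (contMDiff_twistFactor hα hh h0 s)
    fun x => (twistFactor_pos hα hh h0 s x).ne').pullForm
      (hα.smoothVField_reebField.flowDiffeo (-(speed α h s * t)))

lemma contactVolume_twistForm (s t : ℝ) : contactVolume (twistForm α h s t) = contactVolume α := by
  rw [← contactVolume_speed hα hh h0 s]
  exact contactVolume_pullForm (hα.smulForm (contMDiff_twistFactor hα hh h0 s)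
    fun x => (twistFactor_pos hα hh h0 s x).ne').1
      (hα.smoothVField_reebField.flowDiffeo (-(speed α h s * t)))

/-- With `w` the point reached before the last Reeb flow, the velocity is the push-forward under
that flow of `b` times the sum at `w` of the Reeb fields of `α` and `α / F`: the outer flow
preserves its own generator, and the inner velocity is transported by `ζ^s`. This sum is the Reeb
field of `α / (b (1 + F))`. -/
lemma hasVelocity_twist (s t : ℝ) (x : M) :
    HasVelocity (fun τ => twist (reebField α) (rescaledReeb α h) s (speed α h s * τ) x)
      (vecAt (reebField (twistForm α h s t))
        (twist (reebField α) (rescaledReeb α h) s (speed α h s * t) x)) t := by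
  have hX := hα.smoothVField_reebField
  have hZ := smoothVField_rescaledReeb hα hh h0
  set b := speed α h s with hb
  have h1 : HasVelocity (fun τ => flow (reebField α) (b * τ) (flow (rescaledReeb α h) (-s) x))
      (b • vecAt (reebField α) (flow (reebField α) (b * t) (flow (rescaledReeb α h) (-s) x))) t :=
    (hX.hasVelocity_flow _ _).comp_mul
  have h2 := h1.comp (hZ.mdifferentiable_flow s _)
  have h3 := hX.hasVelocity_flow_comp (b := b) h2
  rw [twist]
  set u := flow (reebField α) (b * t) (flow (rescaledReeb α h) (-s) x) with hu
  set w := flow (rescaledReeb α h) s u with hw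
  have h4 : vecAt (reebField (twistForm α h s t)) (flow (reebField α) (b * t) w) =
      der (flow (reebField α) (b * t)) w (vecAt (reebField
        (smulForm (fun x => (b * (1 + conformalFactor α h s x))⁻¹) α)) w) := by
    have h5 := (isContactForm_twistForm hα hh h0 s t).mfderiv_reebField_pullForm
      (hX.flowDiffeo (b * t)) w
    have h6 : pullForm (hX.flowDiffeo (b * t)) (twistForm α h s t) =
        smulForm (fun x => (b * (1 + conformalFactor α h s x))⁻¹) α :=
      hX.pullForm_flow_pullForm_flow_neg (b * t) _
    rw [h6] at h5
    exact h5.symm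
  have h7 : vecAt (reebField (smulForm (fun x => (b * (1 + conformalFactor α h s x))⁻¹) α)) w =
      b • (vecAt (reebField α) w + der (flow (rescaledReeb α h) s) u (vecAt (reebField α) u)) := by
    rw [der_flow_rescaledReeb hα hh h0]
    exact hα.reebField_smulForm_add (contMDiff_conformalFactor_const hα hh h0 s)
      (conformalFactor_pos h0 s) (speed_pos hα hh h0 s) w
  rw [h4, h7, map_smul, map_add, hα.der_flow_reebField, smul_add]
  have h8 : der (flow (reebField α) (b * t)) w (der (flow (rescaledReeb α h) s) u
      (b • vecAt (reebField α) u)) = b • der (flow (reebField α) (b * t)) w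
        (der (flow (rescaledReeb α h) s) u (vecAt (reebField α) u)) := by
    rw [map_smul, map_smul]
  rw [← h8]
  exact h3

end TwistedPath

/-! ### The deformation by contactomorphisms -/

section Contactomorphisms

variable {m : ℕ} {M : Type*} [TopologicalSpace M] [ChartedSpace (Model m) M]
  [IsManifold (𝓡 (2 * m + 1)) ∞ M] [CompactSpace M] [T2Space M]

/-- The map `twist X Z s p`, as a diffeomorphism. -/
noncomputable def twistDiffeo {X Z : VField m M} (hX : SmoothVField X) (hZ : SmoothVField Z)
    (s p : ℝ) : M ≃ₘ⟮𝓡 (2 * m + 1), 𝓡 (2 * m + 1)⟯ M :=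
  (((hZ.flowDiffeo (-s)).trans (hX.flowDiffeo p)).trans (hZ.flowDiffeo s)).trans (hX.flowDiffeo p)

variable {ξ : ContactStructure m M}

/-- The map `twist X Z s p`, as a contactomorphism, for contact vector fields `X` and `Z`. -/
noncomputable def twistCont {X Z : VField m M} (hX : ξ.IsContactVField X)
    (hZ : ξ.IsContactVField Z) (s p : ℝ) : ξ.Cont :=
  ⟨twistDiffeo hX.1 hZ.1 s p, by
    have dX := hX.1.mdifferentiable_flow p
    have dZ := hZ.1.mdifferentiable_flow
    have h1 := (hX.2 p).comp (hZ.2 (-s)) dX (dZ (-s))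
    have d1 := dX.comp (dZ (-s))
    have h2 := (hZ.2 s).comp h1 (dZ s) d1
    exact (hX.2 p).comp h2 dX ((dZ s).comp d1)⟩

lemma twistCont_apply {X Z : VField m M} (hX : ξ.IsContactVField X)
    (hZ : ξ.IsContactVField Z) (s p : ℝ) (x : M) : twistCont hX hZ s p x = twist X Z s p x := rfl

variable {α : OneForm m M} {h : M → ℝ}

lemma ContactStructure.IsDefiningForm.isContactVField_rescaledReeb (hα : ξ.IsDefiningForm α)
    (hh : ContMDiff (𝓡 (2 * m + 1)) 𝓘(ℝ, ℝ) ∞ h) (h0 : ∀ x, 0 < h x) :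
    ξ.IsContactVField (rescaledReeb α h) :=
  (hα.smulForm (contMDiff_inv_of_pos hh h0) fun x => inv_pos.2 (h0 x)).isPositiveContactVField.1

lemma ContactStructure.IsDefiningForm.twistForm [Nonempty M] (hα : ξ.IsDefiningForm α)
    (hh : ContMDiff (𝓡 (2 * m + 1)) 𝓘(ℝ, ℝ) ∞ h) (h0 : ∀ x, 0 < h x) (s t : ℝ) :
    ξ.IsDefiningForm (ContactLF.twistForm α h s t) :=
  (hα.smulForm (contMDiff_twistFactor hα.1 hh h0 s) (twistFactor_pos hα.1 hh h0 s)).pullForm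
    (hα.1.smoothVField_reebField.flowDiffeo (-(speed α h s * t)))
    (hα.isPositiveContactVField.1.2 (-(speed α h s * t)))

lemma generator_twistCont [Nonempty M] (hα : ξ.IsDefiningForm α)
    (hh : ContMDiff (𝓡 (2 * m + 1)) 𝓘(ℝ, ℝ) ∞ h) (h0 : ∀ x, 0 < h x) {T t : ℝ} (hT : 0 < T)
    (ht : t ∈ Icc 0 T) (s : ℝ) :
    generator T (fun τ => twistCont hα.isPositiveContactVField.1
      (hα.isContactVField_rescaledReeb hh h0) s (speed α h s * τ)) t =
        reebField (twistForm α h s t) :=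
  generator_eq hT ht (twistDiffeo hα.1.smoothVField_reebField
    (smoothVField_rescaledReeb hα.1 hh h0) s (speed α h s * t)).surjective fun x =>
    hasVelocity_twist hα.1 hh h0 s t x

lemma generator_reebFlow (hα : IsContactForm α) {T t : ℝ} (hT : 0 < T) (ht : t ∈ Icc 0 T) :
    generator T (reebFlow α) t = reebField α :=
  generator_eq hT ht (hα.smoothVField_reebField.flowDiffeo t).surjective fun x =>
    hα.smoothVField_reebField.hasVelocity_flow t x

/-- If `h` is invariant, the time-`t` Reeb flow of `α` preserves `α / h`, hence commutes with its
Reeb flow. The half period is the case in which it is applied. -/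
lemma rescaledReeb_comm (hα : IsContactForm α) (hh : ContMDiff (𝓡 (2 * m + 1)) 𝓘(ℝ, ℝ) ∞ h)
    (h0 : ∀ x, 0 < h x) {t : ℝ} (hi : ∀ x, h (flow (reebField α) t x) = h x) (s : ℝ) (x : M) :
    flow (reebField α) t (flow (rescaledReeb α h) s x) =
      flow (rescaledReeb α h) s (flow (reebField α) t x) := by
  refine (isContactForm_rescaled hα hh h0).comm_flow
    (hα.smoothVField_reebField.flowDiffeo t) ?_ s x
  have h1 : pullForm (flow (reebField α) t) (smulForm (fun x => (h x)⁻¹) α) =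
      smulForm (fun x => (h x)⁻¹) α := by
    rw [pullForm_smulForm, hα.pullForm_flow t]
    simp only [hi]
  exact h1

/-- The Reeb flow of a Zoll contact form is deformed through positive paths of the same length that
have no fixed points. -/
lemma exists_family_of_nonempty [Nonempty M] {α₀ : OneForm m M} (hα₀ : ξ.IsDefiningForm α₀)
    {T₀ : ℝ} (hZoll : IsZoll α₀ T₀) :
    ∃ ε : ℝ, 0 < ε ∧ ∃ φ : ℝ → ℝ → ξ.Cont,
      ContMDiffOn (𝓘(ℝ, ℝ).prod (𝓘(ℝ, ℝ).prod (𝓡 (2 * m + 1)))) (𝓡 (2 * m + 1)) ∞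
        (fun p : ℝ × ℝ × M => φ p.1 p.2.1 p.2.2)
        (Set.Ioo (-ε) ε ×ˢ (Set.Icc 0 T₀ ×ˢ Set.univ)) ∧
      (∀ s ∈ Set.Ioo (-ε) ε, ξ.IsPositivePath T₀ (φ s)) ∧
      (∀ t ∈ Set.Icc 0 T₀, ∀ x : M, φ 0 t x = reebFlow α₀ t x) ∧
      (∀ s ∈ Set.Ioo (-ε) ε, ∀ x : M, φ s 0 x = x) ∧
      (∀ s ∈ Set.Ioo (-ε) ε,
        ξ.lengthV T₀ (fun t => φ s t) = ξ.lengthV T₀ (reebFlow α₀)) ∧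
      (∀ s ∈ Set.Ioo (-ε) ε, s ≠ 0 → ∀ t ∈ Set.Ioc 0 T₀, ∀ x : M, φ s t x ≠ x) := by
  have hα := hα₀.1
  have hT := hZoll.1
  obtain ⟨h, hh, h0, hi, p, hp⟩ := hZoll.exists_invariant_function hα
  have hX := hα.smoothVField_reebField
  have hZ := smoothVField_rescaledReeb hα hh h0
  have hne := eventually_forall_twist_ne hX hZ (fun x => formAt α₀ x)
    (fun x => (hα.isReebVector_reebField x).1) (hZoll.flow_period hα)
    (fun t ht x => hZoll.flow_ne hα ht x) (rescaledReeb_comm hα hh h0 hi)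
  have hF := eventually_nhdsWithin_iff.1 (eventually_conformalFactor_ne hα hh h0 hp)
  -- One radius for both requirements: absence of fixed points for parameters in `(0, T₀ / 2)`, and
  -- a nontrivial conformal factor at `p` when `s ≠ 0`.
  obtain ⟨ε, hε, hball⟩ := Metric.eventually_nhds_iff_ball.1 (hne.and hF)
  refine ⟨ε, hε, fun s t => twistCont hα₀.isPositiveContactVField.1
    (hα₀.isContactVField_rescaledReeb hh h0) s (speed α₀ h s * t), ?_, ?_, ?_, ?_, ?_, ?_⟩
  · have hs : ContMDiff (𝓘(ℝ, ℝ).prod (𝓘(ℝ, ℝ).prod (𝓡 (2 * m + 1)))) 𝓘(ℝ, ℝ) ∞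
        (fun z : ℝ × ℝ × M => z.1) := contMDiff_fst
    have hp : ContMDiff (𝓘(ℝ, ℝ).prod (𝓘(ℝ, ℝ).prod (𝓡 (2 * m + 1)))) 𝓘(ℝ, ℝ) ∞
        (fun z : ℝ × ℝ × M => speed α₀ h z.1 * z.2.1) :=
      ((contDiff_speed hα hh h0).contMDiff.comp hs).mul (contMDiff_fst.comp contMDiff_snd)
    have hx : ContMDiff (𝓘(ℝ, ℝ).prod (𝓘(ℝ, ℝ).prod (𝓡 (2 * m + 1)))) (𝓡 (2 * m + 1)) ∞
        (fun z : ℝ × ℝ × M => z.2.2) := contMDiff_snd.comp contMDiff_snd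
    exact ((contMDiff_twist hX hZ).comp (hs.prodMk (hp.prodMk hx))).contMDiffOn
  · intro s _ t ht
    rw [generator_twistCont hα₀ hh h0 hT ht]
    exact (hα₀.twistForm hh h0 s t).isPositiveContactVField
  · intro t _ x
    rw [twistCont_apply, twist_zero_left hX hZ, speed_zero hα hh h0, reebFlow]
    congr 1
    ring
  · intro s _ x
    rw [twistCont_apply, mul_zero, twist_zero_right hX hZ]
  · intro s _
    -- The lengths agree because at each time the generating contact form has the same volume as
    -- `α₀`.
    refine intervalIntegral.integral_congr fun t ht => ?_
    rw [uIcc_of_le hT.le] at ht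
    show ξ.V _ = ξ.V _
    rw [generator_twistCont hα₀ hh h0 hT ht, generator_reebFlow hα hT ht,
      (hα₀.twistForm hh h0 s t).V_reebField, hα₀.V_reebField, contactVolume_twistForm hα hh h0]
  · intro s hs hs0 t ht x
    have hsb : s ∈ Metric.ball (0 : ℝ) ε := by
      rw [Real.ball_eq_Ioo, zero_sub, zero_add]; exact hs
    obtain ⟨h1, h2⟩ := hball s hsb
    have hlt := speed_lt hα hh h0 (h2 hs0)
    have hpos := speed_pos hα hh h0 s
    rw [twistCont_apply]
    refine h1 _ ⟨mul_pos hpos ht.1, ?_⟩ x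
    calc speed α₀ h s * t ≤ speed α₀ h s * T₀ := by gcongr; exact ht.2
      _ < 1 / 2 * T₀ := by gcongr
      _ = T₀ / 2 := by ring

end Contactomorphisms

end ContactLF
theorem mainTheorem8 (m : ℕ) (M : Type*) [TopologicalSpace M]
    [ChartedSpace (ContactLF.Model m) M] [IsManifold (𝓡 (2 * m + 1)) ∞ M]
    [CompactSpace M] [T2Space M]
    (ξ : ContactLF.ContactStructure m M) (α₀ : ContactLF.OneForm m M)
    (hα₀ : ξ.IsDefiningForm α₀) (T₀ : ℝ) (hZoll : ContactLF.IsZoll α₀ T₀) :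
    ∃ ε : ℝ, 0 < ε ∧ ∃ φ : ℝ → ℝ → ξ.Cont,
      ContMDiffOn (𝓘(ℝ, ℝ).prod (𝓘(ℝ, ℝ).prod (𝓡 (2 * m + 1)))) (𝓡 (2 * m + 1)) ∞
        (fun p : ℝ × ℝ × M => φ p.1 p.2.1 p.2.2)
        (Set.Ioo (-ε) ε ×ˢ (Set.Icc 0 T₀ ×ˢ Set.univ)) ∧
      (∀ s ∈ Set.Ioo (-ε) ε, ξ.IsPositivePath T₀ (φ s)) ∧
      (∀ t ∈ Set.Icc 0 T₀, ∀ x : M, φ 0 t x = ContactLF.reebFlow α₀ t x) ∧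
      (∀ s ∈ Set.Ioo (-ε) ε, ∀ x : M, φ s 0 x = x) ∧
      (∀ s ∈ Set.Ioo (-ε) ε,
        ξ.lengthV T₀ (fun t => φ s t) = ξ.lengthV T₀ (ContactLF.reebFlow α₀)) ∧
      (∀ s ∈ Set.Ioo (-ε) ε, s ≠ 0 → ∀ t ∈ Set.Ioc 0 T₀, ∀ x : M, φ s t x ≠ x) := by
  rcases isEmpty_or_nonempty M with hM | hM
  -- The construction needs a point of `M` and a positive volume; on the empty manifold the constant
  -- path at the identity does.
  · let φ : ξ.Cont := ⟨Diffeomorph.refl _ M ∞, fun x => hM.elim x⟩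
    refine ⟨1, one_pos, fun _ _ => φ, fun z => hM.elim z.2.2, fun s _ t _ => ?_,
      fun t _ x => hM.elim x, fun s _ x => hM.elim x, fun s _ => ?_, fun s _ _ t _ x => hM.elim x⟩
    · exact ⟨⟨fun x => hM.elim x, fun t x => hM.elim x⟩, fun x => hM.elim x⟩
    · congr 1
      funext t x
      exact hM.elim x
  · exact ContactLF.exists_family_of_nonempty hα₀ hZoll
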